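/- For a nonempty convex open set $\Omega\subset\mathbb C$ with $\Omega\ne\mathbb C$, let \[ C(\Omega)=\sup\{\|r(A)\| \,;\, \overline{W(A)}\subset\Omega,\ |r(z)|\le 1\ \forall z\in\Omega\},\qquad C_{cb}(\Omega)=\sup\{\|R(A)\| \,;\, \overline{W(A)}\subset\Omega,\ \|R(z)\|\le 1\ \forall z\in\Omega\}. \] Here both suprema are taken over all complex Hilbert spaces $H$ and all bounded linear operators $A$ on $H$ whose numerical range $W(A)=\{\langle Ax,x\rangle \,;\, x\in H,\ \|x\|=1\}$ satisfies $\overline{W(A)}\subset\Omega$. In the first one $r$ runs over all complex rational functions without poles in $\Omega$ satisfying the stated bound. In the second one $R=(r_{ij})$ runs over all rational functions without poles in $\Omega$, with values in the complex $m\times n$ matrices, for all $m,n$, satisfying the stated bound; $\|R(z)\|$ is the operator norm for the Euclidean norms on $\mathbb C^n$ and $\mathbb C^m$, and $R(A)=(r_{ij}(A))$ is regarded as an operator from $H^n$ to $H^m$ (Hilbert space direct sums). Theorem. Let $0<\alpha\le\pi/2$, and suppose that the convex open set $\Omega\neq\mathbb C$ contains a sector of angle $2\alpha$, that is, a set $\{z\in\mathbb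 C \,;\, z\ne a,\ |\arg(e^{-i\varphi}(z-a))|<\alpha\}$ for some $a\in\mathbb C$ and $\varphi\in\mathbb R$, with $\arg$ the principal argument. Then \[ C(\Omega)\;\le\; C_{cb}(\Omega)\;\le\; 1+\frac{2}{\pi}\int_\alpha^{\pi/2}\frac{\pi-x+\sin x}{\sin x}\,dx . \] -/

import Mathlib

open scoped ENNReal

universe u

noncomputable section

namespace ConvexFunctionalCalculus

section Operators

variable {H : Type u} [NormedAddCommGroup H] [InnerProductSpace ℂ H]

/-- The numerical range `{⟨Ax, x⟩ ; ‖x‖ = 1}`. The inner product of Mathlib is linear in its second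
argument, so that `⟨Ax, x⟩` (linear in the first argument) is `inner ℂ x (A x)`. -/
def numericalRange (A : H →L[ℂ] H) : Set ℂ :=
  {w | ∃ x : H, ‖x‖ = 1 ∧ w = inner ℂ x (A x)}

/-- The operator `r(A) = p(A) q(A)⁻¹`, where `r = p / q` in lowest terms. It is the usual rational
function of `A` as soon as no pole of `r` lies in the spectrum of `A`. -/
def ratEval (r : RatFunc ℂ) (A : H →L[ℂ] H) : H →L[ℂ] H :=
  Polynomial.aeval A r.num * Ring.inverse (Polynomial.aeval A r.denom)

/-- The operator `(x₁, …, xₙ) ↦ (∑ⱼ T₁ⱼ xⱼ, …, ∑ⱼ Tₘⱼ xⱼ)` from the Hilbert space direct sum `Hⁿ`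
to the Hilbert space direct sum `Hᵐ` given by an `m × n` matrix of operators on `H`. -/
def blockOperator {m n : ℕ} (T : Fin m → Fin n → (H →L[ℂ] H)) :
    PiLp 2 (fun _ : Fin n => H) →L[ℂ] PiLp 2 (fun _ : Fin m => H) :=
  ((PiLp.continuousLinearEquiv 2 ℂ (fun _ : Fin m => H)).symm :
      (Fin m → H) →L[ℂ] PiLp 2 (fun _ : Fin m => H)) ∘L
    ContinuousLinearMap.pi fun i => ∑ j, T i j ∘L PiLp.proj 2 (fun _ : Fin n => H) j

/-- The operator `R(A) : Hⁿ → Hᵐ` for a rational function `R` with values in the complex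
`m × n` matrices. -/
def matRatEval {m n : ℕ} (R : Matrix (Fin m) (Fin n) (RatFunc ℂ)) (A : H →L[ℂ] H) :
    PiLp 2 (fun _ : Fin n => H) →L[ℂ] PiLp 2 (fun _ : Fin m => H) :=
  blockOperator fun i j => ratEval (R i j) A

end Operators

/-- `r` has no pole in `Ω`. -/
def NoPoleIn (r : RatFunc ℂ) (Ω : Set ℂ) : Prop :=
  ∀ z ∈ Ω, r.denom.eval z ≠ 0

/-- The rational function `r` is defined and bounded by `1` in `Ω`. -/
def BoundedByOne (r : RatFunc ℂ) (Ω : Set ℂ) : Prop :=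
  NoPoleIn r Ω ∧ ∀ z ∈ Ω, ‖r.eval (RingHom.id ℂ) z‖ ≤ 1

open scoped Matrix.Norms.L2Operator in
/-- The matrix valued rational function `R` is defined in `Ω` and `‖R(z)‖ ≤ 1` there, for the
operator norm of matrices that is induced by the Euclidean norms. -/
def MatBoundedByOne {m n : ℕ} (R : Matrix (Fin m) (Fin n) (RatFunc ℂ)) (Ω : Set ℂ) : Prop :=
  (∀ i j, NoPoleIn (R i j) Ω) ∧ ∀ z ∈ Ω, ‖R.map (RatFunc.eval (RingHom.id ℂ) z)‖ ≤ 1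

/-- The constant `C(Ω)`, as an element of `[0, ∞]`: the supremum of `‖r(A)‖` over all complex
Hilbert spaces `H`, all bounded operators `A` on `H` with the closure of the numerical range
contained in `Ω`, and all rational functions `r` bounded by `1` in `Ω`. -/
def C (Ω : Set ℂ) : ℝ≥0∞ :=
  ⨆ (H : Type u) (_ : NormedAddCommGroup H) (_ : InnerProductSpace ℂ H) (_ : CompleteSpace H)
    (A : H →L[ℂ] H) (_ : closure (numericalRange A) ⊆ Ω)
    (r : RatFunc ℂ) (_ : BoundedByOne r Ω), ENNReal.ofReal ‖ratEval r A‖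

/-- The constant `C_cb(Ω)`, as an element of `[0, ∞]`: the same supremum, over the rational
functions with values in the matrices of all sizes `m × n`. -/
def Ccb (Ω : Set ℂ) : ℝ≥0∞ :=
  ⨆ (H : Type u) (_ : NormedAddCommGroup H) (_ : InnerProductSpace ℂ H) (_ : CompleteSpace H)
    (A : H →L[ℂ] H) (_ : closure (numericalRange A) ⊆ Ω) (m : ℕ) (n : ℕ)
    (R : Matrix (Fin m) (Fin n) (RatFunc ℂ)) (_ : MatBoundedByOne R Ω),
    ENNReal.ofReal ‖matRatEval R A‖

/-- The open sector of angle `2α` with apex `a` whose axis has the direction `exp(iφ)`. -/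
def sector (a : ℂ) (φ α : ℝ) : Set ℂ :=
  {z | z ≠ a ∧ |Complex.arg ((z - a) * Complex.exp (-(φ * Complex.I)))| < α}

end ConvexFunctionalCalculus

end

/-!
The proof represents `R(A)` by an operator valued double layer potential and estimates the
correction term that comes from the complex conjugate of the Cauchy kernel.

A rigid motion makes the positive real axis the axis of the sector. An open convex set that
contains the cone `L |Im s| < Re s`, where `L = cot α`, is invariant under translations by the
elements of the cone (`hasRecessionCone_of_subset`). Cut off to the left, it is the region to the
right of the graph `x = φ y` of a convex function with the Lipschitz constant `L`. Smoothing
replaces `φ` by a `C²` function whose graph `γ s` still has the numerical range of `A` on its inner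
side, at a positive distance (`exists_convexGraph`). Factors that tend to one reduce the problem to
rational functions that vanish at infinity (`norm_sum_inner_le_of_hasRecessionCone`).

Let `ν s` be the conjugate of the inward normal `1 - i d1 s`, where `d1` is the slope of the graph.
Cauchy's formula expresses `R(A)` by the integral of `-(1 / 2π) R(γ) ν̄ (γ - A)⁻¹`
(`InsideGraph.cauchyIntegral_eq`). With the conjugate term `-(1 / 2π) ν (γ̄ - A†)⁻¹` the kernel
becomes positive, since the numerical range lies on the inner side of every tangent line, and its
integral is at most `1 + 2 arctan L / π`, because the angle under which the graph is seen from
inside is at most `π + 2 arctan L` (`InsideGraph.integral_density_le`).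

What has to be subtracted is the integral of `-(1 / 2π) R(γ) ν (γ̄ - A†)⁻¹`. On a straight line it
would vanish: the resolvent of the adjoint at `z̄` agrees on the line with the resolvent at the
conjugate of the mirror image of `z`, which is holomorphic in `z` on the inner side. For a curved
graph, moving the contour along horizontal rays leaves only the contribution of the rotation of the
tangent (`InsideGraph.integral_reflected`, which rests on `integral_boundary_eq_integral_ray`). For
each tangent line this contribution is a function of an operator with its numerical range in the
half-plane bounded by that line. There the double layer formula has no correction term and total
mass one, and the contribution is bounded by a scalar integral with the value at most
`π / 2 + |arctan d1|` (`InsideGraph.norm_integral_rayKernel_le`). Integration over all tangents,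
with the slope `v = tan β` as the variable, gives the bound
`1 + 2 β₀ / π + (1 / π) ∫ (π / 2 + |β|) / cos β`, where `|β| ≤ β₀ = π / 2 - α`
(`InsideGraph.norm_sum_inner_le`, `slopeConst_eq`).

All estimates are made for matrices: for a positive operator `M` and a matrix `F` of norm at most
one the form `∑ F i j ⟨y i, M (x j)⟩` satisfies the same bound as in the scalar case
(`norm_sum_mul_inner_le`).
-/

noncomputable section

namespace ConvexFunctionalCalculus

open MeasureTheory Set Filter Topology Polynomial
open scoped ComplexConjugate ComplexInnerProductSpace

/-! ### Transport along rays -/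

lemma integrableOn_inv_sq {c : ℝ} (hc : 0 < c) (K : ℝ) :
    IntegrableOn (fun t : ℝ => K / (c + t) ^ 2) (Ioi 0) ∧
      ∫ t in Ioi (0 : ℝ), K / (c + t) ^ 2 = K / c := by
  have hd : ∀ t ∈ Ioi (0 : ℝ), HasDerivAt (fun t : ℝ => -(c + t)⁻¹) (1 / (c + t) ^ 2) t := by
    intro t ht
    have h1 : c + t ≠ 0 := by have : (0 : ℝ) < t := ht; positivity
    have : HasDerivAt (fun t : ℝ => -(c + t)⁻¹) _ t := (((hasDerivAt_id t).const_add c).inv h1).neg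
    exact this.congr_deriv (by simp [neg_div])
  have hc' : ContinuousWithinAt (fun t : ℝ => -(c + t)⁻¹) (Ici 0) 0 := by
    apply ContinuousAt.continuousWithinAt
    apply ContinuousAt.neg
    apply ContinuousAt.inv₀ (by fun_prop)
    simpa using hc.ne'
  have hl : Tendsto (fun t : ℝ => -(c + t)⁻¹) atTop (𝓝 0) := by
    have : Tendsto (fun t : ℝ => (c + t)⁻¹) atTop (𝓝 0) :=
      tendsto_inv_atTop_zero.comp (tendsto_atTop_add_const_left _ c tendsto_id)
    simpa using this.neg
  have hn : ∀ t ∈ Ioi (0 : ℝ), 0 ≤ 1 / (c + t) ^ 2 := fun t _ => by positivity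
  have h1 := integrableOn_Ioi_deriv_of_nonneg hc' hd hn hl
  have h2 := integral_Ioi_of_hasDerivAt_of_nonneg hc' hd hn hl
  have he : (fun t : ℝ => K / (c + t) ^ 2) = fun t => K * (1 / (c + t) ^ 2) := by
    ext t; ring
  rw [he]
  refine ⟨h1.const_mul K, ?_⟩
  rw [integral_const_mul, h2]
  simp [div_eq_mul_inv]

lemma integrable_inv_one_add_abs_sq (K : ℝ) :
    Integrable (fun y : ℝ => K / (1 + |y|) ^ 2) := by
  have h := integrable_one_add_norm (E := ℝ) (μ := volume) (r := 2) (by simp)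
  refine (h.const_mul K).congr (Eventually.of_forall fun y => ?_)
  have : (0 : ℝ) < 1 + ‖y‖ := by positivity
  simp only [Real.norm_eq_abs]
  norm_cast

/-- If the derivatives of `F` in `y` and in `t` differ, after weighting by `a y`, by the integrable
remainder `E`, then the boundary values of `F` at `t = 0` are balanced by `E`: the integral of `F
y` along the ray `t > 0` has the derivative `∫ E - a F(·, 0)` and vanishes at both ends. With `E =
0` and `a y` the velocity of the boundary curve, this is Cauchy's theorem for functions holomorphic
in the region swept out by the rays. -/
theorem integral_boundary_eq_integral_ray {F Fy Ft E : ℝ → ℝ → ℂ} {a : ℝ → ℂ} {B : ℝ → ℝ} {K Ca : ℝ}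
    (hy : ∀ y t, 0 ≤ t → HasDerivAt (fun y => F y t) (Fy y t) y)
    (ht : ∀ y t, 0 ≤ t → HasDerivAt (F y) (Ft y t) t)
    (hE : ∀ y t, 0 ≤ t → Fy y t = a y * Ft y t + E y t)
    (hF : ∀ y t, 0 ≤ t → ‖F y t‖ ≤ K / (1 + |y| + t) ^ 2)
    (hFy : ∀ y t, 0 ≤ t → ‖Fy y t‖ ≤ K / (1 + |y| + t) ^ 2)
    (hFt : ∀ y t, 0 ≤ t → ‖Ft y t‖ ≤ K / (1 + |y| + t) ^ 2)
    (hcy : ∀ y, ContinuousOn (Fy y) (Ioi 0)) (hct : ∀ y, ContinuousOn (Ft y) (Ioi 0))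
    (ha : Continuous a) (hCa : ∀ y, ‖a y‖ ≤ Ca)
    (hEB : ∀ y, ‖∫ t in Ioi (0 : ℝ), E y t‖ ≤ B y) (hB : Integrable B) :
    (Integrable fun y => ∫ t in Ioi (0 : ℝ), E y t) ∧
      ∫ y, a y * F y 0 = ∫ y, ∫ t in Ioi (0 : ℝ), E y t := by
  have hpos : ∀ y : ℝ, 0 < 1 + |y| := fun y => by positivity
  have hK : 0 ≤ K := by
    have := (norm_nonneg _).trans (hF 0 0 le_rfl)
    simpa using this
  have hcF : ∀ y, ContinuousOn (F y) (Ici 0) := fun y t h0 =>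
    (ht y t h0).continuousAt.continuousWithinAt
  have intF : ∀ (G : ℝ → ℝ → ℂ), (∀ y, ContinuousOn (G y) (Ioi 0)) →
      (∀ y t, 0 ≤ t → ‖G y t‖ ≤ K / (1 + |y| + t) ^ 2) → ∀ y, IntegrableOn (G y) (Ioi 0) := by
    intro G hG hb y
    refine (integrableOn_inv_sq (hpos y) K).1.mono' ((hG y).aestronglyMeasurable measurableSet_Ioi)
        ?_
    filter_upwards [ae_restrict_mem measurableSet_Ioi] with t h0
    exact hb y t (le_of_lt h0)
  have iF := intF F (fun y => (hcF y).mono Ioi_subset_Ici_self) hF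
  have iFy := intF Fy hcy hFy
  have iFt := intF Ft hct hFt
  -- the integral along the ray, whose derivative is integrated over `y` below
  set Φ : ℝ → ℂ := fun y => ∫ t in Ioi (0 : ℝ), F y t with hΦ
  have hΦ' : ∀ y, HasDerivAt Φ (∫ t in Ioi (0 : ℝ), Fy y t) y := by
    intro y
    refine (hasDerivAt_integral_of_dominated_loc_of_deriv_le (s := univ)
        (bound := fun t => K / (1 + t) ^ 2)
      univ_mem ?_ (iF y) (iFy y).aestronglyMeasurable ?_ (integrableOn_inv_sq one_pos K).1 ?_).2
    · exact Eventually.of_forall fun y => (iF y).aestronglyMeasurable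
    · filter_upwards [ae_restrict_mem measurableSet_Ioi] with t h0 y _
      have h0' : (0 : ℝ) < t := h0
      refine (hFy y t h0'.le).trans ?_
      have : 1 + t ≤ 1 + |y| + t := by linarith [abs_nonneg y]
      gcongr
    · filter_upwards [ae_restrict_mem measurableSet_Ioi] with t h0 y _
      exact hy y t (le_of_lt h0)
  have hlim : ∀ l : Filter ℝ, Tendsto (fun y : ℝ => |y|) l atTop → Tendsto Φ l (𝓝 0) := by
    intro l hl
    have h1 : Tendsto (fun y : ℝ => K / (1 + |y|)) l (𝓝 0) :=
      tendsto_const_nhds.div_atTop (tendsto_atTop_add_const_left _ 1 hl)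
    refine squeeze_zero_norm (fun y => ?_) h1
    rw [← (integrableOn_inv_sq (hpos y) K).2]
    refine norm_integral_le_of_norm_le (integrableOn_inv_sq (hpos y) K).1 ?_
    filter_upwards [ae_restrict_mem measurableSet_Ioi] with t h0
    exact hF y t (le_of_lt h0)
  -- the boundary term of the integration in `t`
  have hintFt : ∀ y, ∫ t in Ioi (0 : ℝ), Ft y t = - F y 0 := by
    intro y
    have hl : Tendsto (F y) atTop (𝓝 0) := by
      have h1 : Tendsto (fun t : ℝ => K / (1 + |y| + t) ^ 2) atTop (𝓝 0) :=
        tendsto_const_nhds.div_atTop ((tendsto_pow_atTop two_ne_zero).comp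
          (tendsto_atTop_add_const_left _ _ tendsto_id))
      refine squeeze_zero_norm' ?_ h1
      filter_upwards [eventually_ge_atTop 0] with t h0
      exact hF y t h0
    have := integral_Ioi_of_hasDerivAt_of_tendsto (hcF y 0 self_mem_Ici)
      (fun t h0 => ht y t (le_of_lt h0)) (iFt y) hl
    rw [this]; simp
  have hderiv : ∀ y, ∫ t in Ioi (0 : ℝ), Fy y t = -(a y * F y 0) + ∫ t in Ioi (0 : ℝ), E y t := by
    intro y
    have iE : ∫ t in Ioi (0 : ℝ), E y t = ∫ t in Ioi (0 : ℝ), (Fy y t - a y * Ft y t) :=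
      setIntegral_congr_fun measurableSet_Ioi fun t h0 => by
        simp only [hE y t (le_of_lt h0)]; ring
    rw [iE, integral_sub (iFy y) ((iFt y).const_mul _), integral_const_mul, hintFt]
    ring
  have cF0 : Continuous fun y => F y 0 :=
    continuous_iff_continuousAt.2 fun y => (hy y 0 le_rfl).continuousAt
  have iaF : Integrable fun y => a y * F y 0 := by
    refine (integrable_inv_one_add_abs_sq (Ca * K)).mono' (by fun_prop)
        (Eventually.of_forall fun y => ?_)
    rw [norm_mul, mul_div_assoc]
    have := hF y 0 le_rfl
    rw [add_zero] at this
    exact mul_le_mul (hCa y) this (norm_nonneg _) ((norm_nonneg _).trans (hCa y))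
  have hEd : (fun y => ∫ t in Ioi (0 : ℝ), E y t) = fun y => deriv Φ y + a y * F y 0 := by
    ext y; rw [(hΦ' y).deriv, hderiv]; ring
  have iE : Integrable fun y => ∫ t in Ioi (0 : ℝ), E y t := by
    refine hB.mono' ?_ (Eventually.of_forall hEB)
    rw [hEd]
    exact ((measurable_deriv Φ).aestronglyMeasurable).add (by fun_prop)
  have key := integral_of_hasDerivAt_of_tendsto (f := Φ)
    (f' := fun y => -(a y * F y 0) + ∫ t in Ioi (0 : ℝ), E y t) (m := 0) (n := 0)
    (fun y => by simpa only [hderiv y] using hΦ' y) (iaF.neg.add iE)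
    (hlim _ tendsto_abs_atBot_atTop) (hlim _ tendsto_abs_atTop_atTop)
  have h2 := integral_add iaF.neg iE
  simp only [Pi.neg_apply, integral_neg] at h2
  rw [h2] at key
  exact ⟨iE, by linear_combination -key⟩

/-! ### Regions to the right of a convex graph -/

/-- A convex `C²` function `fn : ℝ → ℝ` with first and second derivatives `d1` and `d2`, where
`|d1| ≤ L` and `0 ≤ d2 ≤ Q`. It encodes the convex region `{z ; fn (Im z) < Re z}`. -/
structure ConvexGraph where
  fn : ℝ → ℝ
  d1 : ℝ → ℝ
  d2 : ℝ → ℝ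
  L : ℝ
  Q : ℝ
  hasDerivAt_fn : ∀ y, HasDerivAt fn (d1 y) y
  hasDerivAt_d1 : ∀ y, HasDerivAt d1 (d2 y) y
  continuous_d2 : Continuous d2
  d2_nonneg : ∀ y, 0 ≤ d2 y
  d2_le : ∀ y, d2 y ≤ Q
  abs_d1_le : ∀ y, |d1 y| ≤ L

namespace ConvexGraph

variable (G : ConvexGraph)

/-- The boundary point of the region at height `y`. -/
def pt (y : ℝ) : ℂ := G.fn y + y * Complex.I

/-- The complex conjugate of the inward normal vector `1 - i d1 y` at the boundary point `pt y`. -/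
def nb (y : ℝ) : ℂ := 1 + G.d1 y * Complex.I

/-- The reflection in the tangent line at `pt y` maps `pt y + t` to the complex conjugate
of `conj (pt y) + t * kap y`. -/
def kap (y : ℝ) : ℂ := -G.nb y / conj (G.nb y)

@[simp] lemma pt_re (y : ℝ) : (G.pt y).re = G.fn y := by simp [pt]
@[simp] lemma pt_im (y : ℝ) : (G.pt y).im = y := by simp [pt]
@[simp] lemma nb_re (y : ℝ) : (G.nb y).re = 1 := by simp [nb]
@[simp] lemma nb_im (y : ℝ) : (G.nb y).im = G.d1 y := by simp [nb]

lemma nb_ne (y : ℝ) : G.nb y ≠ 0 := fun h => by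
  have := congrArg Complex.re h
  simp at this

lemma conj_nb_ne (y : ℝ) : conj (G.nb y) ≠ 0 := by simpa using G.nb_ne y

lemma L_nonneg : 0 ≤ G.L := (abs_nonneg _).trans (G.abs_d1_le 0)

lemma norm_nb_le (y : ℝ) : ‖G.nb y‖ ≤ 1 + G.L := by
  refine (norm_add_le _ _).trans ?_
  simpa using G.abs_d1_le y

lemma normSq_nb (y : ℝ) : ‖G.nb y‖ ^ 2 = 1 + G.d1 y ^ 2 := by
  rw [← Complex.normSq_eq_norm_sq, Complex.normSq_apply]; simp; ring

lemma one_le_norm_nb (y : ℝ) : 1 ≤ ‖G.nb y‖ := by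
  have := Complex.re_le_norm (G.nb y); simpa using this

lemma norm_kap (y : ℝ) : ‖G.kap y‖ = 1 := by
  rw [kap, norm_div, norm_neg, Complex.norm_conj, div_self]
  simpa using G.nb_ne y

lemma continuous_fn : Continuous G.fn :=
  continuous_iff_continuousAt.2 fun y => (G.hasDerivAt_fn y).continuousAt

lemma continuous_d1 : Continuous G.d1 :=
  continuous_iff_continuousAt.2 fun y => (G.hasDerivAt_d1 y).continuousAt

lemma continuous_pt : Continuous G.pt := by
  have := G.continuous_fn
  unfold pt; fun_prop

lemma continuous_nb : Continuous G.nb := by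
  have := G.continuous_d1
  unfold nb; fun_prop

lemma continuous_conj_nb : Continuous fun y => conj (G.nb y) :=
  Complex.continuous_conj.comp G.continuous_nb

lemma hasDerivAt_pt (y : ℝ) : HasDerivAt G.pt (Complex.I * conj (G.nb y)) y := by
  have h1 := (G.hasDerivAt_fn y).ofReal_comp
  have h2 := ((hasDerivAt_id y).ofReal_comp).mul_const Complex.I
  refine (h1.add h2).congr_deriv ?_
  simp only [nb, map_add, map_one, map_mul, Complex.conj_ofReal, Complex.conj_I]
  push_cast
  linear_combination (G.d1 y : ℂ) * Complex.I_mul_I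

lemma hasDerivAt_conj_pt (y : ℝ) :
    HasDerivAt (fun y => conj (G.pt y)) (-Complex.I * G.nb y) y := by
  refine (G.hasDerivAt_pt y).star.congr_deriv ?_
  simp

lemma hasDerivAt_nb (y : ℝ) : HasDerivAt G.nb (G.d2 y * Complex.I) y :=
  (((G.hasDerivAt_d1 y).ofReal_comp).mul_const Complex.I).const_add 1

lemma hasDerivAt_kap (y : ℝ) :
    HasDerivAt G.kap (-2 * Complex.I * G.d2 y / conj (G.nb y) ^ 2) y := by
  have h1 := G.hasDerivAt_nb y
  have h2 : HasDerivAt (fun y => conj (G.nb y)) _ y := h1.star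
  refine (h1.neg.div h2 (G.conj_nb_ne y)).congr_deriv ?_
  congr 1
  simp only [Pi.neg_apply, nb, map_add, map_one, map_mul, Complex.conj_ofReal, Complex.conj_I,
      RCLike.star_def]
  ring

lemma kap_mul (y : ℝ) : G.kap y * (Complex.I * conj (G.nb y)) = -Complex.I * G.nb y := by
  have := G.conj_nb_ne y
  rw [kap]; field_simp

lemma monotone_d1 : Monotone G.d1 :=
  monotone_of_deriv_nonneg (fun y => (G.hasDerivAt_d1 y).differentiableAt)
    fun y => by rw [(G.hasDerivAt_d1 y).deriv]; exact G.d2_nonneg y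

lemma convexOn_fn : ConvexOn ℝ univ G.fn := by
  have h : deriv G.fn = G.d1 := funext fun y => (G.hasDerivAt_fn y).deriv
  exact MonotoneOn.convexOn_of_deriv convex_univ G.continuous_fn.continuousOn
    (fun y _ => (G.hasDerivAt_fn y).differentiableAt.differentiableWithinAt)
    (by rw [h]; exact G.monotone_d1.monotoneOn _)

lemma tangent_le (y v : ℝ) : G.fn y + G.d1 y * (v - y) ≤ G.fn v := by
  rcases lt_trichotomy y v with h | h | h
  · have := G.convexOn_fn.le_slope_of_hasDerivAt (mem_univ y) (mem_univ v) h (G.hasDerivAt_fn y)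
    rw [slope_def_field, le_div_iff₀ (by linarith)] at this
    linarith
  · simp [h]
  · have := G.convexOn_fn.slope_le_of_hasDerivAt (mem_univ v) (mem_univ y) h (G.hasDerivAt_fn y)
    rw [slope_def_field, div_le_iff₀ (by linarith)] at this
    linarith

lemma abs_fn_sub_le (y v : ℝ) : |G.fn v - G.fn y| ≤ G.L * |v - y| := by
  have h1 := G.tangent_le y v
  have h2 := G.tangent_le v y
  have h3 : ∀ u w : ℝ, |G.d1 u * w| ≤ G.L * |w| := fun u w => by
    rw [abs_mul]; exact mul_le_mul_of_nonneg_right (G.abs_d1_le u) (abs_nonneg _)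
  have h4 := abs_le.1 (h3 y (v - y))
  have h5 := abs_le.1 (h3 v (y - v))
  rw [abs_sub_comm y v] at h5
  rw [abs_le]
  constructor <;> linarith

/-- Points at signed horizontal distance `t` from the boundary point at height `y` grow
linearly in `1 + |y| + |t|`. -/
lemma exists_growth : ∃ c > 0, ∀ y t : ℝ, c * (1 + |y| + |t|) ≤ 1 + ‖G.pt y + t‖ := by
  have hL := G.L_nonneg
  refine ⟨(3 + G.L + |G.fn 0|)⁻¹, by positivity, fun y t => ?_⟩
  rw [inv_mul_le_iff₀ (by positivity)]
  have h1 : |y| ≤ ‖G.pt y + t‖ := by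
    have := Complex.abs_im_le_norm (G.pt y + t); simpa using this
  have h2 : |G.fn y + t| ≤ ‖G.pt y + t‖ := by
    have := Complex.abs_re_le_norm (G.pt y + t); simpa using this
  have h3 := G.abs_fn_sub_le 0 y
  rw [sub_zero] at h3
  have h4 : |t| ≤ |G.fn y + t| + (|G.fn y - G.fn 0| + |G.fn 0|) := by
    calc |t| = |(G.fn y + t) - ((G.fn y - G.fn 0) + G.fn 0)| := by congr 1; ring
      _ ≤ _ := (abs_sub _ _).trans (by gcongr; exact abs_add_le _ _)
  have h5 : G.L * |y| ≤ G.L * ‖G.pt y + t‖ := mul_le_mul_of_nonneg_left h1 hL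
  nlinarith [mul_nonneg (abs_nonneg (G.fn 0)) (norm_nonneg (G.pt y + t)), norm_nonneg (G.pt y + t)]

end ConvexGraph

/-! ### Resolvents -/

section Resolvent

variable {H : Type u} [NormedAddCommGroup H] [InnerProductSpace ℂ H]

lemma sub_apply_resolvent {A : H →L[ℂ] H} {z : ℂ} (hz : z ∈ resolventSet ℂ A) (x : H) :
    z • resolvent A z x - A (resolvent A z x) = x := by
  have := DFunLike.congr_fun (Ring.mul_inverse_cancel _ hz) x
  simpa [Algebra.algebraMap_eq_smul_one, resolvent] using this

lemma resolvent_sub_apply {A : H →L[ℂ] H} {z : ℂ} (hz : z ∈ resolventSet ℂ A) (x : H) :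
    z • resolvent A z x - resolvent A z (A x) = x := by
  have := DFunLike.congr_fun (Ring.inverse_mul_cancel _ hz) x
  simpa [Algebra.algebraMap_eq_smul_one, resolvent] using this

lemma norm_inner_apply_le (A : H →L[ℂ] H) (x : H) : ‖⟪x, A x⟫‖ ≤ ‖A‖ * ‖x‖ ^ 2 := by
  refine (norm_inner_le_norm _ _).trans ?_
  have := A.le_opNorm x
  nlinarith [norm_nonneg x]

variable [CompleteSpace H]

lemma mem_resolventSet_of_le {A : H →L[ℂ] H} {z : ℂ} {c : ℝ} (hc : 0 < c)
    (h : ∀ x, c * ‖x‖ ^ 2 ≤ ‖z * ‖x‖ ^ 2 - ⟪x, A x⟫‖) :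
    z ∈ resolventSet ℂ A ∧ ‖resolvent A z‖ ≤ 1 / c := by
  have key : ∀ x, c * ‖x‖ ^ 2 ≤ ‖⟪x, (algebraMap ℂ (H →L[ℂ] H) z - A) x⟫‖ := fun x => by
    refine (h x).trans_eq ?_
    congr 1
    simp [Algebra.algebraMap_eq_smul_one, inner_self_eq_norm_sq_to_K]
  have hu : IsUnit (algebraMap ℂ (H →L[ℂ] H) z - A) := by
    refine ContinuousLinearMap.isUnit_of_forall_le_norm_inner_map _ (c := ⟨c, hc.le⟩) hc fun x => ?_
    rw [norm_inner_symm, mul_comm]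
    exact key x
  refine ⟨hu, ContinuousLinearMap.opNorm_le_bound _ (by positivity) fun x => ?_⟩
  set v := resolvent A z x with hv
  have h1 : (algebraMap ℂ (H →L[ℂ] H) z - A) v = x := by
    have := Ring.mul_inverse_cancel _ hu
    exact DFunLike.congr_fun this x
  have h2 := key v
  rw [h1] at h2
  have h3 := h2.trans (norm_inner_le_norm v x)
  rw [div_mul_eq_mul_div, one_mul, le_div_iff₀ hc]
  rcases eq_or_lt_of_le (norm_nonneg v) with h0 | h0
  · rw [← h0]; simp
  · nlinarith

lemma hasDerivAt_inner_resolvent {A : H →L[ℂ] H} {z : ℂ} (hz : z ∈ resolventSet ℂ A) (x y : H) :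
    HasDerivAt (fun z => ⟪y, resolvent A z x⟫) (-⟪y, resolvent A z (resolvent A z x)⟫) z := by
  have h := spectrum.hasDerivAt_resolvent_const_left (𝕜 := ℂ) hz
  have h2 : HasDerivAt (fun z => innerSL ℂ y (resolvent A z x)) _ z :=
    ((innerSL ℂ y).hasFDerivAt.comp_hasDerivAt z
      ((ContinuousLinearMap.apply ℂ H x).hasFDerivAt.comp_hasDerivAt z h))
  refine h2.congr_deriv ?_
  simp [pow_two]

/-- A lower bound `max a (r - m)` is comparable with `1 + r`. -/
lemma mul_one_add_le_of_le {a m r v : ℝ} (ha : 0 < a) (hm : 0 ≤ m) (h1 : a ≤ v)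
    (h2 : r - m ≤ v) : a / (a + m + 1) * (1 + r) ≤ v := by
  rw [div_mul_eq_mul_div, div_le_iff₀ (by positivity)]
  rcases le_total r (m + a) with h | h
  · nlinarith
  · nlinarith [mul_nonneg (sub_nonneg.2 h) hm]

/-- The numerical range of `A` lies at distance at least `η`, measured along the inward normals,
on the inner side of every tangent line of the graph `G`. -/
def InsideGraph (G : ConvexGraph) (A : H →L[ℂ] H) (η : ℝ) : Prop :=
  ∀ y x, η * ‖x‖ ^ 2 ≤ (G.nb y * (⟪x, A x⟫ - G.pt y * ‖x‖ ^ 2)).re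

variable {G : ConvexGraph} {A : H →L[ℂ] H} {η : ℝ}

/-- Outside the region the resolvent decays like the inverse of the distance to the origin. -/
lemma InsideGraph.resolvent_bound (hA : InsideGraph G A η) (hη : 0 < η) :
    ∃ K, ∀ y t : ℝ, 0 ≤ t → (G.pt y - t) ∈ resolventSet ℂ A ∧
      ‖resolvent A (G.pt y - t)‖ ≤ K / (1 + |y| + t) := by
  obtain ⟨c, hc, hg⟩ := G.exists_growth
  have hL := G.L_nonneg
  set a := η / (1 + G.L) with ha
  have ha0 : 0 < a := by positivity
  set θ := a / (a + ‖A‖ + 1) with hθ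
  have hθ0 : 0 < θ := by positivity
  refine ⟨1 / (θ * c), fun y t ht => ?_⟩
  have hpos : 0 < 1 + |y| + t := by positivity
  have := mem_resolventSet_of_le (A := A) (z := G.pt y - t) (c := θ * c * (1 + |y| + t))
      (by positivity) ?_
  · rwa [← div_div] at this
  intro x
  have h1 : a * ‖x‖ ^ 2 ≤ ‖(G.pt y - t) * ‖x‖ ^ 2 - ⟪x, A x⟫‖ := by
    have h2 := hA y x
    have h3 := Complex.re_le_norm (G.nb y * (⟪x, A x⟫ - (G.pt y - t) * ‖x‖ ^ 2))
    have h4 : (G.nb y * (⟪x, A x⟫ - (G.pt y - t) * ‖x‖ ^ 2)).re =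
        (G.nb y * (⟪x, A x⟫ - G.pt y * ‖x‖ ^ 2)).re + t * ‖x‖ ^ 2 := by
      have : G.nb y * (⟪x, A x⟫ - (G.pt y - t) * ‖x‖ ^ 2) =
        G.nb y * (⟪x, A x⟫ - G.pt y * ‖x‖ ^ 2) + ((t * ‖x‖ ^ 2 : ℝ) : ℂ) * G.nb y := by
          push_cast; ring
      rw [this, Complex.add_re, Complex.re_ofReal_mul]; simp
    rw [norm_mul, norm_sub_rev] at h3
    have h5 := mul_le_mul_of_nonneg_right (G.norm_nb_le y)
        (norm_nonneg ((G.pt y - t) * ‖x‖ ^ 2 - ⟪x, A x⟫))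
    have h6 : 0 ≤ t * ‖x‖ ^ 2 := by positivity
    rw [ha, div_mul_eq_mul_div, div_le_iff₀ (by positivity)]
    linarith
  have h2 : (‖G.pt y - t‖ - ‖A‖) * ‖x‖ ^ 2 ≤ ‖(G.pt y - t) * ‖x‖ ^ 2 - ⟪x, A x⟫‖ := by
    refine le_trans ?_ (norm_sub_norm_le _ _)
    have := norm_inner_apply_le A x
    simp only [norm_mul, norm_pow, Complex.norm_real, norm_norm]
    linarith
  have h3 := hg y (-t)
  rw [abs_neg, abs_of_nonneg ht] at h3
  push_cast at h3
  rw [← sub_eq_add_neg] at h3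
  rcases eq_or_ne x 0 with rfl | hx
  · simp
  have hx0 : 0 < ‖x‖ ^ 2 := by positivity
  rw [← le_div_iff₀ hx0] at h1 h2 ⊢
  have h4 := mul_one_add_le_of_le ha0 (norm_nonneg A) h1 h2
  refine le_trans ?_ h4
  rw [mul_assoc]
  exact mul_le_mul_of_nonneg_left h3 hθ0.le

/-- At the reflected points the resolvent of the adjoint decays as well: reflection in a tangent
line moves the outer points away from the numerical range. -/
lemma InsideGraph.adjoint_resolvent_bound (hA : InsideGraph G A η) (hη : 0 < η) :
    ∃ K, ∀ y t : ℝ, 0 ≤ t → (conj (G.pt y) + t * G.kap y) ∈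
        resolventSet ℂ (ContinuousLinearMap.adjoint A) ∧
      ‖resolvent (ContinuousLinearMap.adjoint A) (conj (G.pt y) + t * G.kap y)‖ ≤ K /
          (1 + |y| + t) := by
  obtain ⟨c, hc, hg⟩ := G.exists_growth
  have hL := G.L_nonneg
  set a := η / (1 + G.L) with ha
  have ha0 : 0 < a := by positivity
  set θ := a / (a + ‖A‖ + 1) with hθ
  have hθ0 : 0 < θ := by positivity
  refine ⟨1 / (θ * c), fun y t ht => ?_⟩
  have hpos : 0 < 1 + |y| + t := by positivity
  have := mem_resolventSet_of_le (A := ContinuousLinearMap.adjoint A)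
      (z := conj (G.pt y) + t * G.kap y)
    (c := θ * c * (1 + |y| + t)) (by positivity) ?_
  · rwa [← div_div] at this
  intro x
  set w := ⟪x, A x⟫ with hw
  have hw' : ⟪x, ContinuousLinearMap.adjoint A x⟫ = conj w := by
    rw [ContinuousLinearMap.adjoint_inner_right, hw, inner_conj_symm]
  rw [hw']
  set s : ℝ := ‖x‖ ^ 2 with hs
  have hs0 : 0 ≤ s := by positivity
  set e := G.nb y * (w - G.pt y * s) with he
  have hre : η * s ≤ e.re := by
    have := hA y x
    simpa only [he, hs, hw, Complex.ofReal_pow] using this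
  have h0 : ‖(conj (G.pt y) + t * G.kap y) * (‖x‖ : ℂ) ^ 2 - conj w‖ * ‖G.nb y‖ = ‖e + (t * s : ℝ) *
      conj (G.nb y)‖ := by
    rw [← Complex.norm_conj (e + _), ← Complex.norm_conj (G.nb y), ← norm_mul, ← norm_neg]
    congr 1
    have := G.conj_nb_ne y
    simp only [he, hs, map_add, map_mul, map_sub, Complex.conj_conj, Complex.conj_ofReal,
        ConvexGraph.kap]
    field_simp
    push_cast
    ring
  have h1 : a * s ≤ ‖(conj (G.pt y) + t * G.kap y) * (‖x‖ : ℂ) ^ 2 - conj w‖ := by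
    have h3 := Complex.re_le_norm (e + (t * s : ℝ) * conj (G.nb y))
    rw [← h0, Complex.add_re, Complex.re_ofReal_mul] at h3
    simp only [Complex.conj_re, ConvexGraph.nb_re, mul_one] at h3
    have h5 := mul_le_mul_of_nonneg_left (G.norm_nb_le y)
      (norm_nonneg ((conj (G.pt y) + t * G.kap y) * (‖x‖ : ℂ) ^ 2 - conj w))
    have h6 : 0 ≤ t * s := by positivity
    rw [ha, div_mul_eq_mul_div, div_le_iff₀ (by positivity)]
    linarith
  have h2 : (‖G.pt y + t‖ - ‖A‖) * s ≤ ‖(conj (G.pt y) + t * G.kap y) * (‖x‖ : ℂ) ^ 2 -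
      conj w‖ := by
    have h3 : ‖(G.pt y + t) * s - w‖ * ‖G.nb y‖ = ‖e - (t * s : ℝ) * G.nb y‖ := by
      rw [← norm_mul, ← norm_neg]
      congr 1
      simp only [he]; push_cast; ring
    have h4 : ‖e - (t * s : ℝ) * G.nb y‖ ≤ ‖e + (t * s : ℝ) * conj (G.nb y)‖ := by
      rw [← sq_le_sq₀ (norm_nonneg _) (norm_nonneg _), ← Complex.normSq_eq_norm_sq,
        ← Complex.normSq_eq_norm_sq, Complex.normSq_apply, Complex.normSq_apply]
      simp only [Complex.sub_re, Complex.add_re, Complex.sub_im, Complex.add_im,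
        Complex.re_ofReal_mul, Complex.im_ofReal_mul, Complex.conj_re, Complex.conj_im,
        ConvexGraph.nb_re, ConvexGraph.nb_im]
      have : 0 ≤ (t * s) * e.re := mul_nonneg (by positivity) (le_trans (by positivity) hre)
      nlinarith
    rw [← h3, ← h0] at h4
    have h5 := le_of_mul_le_mul_right h4 (lt_of_lt_of_le one_pos (G.one_le_norm_nb y))
    refine le_trans ?_ h5
    refine le_trans ?_ (norm_sub_norm_le _ _)
    have := norm_inner_apply_le A x
    rw [← hw, ← hs] at this
    rw [norm_mul, Complex.norm_real, Real.norm_of_nonneg hs0]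
    linarith
  have h3 := hg y t
  rw [abs_of_nonneg ht] at h3
  rcases eq_or_ne x 0 with rfl | hx
  · simp [hs]
  have hx0 : 0 < s := by positivity
  rw [← le_div_iff₀ hx0] at h1 h2 ⊢
  have h4 := mul_one_add_le_of_le ha0 (norm_nonneg A) h1 h2
  refine le_trans ?_ h4
  rw [mul_assoc]
  exact mul_le_mul_of_nonneg_left h3 hθ0.le

end Resolvent

/-! ### Rational functions without poles in the closed region -/

/-- The quotient of two polynomials as a function; its value at the zeros of `D` is `0`, but it is
only evaluated elsewhere. -/
def polyQuot (p D : ℂ[X]) (z : ℂ) : ℂ := p.eval z / D.eval z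

lemma exists_norm_eval_le (p : ℂ[X]) {n : ℕ} (hn : p.natDegree ≤ n) :
    ∃ K, 0 ≤ K ∧ ∀ z, ‖p.eval z‖ ≤ K * (1 + ‖z‖) ^ n := by
  refine ⟨∑ i ∈ Finset.range (p.natDegree + 1), ‖p.coeff i‖, by positivity, fun z => ?_⟩
  rw [eval_eq_sum_range, Finset.sum_mul]
  refine (norm_sum_le _ _).trans (Finset.sum_le_sum fun i hi => ?_)
  rw [norm_mul, norm_pow]
  gcongr
  calc ‖z‖ ^ i ≤ (1 + ‖z‖) ^ i := by gcongr; linarith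
    _ ≤ (1 + ‖z‖) ^ n := pow_le_pow_right₀ (by linarith [norm_nonneg z])
        ((Nat.lt_succ_iff.1 (Finset.mem_range.1 hi)).trans hn)

namespace ConvexGraph

variable (G : ConvexGraph)

/-- The closed region to the right of the graph. -/
def region : Set ℂ := {z | G.fn z.im ≤ z.re}

/-- All zeros of `D` lie strictly to the left of the graph. -/
def RootsOutside (D : ℂ[X]) : Prop := D ≠ 0 ∧ ∀ w, D.eval w = 0 → w.re < G.fn w.im

variable {G}

lemma pt_add_mem (y : ℝ) {t : ℝ} (ht : 0 ≤ t) : G.pt y + t ∈ G.region := by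
  simp [region, ht]

lemma pt_mem (y : ℝ) : G.pt y ∈ G.region := by simp [region]

lemma exists_le_norm_sub {w : ℂ} (hw : w.re < G.fn w.im) :
    ∃ c > 0, ∀ z ∈ G.region, c * (1 + ‖z‖) ≤ ‖z - w‖ := by
  have hL := G.L_nonneg
  set a := (G.fn w.im - w.re) / (1 + G.L) with ha
  have ha0 : 0 < a := div_pos (by linarith) (by positivity)
  refine ⟨a / (a + ‖w‖ + 1), by positivity, fun z hz => ?_⟩
  refine mul_one_add_le_of_le ha0 (norm_nonneg w) ?_ (norm_sub_norm_le _ _)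
  rw [ha, div_le_iff₀ (by positivity)]
  have h1 := (abs_le.1 (G.abs_fn_sub_le z.im w.im)).2
  have h2 := Complex.abs_re_le_norm (z - w)
  have h3 := Complex.abs_im_le_norm (z - w)
  rw [Complex.sub_re] at h2
  rw [Complex.sub_im, abs_sub_comm] at h3
  have h4 : G.fn z.im ≤ z.re := hz
  have h5 := mul_le_mul_of_nonneg_left h3 hL
  have h6 := le_abs_self (z.re - w.re)
  linarith

/-- On the closed region `D` grows like the leading power, as each of its linear factors does. -/
lemma RootsOutside.exists_le_norm_eval {D : ℂ[X]} (hD : G.RootsOutside D) :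
    ∃ c > 0, ∀ z ∈ G.region, c * (1 + ‖z‖) ^ D.natDegree ≤ ‖D.eval z‖ := by
  have key : ∀ s : Multiset ℂ, (∀ w ∈ s, w.re < G.fn w.im) → ∃ c > 0, ∀ z ∈ G.region,
      c * (1 + ‖z‖) ^ s.card ≤ ‖((s.map fun w => X - Polynomial.C w).prod).eval z‖ := by
    intro s
    induction s using Multiset.induction_on with
    | empty => exact fun _ => ⟨1, one_pos, fun z _ => by simp⟩
    | cons w s ih =>
      intro h
      obtain ⟨c, hc, h1⟩ := ih fun v hv => h v (Multiset.mem_cons_of_mem hv)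
      obtain ⟨c', hc', h2⟩ := exists_le_norm_sub (h w (Multiset.mem_cons_self w s))
      refine ⟨c' * c, by positivity, fun z hz => ?_⟩
      have := mul_le_mul (h2 z hz) (h1 z hz) (by positivity) (norm_nonneg _)
      simp only [Multiset.map_cons, Multiset.prod_cons, eval_mul, norm_mul, eval_sub, eval_X,
          eval_C,
        Multiset.card_cons]
      refine le_trans (le_of_eq ?_) this
      ring
  obtain ⟨c, hc, h⟩ := key D.roots fun w hw => hD.2 w ((mem_roots hD.1).1 hw)
  have hs := (IsAlgClosed.splits D).eq_prod_roots
  refine ⟨‖D.leadingCoeff‖ * c, by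
    have := norm_pos_iff.2 (leadingCoeff_ne_zero.2 hD.1); positivity, fun z hz => ?_⟩
  have h1 : ‖D.eval z‖ = ‖D.leadingCoeff‖ *
      ‖((D.roots.map fun w => X - Polynomial.C w).prod).eval z‖ := by
    conv_lhs => rw [hs]
    rw [eval_mul, eval_C, norm_mul]
  rw [h1, mul_assoc, (IsAlgClosed.splits D).natDegree_eq_card_roots]
  exact mul_le_mul_of_nonneg_left (h z hz) (norm_nonneg _)

lemma RootsOutside.eval_ne {D : ℂ[X]} (hD : G.RootsOutside D) {z : ℂ} (hz : z ∈ G.region) :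
    D.eval z ≠ 0 := fun h => absurd (hD.2 z h) (not_lt.2 hz)

lemma RootsOutside.mul {D E : ℂ[X]} (hD : G.RootsOutside D) (hE : G.RootsOutside E) :
    G.RootsOutside (D * E) := by
  refine ⟨mul_ne_zero hD.1 hE.1, fun w hw => ?_⟩
  rw [eval_mul, mul_eq_zero] at hw
  exact hw.elim (hD.2 w) (hE.2 w)

lemma RootsOutside.of_mul_right {D E : ℂ[X]} (h : G.RootsOutside (D * E)) : G.RootsOutside E :=
  ⟨right_ne_zero_of_mul h.1, fun w hw => h.2 w (by simp [hw])⟩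

lemma RootsOutside.pow {D : ℂ[X]} (hD : G.RootsOutside D) (n : ℕ) : G.RootsOutside (D ^ n) :=
  ⟨pow_ne_zero _ hD.1, fun w hw => hD.2 w (by
    rw [eval_pow] at hw
    exact eq_zero_of_pow_eq_zero hw)⟩

lemma RootsOutside.norm_polyQuot_le {p D : ℂ[X]} (hD : G.RootsOutside D) {k : ℕ}
    (hk : p.natDegree + k ≤ D.natDegree) :
    ∃ K, ∀ y t : ℝ, 0 ≤ t → ‖polyQuot p D (G.pt y + t)‖ ≤ K / (1 + |y| + t) ^ k := by
  obtain ⟨c, hc, hg⟩ := G.exists_growth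
  obtain ⟨c', hc', hD'⟩ := hD.exists_le_norm_eval
  obtain ⟨K, hK, hp⟩ := exists_norm_eval_le p (n := D.natDegree - k) (by omega)
  refine ⟨K / (c' * c ^ k), fun y t ht => ?_⟩
  have h1 := hg y t
  rw [abs_of_nonneg ht] at h1
  have hpos : 0 < 1 + |y| + t := by positivity
  have hz := hD' _ (pt_add_mem (G := G) y ht)
  set z := G.pt y + t
  have hz0 : 0 < 1 + ‖z‖ := by positivity
  rw [polyQuot, norm_div, div_div,
      div_le_div_iff₀ (lt_of_lt_of_le (by positivity) hz) (by positivity)]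
  have e : (1 + ‖z‖) ^ D.natDegree = (1 + ‖z‖) ^ (D.natDegree - k) * (1 + ‖z‖) ^ k := by
    rw [← pow_add]; congr 1; omega
  calc ‖p.eval z‖ * (c' * c ^ k * (1 + |y| + t) ^ k)
      ≤ (K * (1 + ‖z‖) ^ (D.natDegree - k)) * (c' * (c * (1 + |y| + t)) ^ k) := by
        rw [mul_pow, mul_assoc c']; gcongr; exact hp z
    _ ≤ (K * (1 + ‖z‖) ^ (D.natDegree - k)) * (c' * (1 + ‖z‖) ^ k) := by gcongr
    _ = K * (c' * (1 + ‖z‖) ^ D.natDegree) := by rw [e]; ring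
    _ ≤ K * ‖D.eval z‖ := by gcongr

/-- The numerator of the derivative of `p / D` over the denominator `D ^ 2`. -/
def derivNum (p D : ℂ[X]) : ℂ[X] := derivative p * D - p * derivative D

lemma hasDerivAt_polyQuot {p D : ℂ[X]} {z : ℂ} (hz : D.eval z ≠ 0) :
    HasDerivAt (polyQuot p D) (polyQuot (derivNum p D) (D ^ 2) z) z := by
  refine ((p.hasDerivAt z).div (D.hasDerivAt z) hz).congr_deriv ?_
  simp [polyQuot, derivNum]

lemma natDegree_derivNum_add_le {p D : ℂ[X]} {k : ℕ} (hk : p.natDegree + k ≤ D.natDegree) :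
    (derivNum p D).natDegree + k ≤ (D ^ 2).natDegree := by
  rw [natDegree_pow]
  have h1 : (derivNum p D).natDegree ≤ p.natDegree + D.natDegree := by
    refine (natDegree_sub_le _ _).trans (max_le ?_ ?_)
    · refine natDegree_mul_le.trans ?_
      have := natDegree_derivative_le p
      omega
    · refine natDegree_mul_le.trans ?_
      have := natDegree_derivative_le D
      omega
  omega

lemma continuousOn_polyQuot {p D : ℂ[X]} (hD : G.RootsOutside D) :
    ContinuousOn (polyQuot p D) G.region := fun _ hz =>
  (hasDerivAt_polyQuot (hD.eval_ne hz)).continuousAt.continuousWithinAt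

lemma RootsOutside.continuous_polyQuot_pt {p D : ℂ[X]} (hD : G.RootsOutside D) :
    Continuous fun y => polyQuot p D (G.pt y) :=
  (continuousOn_polyQuot hD).comp_continuous G.continuous_pt fun y => pt_mem y

lemma RootsOutside.continuousOn_polyQuot_ray {p D : ℂ[X]} (hD : G.RootsOutside D) (y : ℝ) :
    ContinuousOn (fun t : ℝ => polyQuot p D (G.pt y + t)) (Ici 0) :=
  (continuousOn_polyQuot hD).comp (by fun_prop) fun _ ht => pt_add_mem y ht

/-- Cauchy's theorem for a rational function that decays like `|z| ^ (-2)` in the region; the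
contour is moved to the right along horizontal rays. -/
theorem RootsOutside.integral_polyQuot_eq_zero {p D : ℂ[X]} (hD : G.RootsOutside D)
    (hk : p.natDegree + 2 ≤ D.natDegree) :
    ∫ y, conj (G.nb y) * polyQuot p D (G.pt y) = 0 := by
  obtain ⟨K1, h1⟩ := hD.norm_polyQuot_le hk
  obtain ⟨K2, h2⟩ := (hD.pow 2).norm_polyQuot_le (natDegree_derivNum_add_le hk)
  have hL := G.L_nonneg
  set M := max K1 ((1 + G.L) * K2) with hM
  have hK2 : 0 ≤ K2 := by
    have := (norm_nonneg _).trans (h2 0 0 le_rfl); simpa using this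
  have h2' : ∀ y t : ℝ, 0 ≤ t → ‖polyQuot (derivNum p D) (D ^ 2) (G.pt y + t)‖ ≤ M /
      (1 + |y| + t) ^ 2 :=
    fun y t ht => (h2 y t ht).trans (by gcongr; exact le_trans (by nlinarith) (le_max_right _ _))
  have hd := fun (y t : ℝ) (ht : 0 ≤ t) =>
    hasDerivAt_polyQuot (p := p) (hD.eval_ne (pt_add_mem (G := G) y ht))
  have hpi : ∀ y, ‖Complex.I * conj (G.nb y)‖ ≤ 1 + G.L := fun y => by
    simpa using G.norm_nb_le y
  have key := (integral_boundary_eq_integral_ray (K := M) (Ca := 1 + G.L) (B := 0)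
      (E := fun _ _ => 0)
    (F := fun y t => polyQuot p D (G.pt y + t))
    (Ft := fun y t => polyQuot (derivNum p D) (D ^ 2) (G.pt y + t))
    (Fy := fun y t => Complex.I * conj (G.nb y) * polyQuot (derivNum p D) (D ^ 2) (G.pt y + t))
    (a := fun y => Complex.I * conj (G.nb y))
    (fun y t ht => by
      have h3 : HasDerivAt (fun y => G.pt y + t) (Complex.I * conj (G.nb y)) y :=
        (G.hasDerivAt_pt y).add_const _
      refine ((hd y t ht).comp y h3).congr_deriv ?_
      ring)
    (fun y t ht => by
      have h3 : HasDerivAt (fun t : ℝ => G.pt y + t) (1 : ℝ) t :=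
        ((hasDerivAt_id t).ofReal_comp).const_add _
      refine ((hd y t ht).comp t h3).congr_deriv ?_
      simp)
    (fun y t ht => by simp)
    (fun y t ht => (h1 y t ht).trans (by gcongr; exact le_max_left _ _))
    (fun y t ht => by
      rw [norm_mul]
      refine (mul_le_mul (hpi y) (h2 y t ht) (norm_nonneg _) (by positivity)).trans ?_
      rw [← mul_div_assoc]
      gcongr
      exact le_max_right _ _)
    h2'
    (fun y => continuousOn_const.mul
        (((hD.pow 2).continuousOn_polyQuot_ray y).mono Ioi_subset_Ici_self))
    (fun y => ((hD.pow 2).continuousOn_polyQuot_ray y).mono Ioi_subset_Ici_self)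
    (continuous_const.mul G.continuous_conj_nb) hpi (by simp) (integrable_zero _ _ _)).2
  simp only [integral_zero, mul_assoc, integral_const_mul, Complex.ofReal_zero, add_zero] at key
  exact (mul_eq_zero.1 key).resolve_left Complex.I_ne_zero

end ConvexGraph

/-! ### Cauchy's formula along the graph -/

namespace ConvexGraph

variable (G : ConvexGraph)

/-- A base point inside the region. -/
def ctr : ℂ := G.pt 0 + 1

lemma ctr_im : G.ctr.im = 0 := by simp [ctr]
lemma ctr_re : G.ctr.re = G.fn 0 + 1 := by simp [ctr]

lemma exists_inv_sub_ctr_bound : ∃ K, ∀ y t : ℝ, 0 ≤ t → G.pt y - t - G.ctr ≠ 0 ∧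
    ‖(G.pt y - t - G.ctr)⁻¹‖ ≤ K / (1 + |y| + t) := by
  obtain ⟨c, hc, hg⟩ := G.exists_growth
  have hL := G.L_nonneg
  set a := 1 / (1 + G.L) with ha
  have ha0 : 0 < a := by positivity
  set θ := a / (a + ‖G.ctr‖ + 1) with hθ
  have hθ0 : 0 < θ := by positivity
  refine ⟨1 / (θ * c), fun y t ht => ?_⟩
  have hpos : 0 < 1 + |y| + t := by positivity
  have h1 : a ≤ ‖G.pt y - t - G.ctr‖ := by
    rw [ha, div_le_iff₀ (by positivity)]
    have h1 := (abs_le.1 (G.abs_fn_sub_le 0 y)).2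
    have h2 := Complex.abs_re_le_norm (G.pt y - t - G.ctr)
    have h3 := Complex.abs_im_le_norm (G.pt y - t - G.ctr)
    simp only [Complex.sub_re, Complex.sub_im, pt_re, pt_im, Complex.ofReal_re, Complex.ofReal_im,
      ctr_im, ctr_re, sub_zero] at h1 h2 h3
    have h5 := mul_le_mul_of_nonneg_left h3 hL
    have h6 := neg_abs_le (G.fn y - t - (G.fn 0 + 1))
    linarith
  have h2 := mul_one_add_le_of_le ha0 (norm_nonneg G.ctr) h1 (norm_sub_norm_le _ _)
  have h3 := hg y (-t)
  rw [abs_neg, abs_of_nonneg ht] at h3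
  push_cast at h3
  rw [← sub_eq_add_neg] at h3
  have h4 : θ * c * (1 + |y| + t) ≤ ‖G.pt y - t - G.ctr‖ := by
    refine le_trans ?_ h2
    rw [mul_assoc]
    exact mul_le_mul_of_nonneg_left h3 hθ0.le
  have h5 : 0 < ‖G.pt y - t - G.ctr‖ := lt_of_lt_of_le ha0 h1
  refine ⟨norm_pos_iff.1 h5, ?_⟩
  rw [norm_inv, div_div, one_div]
  exact inv_anti₀ (by positivity) h4

lemma pt_sub_ctr_ne (y : ℝ) : G.pt y - G.ctr ≠ 0 := by
  obtain ⟨K, hK⟩ := G.exists_inv_sub_ctr_bound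
  simpa using (hK y 0 le_rfl).1

lemma pt_sub_ne {w : ℂ} (hw : w.re < G.fn w.im) (y : ℝ) : G.pt y - w ≠ 0 := fun h => by
  rw [sub_eq_zero] at h
  rw [← h] at hw
  simp at hw

lemma ctr_sub_pt_mem_slitPlane (y : ℝ) : G.ctr - G.pt y ∈ Complex.slitPlane := by
  rw [Complex.mem_slitPlane_iff]
  rcases eq_or_ne y 0 with rfl | h
  · left; simp [ctr]
  · right; simpa [ctr] using h

lemma pt_sub_mem_slitPlane {w : ℂ} (hw : w.re < G.fn w.im) (y : ℝ) :
    G.pt y - w ∈ Complex.slitPlane := by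
  rw [Complex.mem_slitPlane_iff]
  rcases eq_or_ne y w.im with rfl | h
  · left; simpa using hw
  · right; simpa [sub_eq_zero] using h

lemma rootsOutside_X_sub_C {w : ℂ} (hw : w.re < G.fn w.im) :
    G.RootsOutside (X - Polynomial.C w) :=
  ⟨X_sub_C_ne_zero w, fun v hv => by
    have : v = w := by simpa [sub_eq_zero] using hv
    rwa [this]⟩

lemma exists_inv_sub_bound {w : ℂ} (hw : w.re < G.fn w.im) :
    ∃ K, ∀ y : ℝ, ‖(G.pt y - w)⁻¹‖ ≤ K / (1 + |y|) := by
  obtain ⟨K, hK⟩ := (G.rootsOutside_X_sub_C hw).norm_polyQuot_le (p := 1) (k := 1) (by simp)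
  refine ⟨K, fun y => ?_⟩
  simpa [polyQuot] using hK y 0 le_rfl

end ConvexGraph

/-- Two numbers on the same side of the real axis have arguments that differ by less than `π`. -/
lemma log_div_of_im_mul_pos {u v : ℂ} (h : 0 < u.im * v.im) :
    Complex.log (u / v) = Complex.log u - Complex.log v := by
  have hu : u ≠ 0 := by rintro rfl; simp at h
  have hv : v ≠ 0 := by rintro rfl; simp at h
  have hv' : v.arg ≠ Real.pi := by
    intro h'
    rw [Complex.arg_eq_pi_iff] at h'
    simp [h'.2] at h
  rw [div_eq_mul_inv, (Complex.log_mul_eq_add_log_iff hu (inv_ne_zero hv)).2, Complex.log_inv _ hv']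
  · ring
  rw [Complex.arg_inv, if_neg hv']
  have := Real.pi_pos
  have h3 := Complex.arg_le_pi u
  have h4 := Complex.neg_pi_lt_arg u
  have h5 := Complex.arg_le_pi v
  have h6 := Complex.neg_pi_lt_arg v
  rcases pos_and_pos_or_neg_and_neg_of_mul_pos h with ⟨h1, h2⟩ | ⟨h1, h2⟩
  · have h7 := Complex.arg_nonneg_iff.2 h1.le
    have h8 := Complex.arg_nonneg_iff.2 h2.le
    have : v.arg < Real.pi := lt_of_le_of_ne h5 hv'
    constructor <;> linarith
  · have h7 := Complex.arg_neg_iff.2 h1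
    have h8 := Complex.arg_neg_iff.2 h2
    constructor <;> linarith

namespace ConvexGraph

variable (G : ConvexGraph)

lemma tendsto_log_sub_log {w v : ℂ} {l : Filter ℝ} (hl : Tendsto (fun y : ℝ => |y|) l atTop)
    (hs : ∀ᶠ y : ℝ in l, 0 < (y - w.im) * (y - v.im)) :
    Tendsto (fun y => Complex.log (G.pt y - w) - Complex.log (G.pt y - v)) l (𝓝 0) := by
  have h1 : Tendsto (fun y => ‖G.pt y - v‖) l atTop := by
    refine tendsto_atTop_mono (f := fun y => |y| - |v.im|) (fun y => ?_)
      (tendsto_atTop_add_const_right _ _ hl)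
    have := Complex.abs_im_le_norm (G.pt y - v)
    simp only [Complex.sub_im, pt_im] at this
    exact (abs_sub_abs_le_abs_sub _ _).trans this
  have h2 : Tendsto (fun y => 1 + (v - w) * (G.pt y - v)⁻¹) l (𝓝 (1 + (v - w) * 0)) :=
    tendsto_const_nhds.add (tendsto_const_nhds.mul
      (tendsto_inv₀_cobounded.comp (tendsto_norm_atTop_iff_cobounded.1 h1)))
  rw [mul_zero, add_zero] at h2
  have h3 := ((continuousAt_clog Complex.one_mem_slitPlane).tendsto.comp h2)
  rw [Complex.log_one] at h3
  refine h3.congr' ?_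
  filter_upwards [hs] with y hy
  have h4 : 0 < (G.pt y - w).im * (G.pt y - v).im := by simpa using hy
  have h5 : G.pt y - v ≠ 0 := by intro h; simp [h] at h4
  rw [← log_div_of_im_mul_pos h4, Function.comp]
  congr 1
  field_simp
  ring

/-- The winding of the graph around the segment from an outer point `w` to the base point inside.
The primitive uses `log (z - w)` and `log (ctr - z)`, whose branch cuts start at `w` and at `ctr`
and run horizontally away from the graph. -/
theorem integral_inv_sub_inv {w : ℂ} (hw : w.re < G.fn w.im) :
    ∫ y, conj (G.nb y) * ((G.pt y - w)⁻¹ - (G.pt y - G.ctr)⁻¹) = 2 * Real.pi := by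
  obtain ⟨K1, h1⟩ := G.exists_inv_sub_bound hw
  obtain ⟨K2, h2⟩ := G.exists_inv_sub_ctr_bound
  have hL := G.L_nonneg
  have hd : ∀ y, HasDerivAt (fun y => Complex.log (G.pt y - w) - Complex.log (G.ctr - G.pt y))
      (Complex.I * (conj (G.nb y) * ((G.pt y - w)⁻¹ - (G.pt y - G.ctr)⁻¹))) y := by
    intro y
    have h3 := ((G.hasDerivAt_pt y).sub_const w).clog_real (G.pt_sub_mem_slitPlane hw y)
    have h4 := ((G.hasDerivAt_pt y).const_sub G.ctr).clog_real (G.ctr_sub_pt_mem_slitPlane y)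
    refine (h3.sub h4).congr_deriv ?_
    rw [← neg_sub (G.pt y) G.ctr]
    have := G.pt_sub_ctr_ne y
    have := G.pt_sub_ne hw y
    field_simp
  have hi : Integrable fun y =>
      Complex.I * (conj (G.nb y) * ((G.pt y - w)⁻¹ - (G.pt y - G.ctr)⁻¹)) := by
    have hc := G.continuous_pt
    have hc' := G.continuous_conj_nb
    refine (integrable_inv_one_add_abs_sq ((1 + G.L) * (K1 * ‖w - G.ctr‖ * K2))).mono' ?_
      (Eventually.of_forall fun y => ?_)
    · apply Continuous.aestronglyMeasurable
      exact continuous_const.mul (hc'.mul (((hc.sub continuous_const).inv₀ (G.pt_sub_ne hw)).sub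
        ((hc.sub continuous_const).inv₀ G.pt_sub_ctr_ne)))
    · have e : (G.pt y - w)⁻¹ - (G.pt y - G.ctr)⁻¹ = (G.pt y - w)⁻¹ * (w - G.ctr) *
          (G.pt y - G.ctr)⁻¹ := by
        have := G.pt_sub_ctr_ne y
        have := G.pt_sub_ne hw y
        field_simp; ring
      have h3 := h1 y
      have h4 := (h2 y 0 le_rfl).2
      simp only [Complex.ofReal_zero, sub_zero, add_zero] at h4
      have hp : 0 < 1 + |y| := by positivity
      rw [e, norm_mul, norm_mul, norm_mul, norm_mul, Complex.norm_I, one_mul, Complex.norm_conj]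
      have hk : 0 ≤ K1 / (1 + |y|) := (norm_nonneg _).trans h3
      calc _ ≤ (1 + G.L) * (K1 / (1 + |y|) * ‖w - G.ctr‖ * (K2 / (1 + |y|))) := by
            gcongr
            exact G.norm_nb_le y
        _ = _ := by field_simp
  have key := integral_of_hasDerivAt_of_tendsto (m := -(Real.pi * Complex.I))
      (n := Real.pi * Complex.I) hd hi ?_ ?_
  · rw [integral_const_mul] at key
    apply mul_left_cancel₀ Complex.I_ne_zero
    rw [key]; ring
  · have h5 := (G.tendsto_log_sub_log (w := w) (v := G.ctr) tendsto_abs_atBot_atTop ?_).sub_const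
        (Real.pi * Complex.I)
    -- below the base point the two determinations of the logarithm differ by `π i`
    · rw [zero_sub] at h5
      refine h5.congr' ?_
      filter_upwards [eventually_lt_atBot 0] with y hy
      have h6 : (G.ctr - G.pt y).arg = (G.pt y - G.ctr).arg + Real.pi := by
        rw [← neg_sub (G.pt y) G.ctr, Complex.arg_neg_eq_arg_add_pi_of_im_neg]
        simpa [ctr_im] using hy
      have h7 : Complex.log (G.ctr - G.pt y) = Complex.log (G.pt y - G.ctr) + Real.pi *
          Complex.I := by
        rw [Complex.log, Complex.log, h6, norm_sub_rev]; push_cast; ring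
      rw [h7]; ring
    · filter_upwards [eventually_lt_atBot 0, eventually_lt_atBot w.im] with y hy hy'
      rw [ctr_im]
      exact mul_pos_of_neg_of_neg (by linarith) (by linarith)
  · have h5 := (G.tendsto_log_sub_log (w := w) (v := G.ctr) tendsto_abs_atTop_atTop ?_).add_const
        (Real.pi * Complex.I)
    -- above the base point they differ by `-π i`
    · rw [zero_add] at h5
      refine h5.congr' ?_
      filter_upwards [eventually_gt_atTop 0] with y hy
      have h6 : (G.ctr - G.pt y).arg = (G.pt y - G.ctr).arg - Real.pi := by
        rw [← neg_sub (G.pt y) G.ctr, Complex.arg_neg_eq_arg_sub_pi_of_im_pos]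
        simpa [ctr_im] using hy
      have h7 : Complex.log (G.ctr - G.pt y) = Complex.log (G.pt y - G.ctr) - Real.pi *
          Complex.I := by
        rw [Complex.log, Complex.log, h6, norm_sub_rev]; push_cast; ring
      rw [h7]; ring
    · filter_upwards [eventually_gt_atTop 0, eventually_gt_atTop w.im] with y hy hy'
      rw [ctr_im]
      exact mul_pos (by linarith) (by linarith)

end ConvexGraph

section Cauchy

variable {H : Type u} [NormedAddCommGroup H] [InnerProductSpace ℂ H]
variable {G : ConvexGraph} {A : H →L[ℂ] H} {η : ℝ}

lemma norm_inner_apply_apply_le (T : H →L[ℂ] H) (x y : H) : ‖⟪y, T x⟫‖ ≤ ‖y‖ * ‖x‖ * ‖T‖ := by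
  refine (norm_inner_le_norm _ _).trans ?_
  have := T.le_opNorm x
  nlinarith [norm_nonneg y]

/-- The difference of the resolvent and the scalar model `(z - w)⁻¹` contains two factors that decay
like `|z| ^ (-1)`. -/
lemma resolvent_sub_model {z w : ℂ} (hz : z ∈ resolventSet ℂ A) (hw : z - w ≠ 0) (x y : H) :
    ⟪y, resolvent A z x⟫ - ⟪y, x⟫ * (z - w)⁻¹ = ⟪y, resolvent A z (A x - w • x)⟫ * (z - w)⁻¹ := by
  have h := congrArg (fun v => ⟪y, v⟫) (resolvent_sub_apply hz x)
  simp only [inner_sub_right, inner_smul_right] at h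
  rw [map_sub, map_smul, inner_sub_right, inner_smul_right]
  field_simp
  linear_combination h

variable [CompleteSpace H]

lemma InsideGraph.continuous_inner_resolvent (hA : InsideGraph G A η) (hη : 0 < η) (x y : H) :
    Continuous fun s => ⟪y, resolvent A (G.pt s) x⟫ := by
  obtain ⟨K, hK⟩ := hA.resolvent_bound hη
  refine continuous_iff_continuousAt.2 fun s => ?_
  have h := (hK s 0 le_rfl).1
  rw [Complex.ofReal_zero, sub_zero] at h
  exact (hasDerivAt_inner_resolvent h x y).continuousAt.comp G.continuous_pt.continuousAt

/-- Outside the region the resolvent is holomorphic, so that its boundary integral, made absolutely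
convergent by the scalar model with its pole inside, does not change when the contour is moved to
the left along horizontal rays, where it tends to zero. -/
theorem InsideGraph.integral_resolvent_sub_model (hA : InsideGraph G A η) (hη : 0 < η) (x y : H) :
    (Integrable fun s =>
        conj (G.nb s) * (⟪y, resolvent A (G.pt s) x⟫ - ⟪y, x⟫ * (G.pt s - G.ctr)⁻¹)) ∧
    ∫ s, conj (G.nb s) * (⟪y, resolvent A (G.pt s) x⟫ - ⟪y, x⟫ * (G.pt s - G.ctr)⁻¹) = 0 := by
  obtain ⟨K1, h1⟩ := hA.resolvent_bound hη
  obtain ⟨K2, h2⟩ := G.exists_inv_sub_ctr_bound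
  have hL := G.L_nonneg
  have hK1 : 0 ≤ K1 := by
    have := (norm_nonneg _).trans (h1 0 0 le_rfl).2; simpa using this
  have hK2 : 0 ≤ K2 := by
    have := (norm_nonneg _).trans (h2 0 0 le_rfl).2; simpa using this
  set K := ‖y‖ * ‖A x - G.ctr • x‖ * K1 * K2 with hK
  set K' := ‖y‖ * ‖x‖ * K1 ^ 2 + ‖y‖ * ‖x‖ * K2 ^ 2 with hK'
  have hK'0 : 0 ≤ K' := by positivity
  set M := max K ((1 + G.L) * K') with hM
  have hKM : K' ≤ M := le_trans (by nlinarith) (le_max_right _ _)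
  set g : ℂ → ℂ := fun z => ⟪y, resolvent A z x⟫ - ⟪y, x⟫ * (z - G.ctr)⁻¹ with hg
  set g' : ℂ → ℂ := fun z =>
      -⟪y, resolvent A z (resolvent A z x)⟫ + ⟪y, x⟫ * ((z - G.ctr)⁻¹) ^ 2 with hg'
  have hd : ∀ s t : ℝ, 0 ≤ t → HasDerivAt g (g' (G.pt s - t)) (G.pt s - t) := by
    intro s t ht
    refine ((hasDerivAt_inner_resolvent (h1 s t ht).1 x y).sub
      ((((hasDerivAt_id _).sub_const G.ctr).inv (h2 s t ht).1).const_mul ⟪y, x⟫)).congr_deriv ?_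
    simp only [hg', id]
    field_simp
    ring
  have hb : ∀ s t : ℝ, 0 ≤ t → ‖g (G.pt s - t)‖ ≤ M / (1 + |s| + t) ^ 2 := by
    intro s t ht
    have hp : 0 < 1 + |s| + t := by positivity
    simp only [hg]
    rw [resolvent_sub_model (h1 s t ht).1 (h2 s t ht).1, norm_mul]
    calc _ ≤ (‖y‖ * ‖A x - G.ctr • x‖ * (K1 / (1 + |s| + t))) * (K2 / (1 + |s| + t)) := by
          refine mul_le_mul ?_ (h2 s t ht).2 (norm_nonneg _) (by positivity)
          refine (norm_inner_apply_apply_le _ _ _).trans ?_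
          gcongr
          exact (h1 s t ht).2
      _ = K / (1 + |s| + t) ^ 2 := by rw [hK]; field_simp
      _ ≤ _ := by gcongr; exact le_max_left _ _
  have hb' : ∀ s t : ℝ, 0 ≤ t → ‖g' (G.pt s - t)‖ ≤ K' / (1 + |s| + t) ^ 2 := by
    intro s t ht
    have hp : 0 < 1 + |s| + t := by positivity
    simp only [hg']
    refine (norm_add_le _ _).trans ?_
    rw [norm_neg, norm_mul, norm_pow]
    calc _ ≤ (‖y‖ * (K1 / (1 + |s| + t) * ‖x‖) * (K1 / (1 + |s| + t))) +
          (‖y‖ * ‖x‖) * (K2 / (1 + |s| + t)) ^ 2 := by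
          gcongr
          · refine (norm_inner_apply_apply_le _ _ _).trans ?_
            have h3 := (h1 s t ht).2
            have h4 := ((resolvent A (G.pt s - t)).le_opNorm x).trans
              (mul_le_mul_of_nonneg_right h3 (norm_nonneg x))
            gcongr
          · exact norm_inner_le_norm _ _
          · exact (h2 s t ht).2
      _ = K' / (1 + |s| + t) ^ 2 := by rw [hK']; field_simp
  have hc' : ∀ s, ContinuousOn (fun t : ℝ => g' (G.pt s - t)) (Ioi 0) := by
    intro s
    simp only [hg']
    intro t ht
    have ht' : (0 : ℝ) ≤ t := le_of_lt ht
    have hr := (h1 s t ht').1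
    have hpt : ContinuousAt (fun t : ℝ => G.pt s - t) t := by fun_prop
    apply ContinuousAt.continuousWithinAt
    apply ContinuousAt.add
    · have hR : ContinuousAt (fun t : ℝ => resolvent A (G.pt s - t)) t :=
        ContinuousAt.comp (g := resolvent A) (f := fun t : ℝ => G.pt s - t)
          (spectrum.hasDerivAt_resolvent_const_left (𝕜 := ℂ) hr).continuousAt hpt
      exact (continuousAt_const.inner (hR.clm_apply (hR.clm_apply continuousAt_const))).neg
    · exact continuousAt_const.mul (((hpt.sub continuousAt_const).inv₀ (h2 s t ht').1).pow 2)
  have hpi : ∀ s, ‖-(Complex.I * conj (G.nb s))‖ ≤ 1 + G.L := fun s => by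
    simpa using G.norm_nb_le s
  have hcI : Continuous fun s => -(Complex.I * conj (G.nb s)) :=
    (continuous_const.mul G.continuous_conj_nb).neg
  have key := (integral_boundary_eq_integral_ray (K := M) (Ca := 1 + G.L) (B := 0)
      (E := fun _ _ => 0)
    (F := fun s t => g (G.pt s - t))
    (Ft := fun s t => -g' (G.pt s - t))
    (Fy := fun s t => Complex.I * conj (G.nb s) * g' (G.pt s - t))
    (a := fun s => -(Complex.I * conj (G.nb s)))
    (fun s t ht => by
      have h3 : HasDerivAt (fun s => G.pt s - t) (Complex.I * conj (G.nb s)) s :=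
        (G.hasDerivAt_pt s).sub_const _
      refine ((hd s t ht).comp s h3).congr_deriv ?_
      ring)
    (fun s t ht => by
      have h3 : HasDerivAt (fun t : ℝ => G.pt s - t) (-(1 : ℝ)) t :=
        ((hasDerivAt_id t).ofReal_comp).const_sub _
      refine ((hd s t ht).comp t h3).congr_deriv ?_
      simp)
    (fun s t ht => by ring)
    hb
    (fun s t ht => by
      rw [norm_mul]
      have hp := hpi s
      rw [norm_neg] at hp
      refine (mul_le_mul hp (hb' s t ht) (norm_nonneg _) (by positivity)).trans ?_
      rw [← mul_div_assoc]
      gcongr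
      exact le_max_right _ _)
    (fun s t ht => by
      rw [norm_neg]
      exact (hb' s t ht).trans (by gcongr))
    (fun s => continuousOn_const.mul (hc' s))
    (fun s => (hc' s).neg)
    hcI hpi (by simp) (integrable_zero _ _ _)).2
  simp only [integral_zero, Complex.ofReal_zero, sub_zero] at key
  have hcg : Continuous fun s => g (G.pt s) :=
    (hA.continuous_inner_resolvent hη x y).sub (continuous_const.mul
      ((G.continuous_pt.sub continuous_const).inv₀ G.pt_sub_ctr_ne))
  constructor
  · refine (integrable_inv_one_add_abs_sq ((1 + G.L) * M)).mono'
      (G.continuous_conj_nb.mul hcg).aestronglyMeasurable (Eventually.of_forall fun s => ?_)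
    rw [norm_mul, Complex.norm_conj, mul_div_assoc]
    have h3 := hb s 0 le_rfl
    rw [Complex.ofReal_zero, sub_zero, add_zero] at h3
    exact mul_le_mul (G.norm_nb_le s) h3 (norm_nonneg _) (by positivity)
  · have e : ∀ s, -(Complex.I * conj (G.nb s)) * g (G.pt s) = -Complex.I *
        (conj (G.nb s) * g (G.pt s)) :=
      fun s => by ring
    simp only [e, integral_const_mul] at key
    exact (mul_eq_zero.1 key).resolve_left (by simp)

end Cauchy

section CauchyFormula

variable {H : Type u} [NormedAddCommGroup H] [InnerProductSpace ℂ H] [CompleteSpace H]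
variable {G : ConvexGraph} {A : H →L[ℂ] H} {η : ℝ}

lemma integrable_of_norm_le_inv_sq {E : Type*} [NormedAddCommGroup E] {f : ℝ → E} {K : ℝ}
    (hf : Continuous f) (h : ∀ y, ‖f y‖ ≤ K / (1 + |y|) ^ 2) : Integrable f :=
  (integrable_inv_one_add_abs_sq K).mono' hf.aestronglyMeasurable (Eventually.of_forall h)

lemma InsideGraph.integrable_cauchy (hA : InsideGraph G A η) (hη : 0 < η) {p D : ℂ[X]}
    (hD : G.RootsOutside D) (hk : p.natDegree + 1 ≤ D.natDegree) (x y : H) :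
    Integrable fun s => conj (G.nb s) * (polyQuot p D (G.pt s) * ⟪y, resolvent A (G.pt s) x⟫) := by
  obtain ⟨K1, h1⟩ := hA.resolvent_bound hη
  obtain ⟨K2, h2⟩ := hD.norm_polyQuot_le hk
  have hL := G.L_nonneg
  refine integrable_of_norm_le_inv_sq (K := (1 + G.L) * (K2 * (‖y‖ * ‖x‖ * K1)))
    (G.continuous_conj_nb.mul
        (hD.continuous_polyQuot_pt.mul (hA.continuous_inner_resolvent hη x y)))
    fun s => ?_
  have h3 := (h1 s 0 le_rfl).2
  have h4 := h2 s 0 le_rfl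
  rw [Complex.ofReal_zero] at h3 h4
  rw [sub_zero, add_zero] at h3
  rw [pow_one, add_zero, add_zero] at h4
  have hk : 0 ≤ K2 / (1 + |s|) := (norm_nonneg _).trans h4
  rw [norm_mul, norm_mul, Complex.norm_conj]
  calc _ ≤ (1 + G.L) * (K2 / (1 + |s|) * (‖y‖ * ‖x‖ * (K1 / (1 + |s|)))) := by
        have h5 := (norm_inner_apply_apply_le (resolvent A (G.pt s)) x y).trans
          (mul_le_mul_of_nonneg_left h3 (by positivity))
        have := G.norm_nb_le s
        gcongr
    _ = _ := by field_simp

/-- The Cauchy integral of `p / D` against the resolvent of `A`. As `dz = i * conj (nb s) ds` on the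
graph, the factor `conj (nb s)` replaces the line element up to the constant `i`. -/
def cauchyIntegral (G : ConvexGraph) (A : H →L[ℂ] H) (p D : ℂ[X]) (x y : H) : ℂ :=
  ∫ s, conj (G.nb s) * (polyQuot p D (G.pt s) * ⟪y, resolvent A (G.pt s) x⟫)

/-- Moving a factor `z` over to the resolvent costs the integral of a scalar rational function,
which vanishes by Cauchy's theorem. -/
lemma InsideGraph.cauchyIntegral_X_pow_succ (hA : InsideGraph G A η) (hη : 0 < η) {D : ℂ[X]}
    (hD : G.RootsOutside D) {n : ℕ} (hn : n + 2 ≤ D.natDegree) (x y : H) :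
    cauchyIntegral G A (X ^ (n + 1)) D x y = cauchyIntegral G A (X ^ n) D (A x) y := by
  have h0 := hD.integral_polyQuot_eq_zero (p := X ^ n) (by simpa using hn)
  have hi := hA.integrable_cauchy hη hD (p := X ^ n) (by simp; omega) (A x) y
  have hj : Integrable fun s => conj (G.nb s) * polyQuot (X ^ n) D (G.pt s) := by
    obtain ⟨K2, h2⟩ := hD.norm_polyQuot_le (p := X ^ n) (k := 2) (by simpa using hn)
    refine integrable_of_norm_le_inv_sq (K := (1 + G.L) * K2)
      (G.continuous_conj_nb.mul hD.continuous_polyQuot_pt) fun s => ?_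
    have h4 := h2 s 0 le_rfl
    rw [Complex.ofReal_zero, add_zero, add_zero] at h4
    rw [norm_mul, Complex.norm_conj, mul_div_assoc]
    exact mul_le_mul (G.norm_nb_le s) h4 (norm_nonneg _) (by have := G.L_nonneg; positivity)
  obtain ⟨K1, h1⟩ := hA.resolvent_bound hη
  have e : ∀ s, conj (G.nb s) * (polyQuot (X ^ (n + 1)) D (G.pt s) * ⟪y, resolvent A (G.pt s) x⟫) =
      conj (G.nb s) * (polyQuot (X ^ n) D (G.pt s) * ⟪y, resolvent A (G.pt s) (A x)⟫) +
      conj (G.nb s) * polyQuot (X ^ n) D (G.pt s) * ⟪y, x⟫ := by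
    intro s
    have hz := (h1 s 0 le_rfl).1
    rw [Complex.ofReal_zero, sub_zero] at hz
    have h := congrArg (fun v => ⟪y, v⟫) (resolvent_sub_apply hz x)
    simp only [inner_sub_right, inner_smul_right] at h
    simp only [polyQuot, eval_pow, eval_X, ← h]
    ring
  simp only [cauchyIntegral, e]
  rw [integral_add hi (hj.mul_const _), integral_mul_const, h0]
  ring

lemma InsideGraph.cauchyIntegral_X_pow (hA : InsideGraph G A η) (hη : 0 < η) {D : ℂ[X]}
    (hD : G.RootsOutside D) {n : ℕ} (hn : n + 1 ≤ D.natDegree) (x y : H) :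
    cauchyIntegral G A (X ^ n) D x y = cauchyIntegral G A 1 D ((A ^ n) x) y := by
  induction n generalizing x with
  | zero => simp
  | succ n ih =>
    rw [hA.cauchyIntegral_X_pow_succ hη hD hn, ih (by omega), pow_succ]
    rfl

lemma InsideGraph.cauchyIntegral_eq_one (hA : InsideGraph G A η) (hη : 0 < η) {p D : ℂ[X]}
    (hD : G.RootsOutside D) (hn : p.natDegree + 1 ≤ D.natDegree) (x y : H) :
    cauchyIntegral G A p D x y = cauchyIntegral G A 1 D (aeval A p x) y := by
  have hi1 := fun x => hA.integrable_cauchy hη hD (p := 1) (by simp; omega) x y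
  have hi := fun n (h : n + 1 ≤ D.natDegree) =>
      hA.integrable_cauchy hη hD (p := X ^ n) (by simpa using h) x y
  have hX := fun n (h : n + 1 ≤ D.natDegree) => hA.cauchyIntegral_X_pow hη hD h x y
  simp only [cauchyIntegral] at hX ⊢
  have e1 : ∀ s, conj (G.nb s) * (polyQuot p D (G.pt s) * ⟪y, resolvent A (G.pt s) x⟫) =
      ∑ i ∈ Finset.range (p.natDegree + 1), p.coeff i *
        (conj (G.nb s) * (polyQuot (X ^ i) D (G.pt s) * ⟪y, resolvent A (G.pt s) x⟫)) := by
    intro s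
    have : polyQuot p D (G.pt s) = ∑ i ∈ Finset.range (p.natDegree + 1),
        p.coeff i * polyQuot (X ^ i) D (G.pt s) := by
      rw [polyQuot, eval_eq_sum_range, Finset.sum_div]
      simp [polyQuot, mul_div_assoc]
    rw [this, Finset.sum_mul, Finset.mul_sum]
    exact Finset.sum_congr rfl fun i _ => by ring
  have e2 : ∀ s, conj (G.nb s) * (polyQuot 1 D (G.pt s) * ⟪y, resolvent A (G.pt s) (aeval A p x)⟫) =
      ∑ i ∈ Finset.range (p.natDegree + 1), p.coeff i *
        (conj (G.nb s) * (polyQuot 1 D (G.pt s) * ⟪y, resolvent A (G.pt s) ((A ^ i) x)⟫)) := by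
    intro s
    have : ⟪y, resolvent A (G.pt s) (aeval A p x)⟫ = ∑ i ∈ Finset.range (p.natDegree + 1),
        p.coeff i * ⟪y, resolvent A (G.pt s) ((A ^ i) x)⟫ := by
      rw [aeval_eq_sum_range, sum_apply, map_sum, inner_sum]
      simp [inner_smul_right]
    rw [this, Finset.mul_sum, Finset.mul_sum]
    exact Finset.sum_congr rfl fun i _ => by ring
  simp only [e1, e2]
  have hlt : ∀ i ∈ Finset.range (p.natDegree + 1), i + 1 ≤ D.natDegree := fun i hi => by
    have := Finset.mem_range.1 hi; omega
  rw [integral_finsetSum _ fun i h => (hi i (hlt i h)).const_mul _,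
    integral_finsetSum _ fun i _ => (hi1 _).const_mul _]
  refine Finset.sum_congr rfl fun i h => ?_
  rw [integral_const_mul, integral_const_mul, hX i (hlt i h)]

/-- The case of a single pole: the resolvent is compared with its scalar model, which leaves the
winding number. -/
lemma InsideGraph.cauchyIntegral_X_sub_C (hA : InsideGraph G A η) (hη : 0 < η) {w : ℂ}
    (hw : w.re < G.fn w.im) (x y : H) :
    cauchyIntegral G A 1 (X - Polynomial.C w) (A x - w • x) y = -(2 * Real.pi) * ⟪y, x⟫ := by
  obtain ⟨hi, h0⟩ := hA.integral_resolvent_sub_model hη x y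
  have hs := G.integral_inv_sub_inv hw
  obtain ⟨K1, h1⟩ := hA.resolvent_bound hη
  have e : ∀ s, conj (G.nb s) * (polyQuot 1 (X - Polynomial.C w) (G.pt s) *
      ⟪y, resolvent A (G.pt s) (A x - w • x)⟫) =
      conj (G.nb s) * (⟪y, resolvent A (G.pt s) x⟫ - ⟪y, x⟫ * (G.pt s - G.ctr)⁻¹) -
      ⟪y, x⟫ * (conj (G.nb s) * ((G.pt s - w)⁻¹ - (G.pt s - G.ctr)⁻¹)) := by
    intro s
    have hz := (h1 s 0 le_rfl).1
    rw [Complex.ofReal_zero, sub_zero] at hz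
    have h := resolvent_sub_model hz (G.pt_sub_ne hw s) x y
    have : polyQuot 1 (X - Polynomial.C w) (G.pt s) = (G.pt s - w)⁻¹ := by simp [polyQuot]
    rw [this]
    linear_combination -conj (G.nb s) * h
  have hi2 : Integrable fun s =>
      ⟪y, x⟫ * (conj (G.nb s) * ((G.pt s - w)⁻¹ - (G.pt s - G.ctr)⁻¹)) := by
    refine Integrable.const_mul ?_ _
    -- a nonintegrable function would have the integral `0` instead of `2 π`
    by_contra hni
    rw [integral_undef hni] at hs
    have := Real.pi_ne_zero
    norm_num at hs
  simp only [cauchyIntegral, e]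
  rw [integral_sub hi hi2, h0, integral_const_mul, hs]
  ring

/-- Cauchy's formula for the rational functional calculus; `x'` stands for `(p / D)(A) x`. The
numerator is moved over to the vector `x`, and then all factors of `D` but one are. -/
theorem InsideGraph.cauchyIntegral_eq (hA : InsideGraph G A η) (hη : 0 < η) {p D : ℂ[X]}
    (hD : G.RootsOutside D) (hn : p.natDegree + 1 ≤ D.natDegree) {x x' : H} (y : H)
    (hx : aeval A D x' = aeval A p x) :
    cauchyIntegral G A p D x y = -(2 * Real.pi) * ⟪y, x'⟫ := by
  rw [hA.cauchyIntegral_eq_one hη hD hn, ← hx]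
  obtain ⟨w, hw⟩ := IsAlgClosed.exists_root D (by
    rw [degree_eq_natDegree hD.1]
    have : D.natDegree ≠ 0 := by omega
    exact_mod_cast this)
  obtain ⟨D₁, rfl⟩ := dvd_iff_isRoot.2 hw
  have hw' : w.re < G.fn w.im := hD.2 w hw
  have hD₁ := hD.of_mul_right
  have hdeg : ((X - Polynomial.C w) * D₁).natDegree = D₁.natDegree + 1 := by
    rw [natDegree_mul (X_sub_C_ne_zero w) hD₁.1, natDegree_X_sub_C, add_comm]
  have h1 : aeval A ((X - Polynomial.C w) * D₁) x' = aeval A D₁ (A x' - w • x') := by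
    rw [mul_comm, map_mul]
    simp [Algebra.algebraMap_eq_smul_one]
  rw [h1, ← hA.cauchyIntegral_eq_one hη hD hdeg.ge, ← hA.cauchyIntegral_X_sub_C hη hw']
  simp only [cauchyIntegral]
  congr 1
  ext s
  congr 2
  have h2 := hD₁.eval_ne (ConvexGraph.pt_mem (G := G) s)
  have h3 := G.pt_sub_ne hw' s
  simp only [polyQuot, eval_mul, eval_sub, eval_X, eval_C, eval_one]
  field_simp

end CauchyFormula

/-! ### The reflected resolvent -/

namespace ConvexGraph

variable (G : ConvexGraph)

lemma integrable_d2 : Integrable G.d2 := by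
  refine integrable_of_intervalIntegral_norm_bounded (l := atTop) (a := fun i : ℝ => -i) (b := id)
    (2 * G.L) (fun i => (G.continuous_d2.integrableOn_Icc).mono_set Ioc_subset_Icc_self)
    tendsto_neg_atTop_atBot tendsto_id (Eventually.of_forall fun i => ?_)
  have e : (fun y => ‖G.d2 y‖) = G.d2 := funext fun y => Real.norm_of_nonneg (G.d2_nonneg y)
  rw [e, intervalIntegral.integral_eq_sub_of_hasDerivAt (fun y _ => G.hasDerivAt_d1 y)
    (G.continuous_d2.intervalIntegrable _ _)]
  have h1 := (abs_le.1 (G.abs_d1_le i)).2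
  have h2 := (abs_le.1 (G.abs_d1_le (-i))).1
  simp only [id]
  linarith

lemma norm_deriv_kap_le (y : ℝ) : ‖-2 * Complex.I * G.d2 y / conj (G.nb y) ^ 2‖ ≤ 2 * G.d2 y := by
  have h0 := G.d2_nonneg y
  have h1 := G.one_le_norm_nb y
  simp only [norm_div, norm_mul, norm_neg, norm_pow, Complex.norm_conj, Complex.norm_I,
    Complex.norm_real, Real.norm_of_nonneg h0, Complex.norm_ofNat, mul_one]
  exact div_le_self (by positivity) (one_le_pow₀ h1)

end ConvexGraph

section Reflected

variable {H : Type u} [NormedAddCommGroup H] [InnerProductSpace ℂ H] [CompleteSpace H]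
variable {G : ConvexGraph} {A : H →L[ℂ] H} {η : ℝ}

/-- The reflected point belonging to `pt s + t`, at which the resolvent of the adjoint is taken. -/
def ConvexGraph.refl (G : ConvexGraph) (s t : ℝ) : ℂ := conj (G.pt s) + t * G.kap s

/-- The matrix element between `u` and `v` of `(γ̄ - A†) (ζ - A†)⁻²`, where `ζ = γ̄ + t κ` is the
reflected point; it is written as `(ζ - A†)⁻¹ - t κ (ζ - A†)⁻²`. -/
def rayKernel (G : ConvexGraph) (A : H →L[ℂ] H) (u v : H) (s t : ℝ) : ℂ :=
  ⟪v, resolvent (ContinuousLinearMap.adjoint A) (G.refl s t) u⟫ -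
    t * G.kap s * ⟪v, resolvent (ContinuousLinearMap.adjoint A) (G.refl s t)
      (resolvent (ContinuousLinearMap.adjoint A) (G.refl s t) u)⟫

lemma InsideGraph.continuous_inner_adjoint_resolvent (hA : InsideGraph G A η) (hη : 0 < η)
    (u v : H) :
    Continuous fun s => ⟪v, resolvent (ContinuousLinearMap.adjoint A) (conj (G.pt s)) u⟫ := by
  obtain ⟨K, hK⟩ := hA.adjoint_resolvent_bound hη
  refine continuous_iff_continuousAt.2 fun s => ?_
  have h := (hK s 0 le_rfl).1
  rw [Complex.ofReal_zero, zero_mul, add_zero] at h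
  exact ContinuousAt.comp (f := fun s => conj (G.pt s))
      (hasDerivAt_inner_resolvent h u v).continuousAt
    (Complex.continuous_conj.comp G.continuous_pt).continuousAt

set_option maxHeartbeats 1000000 in
/-- On every tangent line the resolvent of the adjoint at `conj z` is the boundary value of a
function that is holomorphic on the inner side, namely the resolvent at the reflected point. If the
graph were a line, the integral would thus vanish by Cauchy's theorem; in general, moving the
contour along horizontal rays leaves only the contribution of the rotation of the tangent, which is
measured by `d2`. -/
theorem InsideGraph.integral_reflected (hA : InsideGraph G A η) (hη : 0 < η) {p D : ℂ[X]}
    (hD : G.RootsOutside D) (hk : p.natDegree + 1 ≤ D.natDegree) (u v : H) :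
    (Integrable fun s => G.nb s * (polyQuot p D (G.pt s) *
      ⟪v, resolvent (ContinuousLinearMap.adjoint A) (conj (G.pt s)) u⟫)) ∧
    (∀ s, IntegrableOn (fun t : ℝ => polyQuot p D (G.pt s + t) * rayKernel G A u v s t) (Ioi 0)) ∧
    (Integrable fun s => 2 * G.d2 s / conj (G.nb s) ^ 2 *
      ∫ t in Ioi (0 : ℝ), polyQuot p D (G.pt s + t) * rayKernel G A u v s t) ∧
    ∫ s, G.nb s * (polyQuot p D (G.pt s) *
      ⟪v, resolvent (ContinuousLinearMap.adjoint A) (conj (G.pt s)) u⟫) =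
    ∫ s, 2 * G.d2 s / conj (G.nb s) ^ 2 *
      ∫ t in Ioi (0 : ℝ), polyQuot p D (G.pt s + t) * rayKernel G A u v s t := by
  obtain ⟨Kr, hr⟩ := hA.adjoint_resolvent_bound hη
  obtain ⟨Kf, hf⟩ := hD.norm_polyQuot_le hk
  obtain ⟨Kf', hf'⟩ := (hD.pow 2).norm_polyQuot_le (ConvexGraph.natDegree_derivNum_add_le hk)
  simp only [pow_one] at hf hf'
  have hL := G.L_nonneg
  have hQ : 0 ≤ G.Q := (G.d2_nonneg 0).trans (G.d2_le 0)
  have hKr : 0 ≤ Kr := by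
    have := (norm_nonneg _).trans (hr 0 0 le_rfl).2; simpa using this
  have hKf : 0 ≤ Kf := by
    have := (norm_nonneg _).trans (hf 0 0 le_rfl); simpa using this
  have hKf' : 0 ≤ Kf' := by
    have := (norm_nonneg _).trans (hf' 0 0 le_rfl); simpa using this
  set B := ContinuousLinearMap.adjoint A with hB
  set ρ : ℂ → ℂ := fun z => ⟪v, resolvent B z u⟫ with hρ
  set ρ' : ℂ → ℂ := fun z => -⟪v, resolvent B z (resolvent B z u)⟫ with hρ'
  set f : ℂ → ℂ := polyQuot p D with hfdef
  set f' : ℂ → ℂ := polyQuot (ConvexGraph.derivNum p D) (D ^ 2) with hf'def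
  set κ' : ℝ → ℂ := fun y => -2 * Complex.I * G.d2 y / conj (G.nb y) ^ 2 with hκ'
  have hκ'2 : ∀ y, ‖κ' y‖ ≤ 2 * G.Q := fun y =>
    (G.norm_deriv_kap_le y).trans (by have := G.d2_le y; linarith)
  have hγ : ∀ y, ‖Complex.I * conj (G.nb y)‖ ≤ 1 + G.L := fun y => by
    simpa using G.norm_nb_le y
  set a := ‖v‖ * ‖u‖ with ha
  have ha0 : 0 ≤ a := by positivity
  have bρ : ∀ s t : ℝ, 0 ≤ t → ‖ρ (G.refl s t)‖ ≤ a * Kr / (1 + |s| + t) := fun s t ht => by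
    refine (norm_inner_apply_apply_le _ _ _).trans ?_
    rw [mul_div_assoc]
    exact mul_le_mul_of_nonneg_left (hr s t ht).2 ha0
  have bρ' : ∀ s t : ℝ, 0 ≤ t → ‖ρ' (G.refl s t)‖ ≤
      a * Kr ^ 2 / (1 + |s| + t) ^ 2 := fun s t ht => by
    have hp : 0 < 1 + |s| + t := by positivity
    simp only [hρ', norm_neg]
    refine (norm_inner_apply_apply_le _ _ _).trans ?_
    have h3 : ‖resolvent B (G.refl s t)‖ ≤ Kr / (1 + |s| + t) := (hr s t ht).2
    have h4 := ((resolvent B (G.refl s t)).le_opNorm u).trans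
      (mul_le_mul_of_nonneg_right h3 (norm_nonneg u))
    calc _ ≤ ‖v‖ * (Kr / (1 + |s| + t) * ‖u‖) * (Kr / (1 + |s| + t)) := by gcongr
      _ = _ := by rw [ha]; field_simp
  have dρ : ∀ s t : ℝ, 0 ≤ t → HasDerivAt ρ (ρ' (G.refl s t)) (G.refl s t) := fun s t ht =>
    hasDerivAt_inner_resolvent (hr s t ht).1 u v
  have df : ∀ s t : ℝ, 0 ≤ t → HasDerivAt f (f' (G.pt s + t)) (G.pt s + t) := fun s t ht =>
    ConvexGraph.hasDerivAt_polyQuot (hD.eval_ne (ConvexGraph.pt_add_mem s ht))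
  have bt : ∀ s t : ℝ, 0 ≤ t → t ≤ 1 + |s| + t := fun s t _ => by linarith [abs_nonneg s]
  -- the factor of `κ'` in the derivative along the graph: `κ` and, through the reflected point,
  -- `t κ` depend on the tangent
  have bE : ∀ s t : ℝ, 0 ≤ t → ‖f (G.pt s + t) * (ρ (G.refl s t) + t * G.kap s * ρ' (G.refl s t))‖ ≤
      Kf * (a * Kr + a * Kr ^ 2) / (1 + |s| + t) ^ 2 := fun s t ht => by
    have hp : 0 < 1 + |s| + t := by positivity
    have h3 : ‖ρ (G.refl s t) + t * G.kap s * ρ' (G.refl s t)‖ ≤ (a * Kr + a * Kr ^ 2) /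
        (1 + |s| + t) := by
      refine (norm_add_le _ _).trans ?_
      rw [norm_mul, norm_mul, G.norm_kap, mul_one, Complex.norm_real, Real.norm_of_nonneg ht,
          add_div]
      refine add_le_add (bρ s t ht) ?_
      calc _ ≤ (1 + |s| + t) * (a * Kr ^ 2 / (1 + |s| + t) ^ 2) := by
            gcongr
            · exact bt s t ht
            · exact bρ' s t ht
        _ = _ := by field_simp
    rw [norm_mul]
    calc _ ≤ (Kf / (1 + |s| + t)) * ((a * Kr + a * Kr ^ 2) / (1 + |s| + t)) := by
          gcongr
          exact hf s t ht
      _ = _ := by field_simp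
  set M0 := Kf * (a * Kr + a * Kr ^ 2) with hM0
  have hM00 : 0 ≤ M0 := by positivity
  set M1 := Kf' * (a * Kr) + Kf * (a * Kr ^ 2) with hM1
  have hM10 : 0 ≤ M1 := by positivity
  set M := M0 + Kf * (a * Kr) + (1 + G.L) * M1 + 2 * G.Q * M0 with hM
  set F : ℝ → ℝ → ℂ := fun s t => G.kap s * (f (G.pt s + t) * ρ (G.refl s t)) with hF
  set Ft : ℝ → ℝ → ℂ := fun s t => G.kap s * (f' (G.pt s + t) * ρ (G.refl s t) +
    f (G.pt s + t) * (ρ' (G.refl s t) * G.kap s)) with hFt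
  set E : ℝ → ℝ → ℂ := fun s t =>
      κ' s * (f (G.pt s + t) * (ρ (G.refl s t) + t * G.kap s * ρ' (G.refl s t)))
    with hE
  set Fy : ℝ → ℝ → ℂ := fun s t => Complex.I * conj (G.nb s) * Ft s t + E s t with hFy
  have bFt : ∀ s t : ℝ, 0 ≤ t → ‖Ft s t‖ ≤ M1 / (1 + |s| + t) ^ 2 := fun s t ht => by
    have hp : 0 < 1 + |s| + t := by positivity
    simp only [hFt]
    rw [norm_mul, G.norm_kap, one_mul]
    refine (norm_add_le _ _).trans ?_
    rw [norm_mul, norm_mul, norm_mul, G.norm_kap, mul_one]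
    have h1 : 1 ≤ 1 + |s| + t := by linarith [abs_nonneg s]
    calc _ ≤ (Kf' / (1 + |s| + t)) * (a * Kr / (1 + |s| + t)) + Kf *
        (a * Kr ^ 2 / (1 + |s| + t) ^ 2) := by
          gcongr
          · exact hf' s t ht
          · exact bρ s t ht
          · exact (hf s t ht).trans (div_le_self hKf h1)
          · exact bρ' s t ht
      _ = _ := by rw [hM1]; field_simp
  have bEE : ∀ s t : ℝ, 0 ≤ t → ‖E s t‖ ≤ 2 * G.Q * M0 / (1 + |s| + t) ^ 2 := fun s t ht => by
    simp only [hE]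
    rw [norm_mul, mul_div_assoc]
    exact mul_le_mul (hκ'2 s) (bE s t ht) (norm_nonneg _) (by positivity)
  have cpt : ∀ s, Continuous fun t : ℝ => G.pt s + t := fun s => by fun_prop
  have crefl : ∀ s, Continuous fun t : ℝ => G.refl s t := fun s => by
    unfold ConvexGraph.refl; fun_prop
  have cf : ∀ s, ContinuousOn (fun t : ℝ => f (G.pt s + t)) (Ioi 0) := fun s =>
    (hD.continuousOn_polyQuot_ray s).mono Ioi_subset_Ici_self
  have cf' : ∀ s, ContinuousOn (fun t : ℝ => f' (G.pt s + t)) (Ioi 0) := fun s =>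
    ((hD.pow 2).continuousOn_polyQuot_ray s).mono Ioi_subset_Ici_self
  have cR : ∀ s, ContinuousOn (fun t : ℝ => resolvent B (G.refl s t)) (Ioi 0) := fun s t ht =>
    (ContinuousAt.comp (g := resolvent B) (f := fun t : ℝ => G.refl s t)
      (spectrum.hasDerivAt_resolvent_const_left (𝕜 := ℂ) (hr s t (le_of_lt ht)).1).continuousAt
      (crefl s).continuousAt).continuousWithinAt
  have cρ : ∀ s, ContinuousOn (fun t : ℝ => ρ (G.refl s t)) (Ioi 0) := fun s =>
    continuousOn_const.inner ((cR s).clm_apply continuousOn_const)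
  have cρ' : ∀ s, ContinuousOn (fun t : ℝ => ρ' (G.refl s t)) (Ioi 0) := fun s =>
    (continuousOn_const.inner ((cR s).clm_apply ((cR s).clm_apply continuousOn_const))).neg
  have cFt : ∀ s, ContinuousOn (Ft s) (Ioi 0) := fun s =>
    continuousOn_const.mul (((cf' s).mul (cρ s)).add ((cf s).mul ((cρ' s).mul continuousOn_const)))
  have cI : ∀ s, ContinuousOn
      (fun t : ℝ => f (G.pt s + t) * (ρ (G.refl s t) + t * G.kap s * ρ' (G.refl s t)))
      (Ioi 0) := fun s =>
    (cf s).mul ((cρ s).add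
        ((by fun_prop : ContinuousOn (fun t : ℝ => (t : ℂ) * G.kap s) (Ioi 0)).mul (cρ' s)))
  have hEint : ∀ s, ∫ t in Ioi (0 : ℝ), E s t = κ' s * ∫ t in Ioi (0 : ℝ),
      polyQuot p D (G.pt s + t) * rayKernel G A u v s t := by
    intro s
    rw [← integral_const_mul]
    refine setIntegral_congr_fun measurableSet_Ioi fun t _ => ?_
    simp only [hE, hρ, hρ', rayKernel, ← hB, hfdef]
    ring
  have key := integral_boundary_eq_integral_ray (K := M) (Ca := 1 + G.L)
      (B := fun s => 2 * G.d2 s * M0)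
    (E := E) (F := F) (Ft := Ft) (Fy := Fy) (a := fun s => Complex.I * conj (G.nb s))
    (fun s t ht => by
      have h3 : HasDerivAt (fun s => G.pt s + t) (Complex.I * conj (G.nb s)) s :=
        (G.hasDerivAt_pt s).add_const _
      have h4 : HasDerivAt (fun s => G.refl s t) (-Complex.I * G.nb s + t * κ' s) s :=
        (G.hasDerivAt_conj_pt s).add ((G.hasDerivAt_kap s).const_mul _)
      refine ((G.hasDerivAt_kap s).mul
          (((df s t ht).comp s h3).mul ((dρ s t ht).comp s h4))).congr_deriv ?_
      simp only [hFy, hFt, hE, hκ', Function.comp, Pi.mul_apply]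
      linear_combination (-G.kap s * f (G.pt s + t) * ρ' (G.refl s t)) * G.kap_mul s)
    (fun s t ht => by
      have h3 : HasDerivAt (fun t : ℝ => G.pt s + t) (1 : ℝ) t :=
        ((hasDerivAt_id t).ofReal_comp).const_add _
      have h4 : HasDerivAt (fun t : ℝ => G.refl s t) ((1 : ℝ) * G.kap s) t :=
        (((hasDerivAt_id t).ofReal_comp).mul_const _).const_add _
      refine (((df s t ht).comp t h3).mul ((dρ s t ht).comp t h4)).const_mul
          (G.kap s) |>.congr_deriv ?_
      simp [hFt])
    (fun s t ht => rfl)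
    (fun s t ht => by
      have hp : 0 < 1 + |s| + t := by positivity
      simp only [hF]
      rw [norm_mul, G.norm_kap, one_mul, norm_mul]
      calc _ ≤ (Kf / (1 + |s| + t)) * (a * Kr / (1 + |s| + t)) := by
            gcongr
            · exact hf s t ht
            · exact bρ s t ht
        _ = Kf * (a * Kr) / (1 + |s| + t) ^ 2 := by field_simp
        _ ≤ _ := by
          gcongr
          rw [hM]
          have : 0 ≤ (1 + G.L) * M1 := by positivity
          have : 0 ≤ 2 * G.Q * M0 := by positivity
          linarith)
    (fun s t ht => by
      have hp : 0 < 1 + |s| + t := by positivity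
      simp only [hFy]
      refine (norm_add_le _ _).trans ?_
      rw [norm_mul]
      calc _ ≤ (1 + G.L) * (M1 / (1 + |s| + t) ^ 2) + 2 * G.Q * M0 / (1 + |s| + t) ^ 2 :=
            add_le_add (mul_le_mul (hγ s) (bFt s t ht) (norm_nonneg _) (by positivity)) (bEE s t ht)
        _ = ((1 + G.L) * M1 + 2 * G.Q * M0) / (1 + |s| + t) ^ 2 := by ring
        _ ≤ _ := by
          gcongr
          rw [hM]
          have : 0 ≤ Kf * (a * Kr) := by positivity
          linarith)
    (fun s t ht => (bFt s t ht).trans (by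
      gcongr
      rw [hM]
      have : 0 ≤ Kf * (a * Kr) := by positivity
      have : 0 ≤ 2 * G.Q * M0 := by positivity
      nlinarith))
    (fun s => (continuousOn_const.mul (cFt s)).add (continuousOn_const.mul (cI s)))
    cFt (continuous_const.mul G.continuous_conj_nb) hγ
    (fun s => by
      have hp : 0 < 1 + |s| := by positivity
      rw [hEint, norm_mul]
      refine mul_le_mul (G.norm_deriv_kap_le s) ?_ (norm_nonneg _)
          (by have := G.d2_nonneg s; positivity)
      have h5 := integrableOn_inv_sq hp M0
      calc _ ≤ M0 / (1 + |s|) := by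
            rw [← h5.2]
            refine norm_integral_le_of_norm_le h5.1 ?_
            filter_upwards [ae_restrict_mem measurableSet_Ioi] with t h0
            have h6 := bE s t (le_of_lt h0)
            refine le_trans (le_of_eq ?_) h6
            congr 1
            simp only [hρ, hρ', rayKernel, ← hB, hfdef]
            ring
        _ ≤ M0 := div_le_self hM00 (by linarith [abs_nonneg s]))
    ((G.integrable_d2.const_mul 2).mul_const M0)
  have e0 : ∀ s, G.refl s 0 = conj (G.pt s) := fun s => by simp [ConvexGraph.refl]
  have e2 : ∀ s, κ' s * ∫ t in Ioi (0 : ℝ), polyQuot p D (G.pt s + t) * rayKernel G A u v s t =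
        -Complex.I * (2 * G.d2 s / conj (G.nb s) ^ 2 *
      ∫ t in Ioi (0 : ℝ), polyQuot p D (G.pt s + t) * rayKernel G A u v s t) := fun s => by
      simp only [hκ']; ring
  simp only [hEint, e2] at key
  obtain ⟨keyi, key⟩ := key
  refine ⟨?_, fun s => ?_, ?_, ?_⟩
  · refine integrable_of_norm_le_inv_sq (K := (1 + G.L) * (Kf * (a * Kr))) (G.continuous_nb.mul
      (hD.continuous_polyQuot_pt.mul (hA.continuous_inner_adjoint_resolvent hη u v))) fun s => ?_
    have hp : 0 < 1 + |s| := by positivity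
    have h1 := hf s 0 le_rfl
    have h2 := bρ s 0 le_rfl
    rw [Complex.ofReal_zero, add_zero, add_zero] at h1
    rw [e0, add_zero] at h2
    rw [norm_mul, norm_mul]
    calc _ ≤ (1 + G.L) * ((Kf / (1 + |s|)) * (a * Kr / (1 + |s|))) := by
          have := G.norm_nb_le s
          gcongr
      _ = _ := by field_simp
  · have hp : 0 < 1 + |s| := by positivity
    have e3 : (fun t : ℝ => polyQuot p D (G.pt s + t) * rayKernel G A u v s t) =
        fun t : ℝ => f (G.pt s + t) * (ρ (G.refl s t) + t * G.kap s * ρ' (G.refl s t)) := by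
      ext t
      simp only [hρ, hρ', rayKernel, ← hB, hfdef]
      ring
    rw [e3]
    refine (integrableOn_inv_sq hp M0).1.mono' ((cI s).aestronglyMeasurable measurableSet_Ioi) ?_
    filter_upwards [ae_restrict_mem measurableSet_Ioi] with t h0
    exact bE s t (le_of_lt h0)
  · refine (keyi.const_mul Complex.I).congr (Eventually.of_forall fun s => ?_)
    simp only [← hfdef]
    linear_combination (-(2 * G.d2 s / conj (G.nb s) ^ 2 *
      ∫ t in Ioi (0 : ℝ), f (G.pt s + t) * rayKernel G A u v s t)) * Complex.I_mul_I
  · have e1 : ∀ s, Complex.I * conj (G.nb s) * F s 0 = -Complex.I *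
        (G.nb s * (polyQuot p D (G.pt s) *
        ⟪v, resolvent B (conj (G.pt s)) u⟫)) := fun s => by
      simp only [hF, e0, hρ, Complex.ofReal_zero, add_zero, ← hfdef]
      linear_combination (f (G.pt s) * ⟪v, resolvent B (conj (G.pt s)) u⟫) * G.kap_mul s
    simp only [e1, integral_const_mul] at key
    exact mul_left_cancel₀ (by simp) key

end Reflected

/-! ### Matrices of contractions and positive operators -/

section Positive

variable {H : Type u} [NormedAddCommGroup H] [InnerProductSpace ℂ H]

/-- The quadratic form of `M` at `∑ⱼ F i j • x j`, summed over `i`, depends on `Fᴴ F` only. -/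
lemma sum_inner_map_mulVec {m n : ℕ} (F : Matrix (Fin m) (Fin n) ℂ) (M : H →L[ℂ] H)
    (x : Fin n → H) :
    ∑ i, ⟪∑ j, F i j • x j, M (∑ j, F i j • x j)⟫ =
      ∑ j, ∑ k, (F.conjTranspose * F) j k * ⟪x j, M (x k)⟫ := by
  simp only [map_sum, sum_inner, inner_sum, map_smul, inner_smul_left, inner_smul_right,
    Matrix.mul_apply, Matrix.conjTranspose_apply, Finset.sum_mul, RCLike.star_def]
  simp only [Finset.mul_sum]
  rw [Finset.sum_comm]
  conv_rhs => rw [Finset.sum_comm]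
  refine Finset.sum_congr rfl fun k _ => ?_
  rw [Finset.sum_comm]
  exact Finset.sum_congr rfl fun j _ => Finset.sum_congr rfl fun i _ => by ring

open scoped Matrix.Norms.L2Operator ComplexOrder MatrixOrder in
/-- `1 - Fᴴ F` is positive semidefinite and hence of the form `Eᴴ E`. -/
lemma exists_conjTranspose_mul_self_add {m n : ℕ} {F : Matrix (Fin m) (Fin n) ℂ} (hF : ‖F‖ ≤ 1) :
    ∃ E : Matrix (Fin n) (Fin n) ℂ, F.conjTranspose * F + E.conjTranspose * E = 1 := by
  have hp : (1 - F.conjTranspose * F).PosSemidef := by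
    refine Matrix.PosSemidef.of_dotProduct_mulVec_nonneg ?_ fun v => ?_
    · simp [Matrix.IsHermitian, Matrix.conjTranspose_sub]
    · have h1 : star v ⬝ᵥ (1 - F.conjTranspose * F).mulVec v =
          ((‖WithLp.toLp 2 v‖ ^ 2 - ‖WithLp.toLp 2 (F.mulVec v)‖ ^ 2 : ℝ) : ℂ) := by
        rw [Matrix.sub_mulVec, dotProduct_sub, Matrix.one_mulVec, ← Matrix.mulVec_mulVec,
          Matrix.dotProduct_mulVec, ← Matrix.star_mulVec]
        have e : ∀ {k : ℕ} (w : Fin k → ℂ), star w ⬝ᵥ w = ((‖WithLp.toLp 2 w‖ ^ 2 : ℝ) : ℂ) := by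
          intro k w
          rw [EuclideanSpace.norm_sq_eq, dotProduct]
          push_cast
          exact Finset.sum_congr rfl fun i _ => by simp [Complex.conj_mul']
        rw [e, e]; push_cast; ring
      rw [h1]
      have h2 := Matrix.l2_opNorm_mulVec F (WithLp.toLp 2 v)
      have h3 : ‖WithLp.toLp 2 (F.mulVec v)‖ ≤ ‖WithLp.toLp 2 v‖ := by
        refine h2.trans ?_
        exact mul_le_of_le_one_left (norm_nonneg _) hF
      have : 0 ≤ ‖WithLp.toLp 2 v‖ ^ 2 - ‖WithLp.toLp 2 (F.mulVec v)‖ ^ 2 :=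
        sub_nonneg.2 (pow_le_pow_left₀ (norm_nonneg _) h3 2)
      exact_mod_cast this
  obtain ⟨E, hE⟩ := CStarAlgebra.nonneg_iff_eq_star_mul_self.1 hp.nonneg
  rw [Matrix.star_eq_conjTranspose] at hE
  exact ⟨E, by rw [← hE]; abel⟩

open scoped Matrix.Norms.L2Operator in
/-- The Cauchy–Schwarz inequality for a positive operator `M` and a matrix `F` of norm at most one.
Replacing the vectors `x j` by `∑ⱼ F i j • x j` decreases the sum of the values of the quadratic
form of `M`. -/
theorem norm_sum_mul_inner_le {m n : ℕ} {F : Matrix (Fin m) (Fin n) ℂ} (hF : ‖F‖ ≤ 1)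
    {M : H →L[ℂ] H} (hM : ∀ x, 0 ≤ (⟪x, M x⟫).re) (hs : ∀ x y, ⟪x, M y⟫ = conj ⟪y, M x⟫)
    (x : Fin n → H) (y : Fin m → H) :
    ‖∑ i, ∑ j, F i j * ⟪y i, M (x j)⟫‖ ≤
      (∑ j, (⟪x j, M (x j)⟫).re + ∑ i, (⟪y i, M (y i)⟫).re) / 2 := by
  obtain ⟨E, hE⟩ := exists_conjTranspose_mul_self_add hF
  set z : Fin m → H := fun i => ∑ j, F i j • x j with hz
  have h1 : ∑ i, (⟪z i, M (z i)⟫).re ≤ ∑ j, (⟪x j, M (x j)⟫).re := by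
    have h2 := sum_inner_map_mulVec F M x
    have h3 := sum_inner_map_mulVec E M x
    have h4 : ∑ i, ⟪∑ j, F i j • x j, M (∑ j, F i j • x j)⟫ +
        ∑ i, ⟪∑ j, E i j • x j, M (∑ j, E i j • x j)⟫ = ∑ j, ⟪x j, M (x j)⟫ := by
      rw [h2, h3, ← Finset.sum_add_distrib]
      refine Finset.sum_congr rfl fun j _ => ?_
      rw [← Finset.sum_add_distrib]
      have : ∀ k, (F.conjTranspose * F) j k * ⟪x j, M (x k)⟫ + (E.conjTranspose * E) j k *
          ⟪x j, M (x k)⟫ =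
          if j = k then ⟪x j, M (x k)⟫ else 0 := by
        intro k
        rw [← add_mul, ← Matrix.add_apply, hE, Matrix.one_apply]
        split_ifs <;> simp
      simp [this]
    have h5 := congrArg Complex.re h4
    simp only [Complex.add_re, Complex.re_sum] at h5
    have h6 : 0 ≤ ∑ i, (⟪∑ j, E i j • x j, M (∑ j, E i j • x j)⟫).re := Finset.sum_nonneg fun i _ =>
        hM _
    simp only [hz]
    linarith
  have e : ∑ i, ∑ j, F i j * ⟪y i, M (x j)⟫ = ∑ i, ⟪y i, M (z i)⟫ := by
    simp only [hz, map_sum, map_smul, inner_sum, inner_smul_right]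
  rw [e]
  set σ := ∑ i, ⟪y i, M (z i)⟫ with hσ
  -- a unimodular factor that makes `σ` nonnegative
  obtain ⟨c, hc1, hc2⟩ : ∃ c : ℂ, ‖c‖ = 1 ∧ c * σ = ‖σ‖ := by
    rcases eq_or_ne σ 0 with h | h
    · exact ⟨1, by simp, by simp [h]⟩
    · have h0 : (‖σ‖ : ℂ) ≠ 0 := by simpa using h
      refine ⟨conj σ / ‖σ‖, by simp [h], ?_⟩
      rw [div_mul_eq_mul_div, Complex.conj_mul']
      field_simp
  have hcc : conj c * c = 1 := by rw [Complex.conj_mul', hc1]; simp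
  have h7 : ∀ i, (⟪y i - c • z i, M (y i - c • z i)⟫).re =
      (⟪y i, M (y i)⟫).re + (⟪z i, M (z i)⟫).re - 2 * (c * ⟪y i, M (z i)⟫).re := by
    intro i
    have h8 : ⟪y i - c • z i, M (y i - c • z i)⟫ = ⟪y i, M (y i)⟫ + ⟪z i, M (z i)⟫ -
        (c * ⟪y i, M (z i)⟫ + conj (c * ⟪y i, M (z i)⟫)) := by
      rw [map_mul, ← hs]
      simp only [map_sub, map_smul, inner_sub_left, inner_sub_right, inner_smul_left,
          inner_smul_right]
      linear_combination ⟪z i, M (z i)⟫ * hcc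
    rw [h8]
    simp only [Complex.sub_re, Complex.add_re, Complex.conj_re]
    ring
  -- positivity at the vectors `y i - c z i` bounds the mixed terms
  have h9 : 0 ≤ ∑ i, (⟪y i - c • z i, M (y i - c • z i)⟫).re := Finset.sum_nonneg fun i _ => hM _
  have h10 : ∑ i, (c * ⟪y i, M (z i)⟫).re = ‖σ‖ := by
    rw [← Complex.re_sum, ← Finset.mul_sum, ← hσ, hc2, Complex.ofReal_re]
  simp only [h7, Finset.sum_add_distrib, Finset.sum_sub_distrib, ← Finset.mul_sum, h10] at h9
  linarith

end Positive

/-! ### The double layer density -/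

section Density

variable {H : Type u} [NormedAddCommGroup H] [InnerProductSpace ℂ H] [CompleteSpace H]
variable {G : ConvexGraph} {A : H →L[ℂ] H} {η : ℝ}

/-- The density of the operator valued double layer potential of `A` on the graph, with respect to
the height `s`: the selfadjoint part of `-(1 / π) * conj (nb s) * (pt s - A)⁻¹`. -/
def density (G : ConvexGraph) (A : H →L[ℂ] H) (s : ℝ) : H →L[ℂ] H :=
  (-(1 / (2 * Real.pi)) : ℂ) • (conj (G.nb s) • resolvent A (G.pt s) +
    G.nb s • resolvent (ContinuousLinearMap.adjoint A) (conj (G.pt s)))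

lemma inner_density (s : ℝ) (x y : H) : ⟪y, density G A s x⟫ =
    -(1 / (2 * Real.pi)) * (conj (G.nb s) * ⟪y, resolvent A (G.pt s) x⟫ +
    G.nb s * ⟪y, resolvent (ContinuousLinearMap.adjoint A) (conj (G.pt s)) x⟫) := by
  simp only [density, smul_apply, add_apply, inner_smul_right, inner_add_right]

lemma inner_resolvent_adjoint {z : ℂ} (hz : z ∈ resolventSet ℂ A)
    (hz' : conj z ∈ resolventSet ℂ (ContinuousLinearMap.adjoint A)) (x y : H) :
    ⟪y, resolvent (ContinuousLinearMap.adjoint A) (conj z) x⟫ = conj ⟪x, resolvent A z y⟫ := by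
  set u := resolvent A z y with hu
  set v := resolvent (ContinuousLinearMap.adjoint A) (conj z) x with hv
  have h1 : z • u - A u = y := sub_apply_resolvent hz y
  have h2 : conj z • v - ContinuousLinearMap.adjoint A v = x := sub_apply_resolvent hz' x
  rw [inner_conj_symm]
  nth_rewrite 1 [← h1]
  rw [← h2]
  simp only [inner_sub_left, inner_sub_right, inner_smul_left, inner_smul_right,
    ContinuousLinearMap.adjoint_inner_right]

lemma InsideGraph.mem_resolventSet (hA : InsideGraph G A η) (hη : 0 < η) (s : ℝ) :
    G.pt s ∈ resolventSet ℂ A := by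
  obtain ⟨K, hK⟩ := hA.resolvent_bound hη
  simpa using (hK s 0 le_rfl).1

lemma InsideGraph.mem_resolventSet_adjoint (hA : InsideGraph G A η) (hη : 0 < η) (s : ℝ) :
    conj (G.pt s) ∈ resolventSet ℂ (ContinuousLinearMap.adjoint A) := by
  obtain ⟨K, hK⟩ := hA.adjoint_resolvent_bound hη
  simpa using (hK s 0 le_rfl).1

lemma InsideGraph.inner_density_symm (hA : InsideGraph G A η) (hη : 0 < η) (s : ℝ) (x y : H) :
    ⟪x, density G A s y⟫ = conj ⟪y, density G A s x⟫ := by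
  rw [inner_density, inner_density, inner_resolvent_adjoint (hA.mem_resolventSet hη s)
    (hA.mem_resolventSet_adjoint hη s), inner_resolvent_adjoint (hA.mem_resolventSet hη s)
    (hA.mem_resolventSet_adjoint hη s)]
  simp only [map_mul, map_add, map_neg, map_div₀, Complex.conj_conj, map_one, Complex.conj_ofReal,
      map_ofNat]
  ring

lemma InsideGraph.re_inner_density (hA : InsideGraph G A η) (hη : 0 < η) (s : ℝ) (x : H) :
    (⟪x, density G A s x⟫).re = -(1 / Real.pi) *
        (conj (G.nb s) * ⟪x, resolvent A (G.pt s) x⟫).re := by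
  have h1 : ⟪x, density G A s x⟫ = ((-(1 / (2 * Real.pi)) : ℝ) : ℂ) *
      (conj (G.nb s) * ⟪x, resolvent A (G.pt s) x⟫ +
          conj (conj (G.nb s) * ⟪x, resolvent A (G.pt s) x⟫)) := by
    rw [inner_density, inner_resolvent_adjoint (hA.mem_resolventSet hη s)
      (hA.mem_resolventSet_adjoint hη s)]
    simp only [map_mul, Complex.conj_conj]
    push_cast
    ring
  rw [h1, Complex.re_ofReal_mul, Complex.add_re, Complex.conj_re]
  have := Real.pi_ne_zero
  field_simp
  ring

/-- The density is positive because the numerical range lies on the inner side of the tangent. -/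
lemma InsideGraph.density_nonneg (hA : InsideGraph G A η) (hη : 0 < η) (s : ℝ) (x : H) :
    0 ≤ (⟪x, density G A s x⟫).re := by
  rw [hA.re_inner_density hη]
  set u := resolvent A (G.pt s) x with hu
  have h1 : G.pt s • u - A u = x := sub_apply_resolvent (hA.mem_resolventSet hη s) x
  have h2 : ⟪x, u⟫ = -conj (⟪u, A u⟫ - G.pt s * ‖u‖ ^ 2) := by
    rw [← h1, inner_sub_left, inner_smul_left, map_sub, inner_conj_symm, inner_self_eq_norm_sq_to_K]
    simp
  have h3 := hA s u
  rw [h2, mul_neg, ← map_mul, Complex.neg_re, Complex.conj_re]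
  have h4 : 0 ≤ (G.nb s * (⟪u, A u⟫ - G.pt s * ‖u‖ ^ 2)).re := le_trans (by positivity) h3
  have := Real.pi_pos
  have : 0 ≤ 1 / Real.pi * (G.nb s * (⟪u, A u⟫ - G.pt s * ‖u‖ ^ 2)).re := by positivity
  linarith

lemma InsideGraph.continuous_inner_density (hA : InsideGraph G A η) (hη : 0 < η) (x y : H) :
    Continuous fun s => ⟪y, density G A s x⟫ := by
  simp only [inner_density]
  exact continuous_const.mul ((G.continuous_conj_nb.mul (hA.continuous_inner_resolvent hη x y)).add
    (G.continuous_nb.mul (hA.continuous_inner_adjoint_resolvent hη x y)))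

end Density

lemma arg_le_of_neg_mul_le {u : ℂ} {L : ℝ} (hL : 0 ≤ L) (hi : 0 < u.im) (hr : -(L * u.im) ≤ u.re) :
    u.arg ≤ Real.pi / 2 + Real.arctan L := by
  set β := Real.arctan L with hβ
  have hβ0 : 0 ≤ β := Real.arctan_nonneg.2 hL
  have hβ1 : β < Real.pi / 2 := Real.arctan_lt_pi_div_two L
  by_contra! h
  have h1 := Complex.arg_le_pi u
  have hn : 0 < ‖u‖ := norm_pos_iff.2 (by rintro rfl; simp at hi)
  have h2 : Real.cos (u.arg - β) < 0 :=
    Real.cos_neg_of_pi_div_two_lt_of_lt (by linarith) (by linarith)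
  have hc : 0 < Real.cos β := Real.cos_pos_of_mem_Ioo ⟨by linarith, hβ1⟩
  have hs : Real.sin β = L * Real.cos β := by
    rw [← Real.tan_arctan L, ← hβ, Real.tan_mul_cos hc.ne']
  have h3 : ‖u‖ * Real.cos (u.arg - β) = Real.cos β * (u.re + L * u.im) := by
    rw [Real.cos_sub, hs]
    have e1 := Complex.norm_mul_cos_arg u
    have e2 := Complex.norm_mul_sin_arg u
    linear_combination Real.cos β * e1 + L * Real.cos β * e2
  have h4 : 0 ≤ Real.cos β * (u.re + L * u.im) := mul_nonneg hc.le (by linarith)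
  nlinarith

namespace ConvexGraph

variable (G : ConvexGraph)

/-- The angle under which an arc of the graph is seen from the base point. As the slope is bounded
by `L`, the graph stays outside the sector of half angle `π / 2 - arctan L` at the base point. -/
lemma re_integral_inv_sub_ctr (Y : ℝ) (hY : 0 < Y) :
    -(∫ s in (-Y)..Y, conj (G.nb s) * (G.pt s - G.ctr)⁻¹).re ≤ Real.pi + 2 * Real.arctan G.L := by
  have hd : ∀ s, HasDerivAt (fun s => -Complex.I * Complex.log (G.ctr - G.pt s))
      (conj (G.nb s) * (G.pt s - G.ctr)⁻¹) s := by
    intro s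
    have h4 := ((G.hasDerivAt_pt s).const_sub G.ctr).clog_real (G.ctr_sub_pt_mem_slitPlane s)
    refine (h4.const_mul (-Complex.I)).congr_deriv ?_
    rw [← neg_sub (G.pt s) G.ctr]
    have := G.pt_sub_ctr_ne s
    field_simp
    linear_combination (-conj (G.nb s)) * Complex.I_sq
  have hc : Continuous fun s => conj (G.nb s) * (G.pt s - G.ctr)⁻¹ :=
    G.continuous_conj_nb.mul ((G.continuous_pt.sub continuous_const).inv₀ G.pt_sub_ctr_ne)
  rw [intervalIntegral.integral_eq_sub_of_hasDerivAt (fun s _ => hd s) (hc.intervalIntegrable _ _)]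
  have e : (-Complex.I * Complex.log (G.ctr - G.pt Y) - -Complex.I *
      Complex.log (G.ctr - G.pt (-Y))).re =
      (G.ctr - G.pt Y).arg - (G.ctr - G.pt (-Y)).arg := by
    simp [Complex.log_im, sub_eq_add_neg]
  rw [e]
  have h1 : (G.ctr - G.pt (-Y)).arg ≤ Real.pi / 2 + Real.arctan G.L := by
    refine arg_le_of_neg_mul_le G.L_nonneg (by simpa [ctr_im] using hY) ?_
    have := (abs_le.1 (G.abs_fn_sub_le 0 (-Y))).2
    simp only [Complex.sub_im, Complex.sub_re, pt_re, pt_im, ctr_re, ctr_im, sub_zero, abs_neg,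
      abs_of_pos hY, zero_sub, neg_neg] at this ⊢
    linarith
  have h2 : -(G.ctr - G.pt Y).arg ≤ Real.pi / 2 + Real.arctan G.L := by
    have hne : (G.ctr - G.pt Y).arg ≠ Real.pi := by
      intro h
      rw [Complex.arg_eq_pi_iff] at h
      have := h.2
      simp [ctr_im] at this
      linarith
    have h3 : (conj (G.ctr - G.pt Y)).arg = -(G.ctr - G.pt Y).arg := by
      rw [Complex.arg_conj, if_neg hne]
    rw [← h3]
    refine arg_le_of_neg_mul_le G.L_nonneg (by simpa [ctr_im] using hY) ?_
    have := (abs_le.1 (G.abs_fn_sub_le 0 Y)).2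
    simp only [Complex.conj_re, Complex.conj_im, Complex.sub_im, Complex.sub_re, pt_re, pt_im,
        ctr_re, ctr_im,
      sub_zero, abs_of_pos hY, zero_sub, neg_neg] at this ⊢
    linarith
  linarith

end ConvexGraph

section Mass

variable {H : Type u} [NormedAddCommGroup H] [InnerProductSpace ℂ H] [CompleteSpace H]
variable {G : ConvexGraph} {A : H →L[ℂ] H} {η : ℝ}

/-- The total mass of the double layer potential is bounded through the angle under which the graph
is seen from the base point. -/
theorem InsideGraph.integral_density_le (hA : InsideGraph G A η) (hη : 0 < η) (x : H) :
    (Integrable fun s => (⟪x, density G A s x⟫).re) ∧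
    ∫ s, (⟪x, density G A s x⟫).re ≤ (1 + 2 * Real.arctan G.L / Real.pi) * ‖x‖ ^ 2 := by
  have hπ := Real.pi_pos
  obtain ⟨hi, h0⟩ := hA.integral_resolvent_sub_model hη x x
  set h : ℝ → ℂ := fun s =>
      conj (G.nb s) * (⟪x, resolvent A (G.pt s) x⟫ - ⟪x, x⟫ * (G.pt s - G.ctr)⁻¹) with hh
  have hcont : Continuous fun s => (⟪x, density G A s x⟫).re :=
    Complex.continuous_re.comp (hA.continuous_inner_density hη x x)
  have hc2 : Continuous fun s => conj (G.nb s) * (G.pt s - G.ctr)⁻¹ :=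
    G.continuous_conj_nb.mul ((G.continuous_pt.sub continuous_const).inv₀ G.pt_sub_ctr_ne)
  have key : ∀ Y : ℝ, 0 < Y → ∫ s in (-Y)..Y, (⟪x, density G A s x⟫).re ≤
      (1 + 2 * Real.arctan G.L / Real.pi) * ‖x‖ ^ 2 - (1 / Real.pi) * (∫ s in (-Y)..Y, h s).re := by
    intro Y hY
    have e : ∀ s, (⟪x, density G A s x⟫).re = -(1 / Real.pi) * (h s).re -
        (‖x‖ ^ 2 / Real.pi) * (conj (G.nb s) * (G.pt s - G.ctr)⁻¹).re := by
      intro s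
      rw [hA.re_inner_density hη]
      have e1 : conj (G.nb s) * ⟪x, resolvent A (G.pt s) x⟫ = h s + ((‖x‖ ^ 2 : ℝ) : ℂ) *
          (conj (G.nb s) * (G.pt s - G.ctr)⁻¹) := by
        simp only [hh, inner_self_eq_norm_sq_to_K]
        push_cast
        simp only [Complex.coe_algebraMap]
        ring
      rw [e1, Complex.add_re, Complex.re_ofReal_mul]
      ring
    have i1 : IntervalIntegrable h volume (-Y) Y := hi.intervalIntegrable
    have i2 : IntervalIntegrable (fun s => conj (G.nb s) * (G.pt s - G.ctr)⁻¹) volume (-Y) Y :=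
      hc2.intervalIntegrable _ _
    have r1 : ∫ s in (-Y)..Y, (h s).re = (∫ s in (-Y)..Y, h s).re :=
      (Complex.reCLM.intervalIntegral_comp_comm i1)
    have r2 : ∫ s in (-Y)..Y, (conj (G.nb s) * (G.pt s - G.ctr)⁻¹).re =
        (∫ s in (-Y)..Y, conj (G.nb s) * (G.pt s - G.ctr)⁻¹).re :=
      (Complex.reCLM.intervalIntegral_comp_comm i2)
    have i1' : IntervalIntegrable (fun s => (h s).re) volume (-Y) Y := hi.re.intervalIntegrable
    have i2' : IntervalIntegrable (fun s => (conj (G.nb s) * (G.pt s - G.ctr)⁻¹).re) volume (-Y)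
        Y :=
      (Complex.continuous_re.comp hc2).intervalIntegrable _ _
    simp only [e]
    rw [intervalIntegral.integral_sub (i1'.const_mul _) (i2'.const_mul _),
      intervalIntegral.integral_const_mul, intervalIntegral.integral_const_mul, r1, r2]
    have hw := mul_le_mul_of_nonneg_left (G.re_integral_inv_sub_ctr Y hY)
      (by positivity : (0 : ℝ) ≤ ‖x‖ ^ 2 / Real.pi)
    have e3 : ‖x‖ ^ 2 / Real.pi * (Real.pi + 2 * Real.arctan G.L) =
        (1 + 2 * Real.arctan G.L / Real.pi) * ‖x‖ ^ 2 := by field_simp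
    rw [e3] at hw
    linarith
  have hint : Integrable fun s => (⟪x, density G A s x⟫).re := by
    -- the integrand is nonnegative, so bounded integrals over `[-Y, Y]` suffice
    refine integrable_of_intervalIntegral_norm_bounded (l := atTop) (a := fun i : ℝ => -i) (b := id)
      ((1 + 2 * Real.arctan G.L / Real.pi) * ‖x‖ ^ 2 + (1 / Real.pi) * ∫ s, ‖h s‖)
      (fun i => (hcont.integrableOn_Icc).mono_set Ioc_subset_Icc_self)
      tendsto_neg_atTop_atBot tendsto_id ?_
    filter_upwards [eventually_gt_atTop 0] with Y hY
    have e : (fun s => ‖(⟪x, density G A s x⟫).re‖) = fun s => (⟪x, density G A s x⟫).re :=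
      funext fun s => Real.norm_of_nonneg (hA.density_nonneg hη s x)
    rw [e]
    refine (key Y hY).trans ?_
    have h1 : -(∫ s in (-Y)..Y, h s).re ≤ ∫ s, ‖h s‖ := by
      refine (neg_le_abs _).trans ((Complex.abs_re_le_norm _).trans ?_)
      rw [intervalIntegral.integral_of_le (by linarith)]
      refine (norm_integral_le_integral_norm _).trans ?_
      exact setIntegral_le_integral hi.norm (Eventually.of_forall fun s => norm_nonneg _)
    have := mul_le_mul_of_nonneg_left h1 (by positivity : (0 : ℝ) ≤ 1 / Real.pi)
    linarith
  refine ⟨hint, ?_⟩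
  have t1 := intervalIntegral_tendsto_integral (l := atTop) (a := fun i : ℝ => -i) (b := id) hint
    tendsto_neg_atTop_atBot tendsto_id
  have t2 := intervalIntegral_tendsto_integral (l := atTop) (a := fun i : ℝ => -i) (b := id) hi
    tendsto_neg_atTop_atBot tendsto_id
  rw [h0] at t2
  have t3 := ((Complex.continuous_re.tendsto _).comp t2).const_mul (1 / Real.pi)
  have t4 := t3.const_sub ((1 + 2 * Real.arctan G.L / Real.pi) * ‖x‖ ^ 2)
  rw [Complex.zero_re, mul_zero, sub_zero] at t4
  refine le_of_tendsto_of_tendsto t1 t4 ?_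
  filter_upwards [eventually_gt_atTop 0] with Y hY
  exact key Y hY

/-- The functional calculus through the double layer potential: the correction term is an
integral over the rotation of the tangent line. -/
theorem InsideGraph.inner_eq_integral_density (hA : InsideGraph G A η) (hη : 0 < η) {p D : ℂ[X]}
    (hD : G.RootsOutside D) (hk : p.natDegree + 1 ≤ D.natDegree) {x x' : H} (y : H)
    (hx : aeval A D x' = aeval A p x) :
    (Integrable fun s => polyQuot p D (G.pt s) * ⟪y, density G A s x⟫) ∧
    (∀ s, IntegrableOn (fun t : ℝ => polyQuot p D (G.pt s + t) * rayKernel G A x y s t) (Ioi 0)) ∧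
    (Integrable fun s => G.d2 s / conj (G.nb s) ^ 2 *
      ∫ t in Ioi (0 : ℝ), polyQuot p D (G.pt s + t) * rayKernel G A x y s t) ∧
    ⟪y, x'⟫ = (∫ s, polyQuot p D (G.pt s) * ⟪y, density G A s x⟫) +
      (1 / Real.pi) * ∫ s, G.d2 s / conj (G.nb s) ^ 2 *
        ∫ t in Ioi (0 : ℝ), polyQuot p D (G.pt s + t) * rayKernel G A x y s t := by
  have hπ : (Real.pi : ℂ) ≠ 0 := by exact_mod_cast Real.pi_ne_zero
  have h1 := hA.cauchyIntegral_eq hη hD hk y hx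
  have i1 := hA.integrable_cauchy hη hD hk x y
  obtain ⟨i2, i3, i4, h2⟩ := hA.integral_reflected hη hD hk x y
  have e : ∀ s, polyQuot p D (G.pt s) * ⟪y, density G A s x⟫ = -(1 / (2 * Real.pi)) *
      (conj (G.nb s) * (polyQuot p D (G.pt s) * ⟪y, resolvent A (G.pt s) x⟫) +
      G.nb s * (polyQuot p D (G.pt s) *
          ⟪y, resolvent (ContinuousLinearMap.adjoint A) (conj (G.pt s)) x⟫)) := by
    intro s; rw [inner_density]; ring
  simp only [e]
  have e2 : ∀ s, 2 * (G.d2 s : ℂ) / conj (G.nb s) ^ 2 * ∫ t in Ioi (0 : ℝ),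
      polyQuot p D (G.pt s + t) * rayKernel G A x y s t
      = 2 * (G.d2 s / conj (G.nb s) ^ 2 * ∫ t in Ioi (0 : ℝ), polyQuot p D (G.pt s + t) *
          rayKernel G A x y s t) := by
    intro s; ring
  simp only [e2] at h2 i4
  refine ⟨(i1.add i2).const_mul _, i3, ?_, ?_⟩
  · refine (i4.const_mul (1 / 2)).congr (Eventually.of_forall fun s => ?_)
    simp only [← mul_assoc]
    norm_num
  rw [integral_const_mul, integral_add i1 i2, h2]
  rw [cauchyIntegral] at h1
  rw [h1]
  simp only [integral_const_mul]
  field_simp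
  ring

end Mass

/-! ### The half-plane and the estimate of the reflected term -/

/-- The modulus of `i s / (i s + t (1 + i d))²` for real `s`, `t` and `d`. -/
def rayWeight (d s t : ℝ) : ℝ := |s| / (t ^ 2 + (s + t * d) ^ 2)

lemma rayWeight_nonneg (d s t : ℝ) : 0 ≤ rayWeight d s t := by unfold rayWeight; positivity

/-- A primitive is `arctan (((1 + d²) t + s d) / s)`, which runs from `arctan d` to `π / 2`. -/
lemma integral_rayWeight_of_pos (d : ℝ) {s : ℝ} (hs : 0 < s) :
    IntegrableOn (rayWeight d s) (Ioi 0) ∧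
    ∫ t in Ioi (0 : ℝ), rayWeight d s t ≤ Real.pi / 2 + |Real.arctan d| := by
  have hd : ∀ t ∈ Ioi (0 : ℝ), HasDerivAt (fun t : ℝ => Real.arctan (((1 + d ^ 2) * t + s * d) / s))
      (rayWeight d s t) t := by
    intro t ht
    have ht' : (0 : ℝ) < t := ht
    have h1 : HasDerivAt (fun t : ℝ => ((1 + d ^ 2) * t + s * d) / s) ((1 + d ^ 2) / s) t := by
      simpa using ((((hasDerivAt_id t).const_mul (1 + d ^ 2)).add_const (s * d)).div_const s)
    refine h1.arctan.congr_deriv ?_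
    rw [rayWeight, abs_of_pos hs]
    have h2 : 0 < t ^ 2 + (s + t * d) ^ 2 := by positivity
    field_simp
    ring
  have hc : ContinuousWithinAt (fun t : ℝ => Real.arctan (((1 + d ^ 2) * t + s * d) / s)) (Ici 0)
      0 := by
    have : Continuous fun t : ℝ => Real.arctan (((1 + d ^ 2) * t + s * d) / s) := by fun_prop
    exact this.continuousWithinAt
  have hl : Tendsto (fun t : ℝ => Real.arctan (((1 + d ^ 2) * t + s * d) / s)) atTop
      (𝓝 (Real.pi / 2)) := by
    have h1 : Tendsto (fun t : ℝ => ((1 + d ^ 2) * t + s * d) / s) atTop atTop :=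
      (tendsto_atTop_add_const_right _ _
          (tendsto_id.const_mul_atTop (by positivity))).atTop_div_const hs
    exact (Real.tendsto_arctan_atTop.mono_right nhdsWithin_le_nhds).comp h1
  have hn : ∀ t ∈ Ioi (0 : ℝ), 0 ≤ rayWeight d s t := fun t _ => rayWeight_nonneg d s t
  refine ⟨integrableOn_Ioi_deriv_of_nonneg hc hd hn hl, ?_⟩
  rw [integral_Ioi_of_hasDerivAt_of_nonneg hc hd hn hl]
  have e : ((1 + d ^ 2) * 0 + s * d) / s = d := by field_simp; ring
  rw [e]
  linarith [neg_abs_le (Real.arctan d)]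

lemma integral_rayWeight_le (d s : ℝ) :
    IntegrableOn (rayWeight d s) (Ioi 0) ∧
    ∫ t in Ioi (0 : ℝ), rayWeight d s t ≤ Real.pi / 2 + |Real.arctan d| := by
  rcases lt_trichotomy s 0 with hs | rfl | hs
  · have h := integral_rayWeight_of_pos (-d) (neg_pos.2 hs)
    have e : rayWeight (-d) (-s) = rayWeight d s := by
      ext t; unfold rayWeight; rw [abs_neg]; congr 1; ring
    rwa [e, Real.arctan_neg, abs_neg] at h
  · have e : rayWeight d 0 = fun _ => 0 := by ext t; simp [rayWeight]
    rw [e]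
    refine ⟨integrableOn_zero, ?_⟩
    have := Real.pi_pos
    simp only [integral_zero]
    positivity
  · exact integral_rayWeight_of_pos d hs

/-- The right half-plane, as the region to the right of the zero function. -/
def halfPlane : ConvexGraph where
  fn := fun _ => 0
  d1 := fun _ => 0
  d2 := fun _ => 0
  L := 0
  Q := 0
  hasDerivAt_fn := fun y => hasDerivAt_const y 0
  hasDerivAt_d1 := fun y => hasDerivAt_const y 0
  continuous_d2 := continuous_const
  d2_nonneg := fun _ => le_rfl
  d2_le := fun _ => le_rfl
  abs_d1_le := fun _ => by simp

lemma integral_sum_sum_mul {X : Type*} [MeasurableSpace X] {μ : Measure X} {m n : ℕ}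
    {g : Fin m → Fin n → X → ℂ} {c : Fin m → Fin n → ℂ} (hg : ∀ i j, Integrable (g i j) μ) :
    ∫ r, ∑ i, ∑ j, c i j * g i j r ∂μ = ∑ i, ∑ j, c i j * ∫ r, g i j r ∂μ := by
  rw [integral_finsetSum _ fun i _ => integrable_finsetSum _ fun j _ => (hg i j).const_mul _]
  refine Finset.sum_congr rfl fun i _ => ?_
  rw [integral_finsetSum _ fun j _ => (hg i j).const_mul _]
  exact Finset.sum_congr rfl fun j _ => integral_const_mul _ _

section RayBound

variable {H : Type u} [NormedAddCommGroup H] [InnerProductSpace ℂ H] [CompleteSpace H]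
variable {G : ConvexGraph} {A : H →L[ℂ] H} {η : ℝ}

/-- The adjoint of `A`, moved so that the tangent line of the graph at height `s` becomes the
imaginary axis. -/
def tangentOp (G : ConvexGraph) (A : H →L[ℂ] H) (s : ℝ) : H →L[ℂ] H :=
  conj (G.nb s) • (ContinuousLinearMap.adjoint A - conj (G.pt s) • ContinuousLinearMap.id ℂ H)

lemma tangentOp_apply (s : ℝ) (x : H) : tangentOp G A s x =
    conj (G.nb s) • (ContinuousLinearMap.adjoint A x - conj (G.pt s) • x) := by
  simp [tangentOp]

lemma InsideGraph.insideGraph_tangentOp (hA : InsideGraph G A η) (s : ℝ) :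
    InsideGraph halfPlane (tangentOp G A s) η := by
  intro y x
  have h := hA s x
  have e : ⟪x, tangentOp G A s x⟫ =
      conj (G.nb s * (⟪x, A x⟫ - G.pt s * ‖x‖ ^ 2)) := by
    rw [tangentOp_apply]
    simp only [inner_smul_right, inner_sub_right, ContinuousLinearMap.adjoint_inner_right,
      inner_self_eq_norm_sq_to_K, map_mul, map_sub, inner_conj_symm, map_pow]
    simp
  have h1 : halfPlane.nb y = 1 := by simp [ConvexGraph.nb, halfPlane]
  have h2 : halfPlane.pt y * (‖x‖ : ℂ) ^ 2 = ((y * ‖x‖ ^ 2 : ℝ) : ℂ) * Complex.I := by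
    simp only [ConvexGraph.pt, halfPlane]
    push_cast
    ring
  rw [e, h1, h2, one_mul, Complex.sub_re, Complex.conj_re, Complex.re_ofReal_mul, Complex.I_re,
    mul_zero, sub_zero]
  exact h

/-- The kernel is the function `z / (z + t * nb s)²` of `tangentOp G A s`, up to a factor. For the
half-plane there is no correction term, and the double layer formula is the Poisson formula. -/
lemma InsideGraph.rayKernel_eq (hA : InsideGraph G A η) (hη : 0 < η) (s : ℝ) {t : ℝ} (ht : 0 < t)
    (u v : H) :
    (Integrable fun r => polyQuot X ((X + Polynomial.C (t * G.nb s)) ^ 2) (halfPlane.pt r) *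
      ⟪v, density halfPlane (tangentOp G A s) r u⟫) ∧
    rayKernel G A u v s t = -conj (G.nb s) *
      ∫ r, polyQuot X ((X + Polynomial.C (t * G.nb s)) ^ 2) (halfPlane.pt r) *
        ⟪v, density halfPlane (tangentOp G A s) r u⟫ := by
  obtain ⟨K, hK⟩ := hA.adjoint_resolvent_bound hη
  have hz : G.refl s t ∈ resolventSet ℂ (ContinuousLinearMap.adjoint A) := (hK s t ht.le).1
  set B := ContinuousLinearMap.adjoint A with hB
  set T := tangentOp G A s with hT
  have hb := G.conj_nb_ne s
  set w := resolvent B (G.refl s t) u with hw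
  set w' := resolvent B (G.refl s t) w with hw'
  have h1 : G.refl s t • w - B w = u := sub_apply_resolvent hz u
  have h2 : G.refl s t • w' - B w' = w := sub_apply_resolvent hz w
  have hκ : conj (G.nb s) * G.kap s = -G.nb s := by
    rw [ConvexGraph.kap]; field_simp
  -- the shifted operator is a multiple of `refl - B`
  have hTb : ∀ z, T z + ((t : ℂ) * G.nb s) • z = -conj (G.nb s) • (G.refl s t • z - B z) := by
    intro z
    rw [hT, tangentOp_apply, ConvexGraph.refl, ← hB]
    have e : (t : ℂ) * G.nb s = -(conj (G.nb s) * (t * G.kap s)) := by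
      linear_combination (t : ℂ) * hκ
    rw [e]
    module
  set D : ℂ[X] := (X + Polynomial.C (t * G.nb s)) ^ 2 with hD
  have hroots : halfPlane.RootsOutside D := by
    refine ⟨pow_ne_zero _ (X_add_C_ne_zero _), fun z hz => ?_⟩
    have h3 : z = -(t * G.nb s) := by
      have : z + t * G.nb s = 0 := by simpa [hD] using hz
      exact eq_neg_of_add_eq_zero_left this
    simp [h3, halfPlane, ht]
  have hdeg : (X : ℂ[X]).natDegree + 1 ≤ D.natDegree := by
    rw [hD, natDegree_pow, natDegree_X_add_C, natDegree_X]
  set x' : H := -(conj (G.nb s))⁻¹ • (w - (t * G.kap s) • w') with hx'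
  have hstep : aeval T D x' = aeval T (X : ℂ[X]) u := by
    have e1 : ∀ z, aeval T D z = (fun z => T z + ((t : ℂ) * G.nb s) • z)
        ((fun z => T z + ((t : ℂ) * G.nb s) • z) z) := by
      intro z
      have e0 : aeval T D = (T + ((t : ℂ) * G.nb s) • 1) * (T + ((t : ℂ) * G.nb s) • 1) := by
        rw [hD, pow_two, map_mul, map_add, aeval_X, aeval_C, Algebra.algebraMap_eq_smul_one]
      rw [e0]
      rfl
    rw [e1, aeval_X]
    simp only
    have e2 : T x' + ((t : ℂ) * G.nb s) • x' = u - (t * G.kap s) • w := by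
      rw [hTb, hx']
      have : G.refl s t • (-(conj (G.nb s))⁻¹ • (w - (t * G.kap s) • w')) -
          B (-(conj (G.nb s))⁻¹ • (w - (t * G.kap s) • w')) =
          -(conj (G.nb s))⁻¹ •
              ((G.refl s t • w - B w) - (t * G.kap s) • (G.refl s t • w' - B w')) := by
        simp only [map_smul, map_sub]
        module
      rw [this, h1, h2, smul_smul, neg_mul_neg, mul_inv_cancel₀ hb, one_smul]
    rw [e2, hTb]
    have e3 : G.refl s t • (u - (t * G.kap s) • w) - B (u - (t * G.kap s) • w) =
        (G.refl s t • u - B u) - (t * G.kap s) • (G.refl s t • w - B w) := by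
      simp only [map_smul, map_sub]
      module
    rw [e3, h1, hT, tangentOp_apply, ConvexGraph.refl, ← hB]
    module
  have key := (hA.insideGraph_tangentOp s).inner_eq_integral_density hη hroots hdeg v hstep
  refine ⟨key.1, ?_⟩
  have h5 := key.2.2.2
  have h6 : ∀ r, halfPlane.d2 r = 0 := fun r => rfl
  -- the tangent of the half-plane does not rotate, so the correction term is zero
  simp only [h6, Complex.ofReal_zero, zero_div, zero_mul, integral_zero, mul_zero, add_zero] at h5
  rw [← h5, hx', rayKernel, inner_smul_right, inner_sub_right, inner_smul_right]
  field_simp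
  rfl

lemma norm_polyQuot_halfPlane (s r : ℝ) (t : ℝ) :
    ‖polyQuot X ((X + Polynomial.C (t * G.nb s)) ^ 2) (halfPlane.pt r)‖ =
        rayWeight (G.d1 s) r t := by
  have e : halfPlane.pt r = r * Complex.I := by simp [ConvexGraph.pt, halfPlane]
  rw [polyQuot, e, rayWeight]
  simp only [eval_X, eval_pow, eval_add, eval_C, norm_div, norm_pow, norm_mul, Complex.norm_I,
    mul_one, Complex.norm_real, Real.norm_eq_abs]
  congr 1
  rw [← Complex.normSq_eq_norm_sq, Complex.normSq_apply]
  simp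
  ring

open scoped Matrix.Norms.L2Operator in
/-- The estimate of the reflected term along one ray: by the Poisson formula of the half-plane
bounded by the tangent line it is governed by the scalar integral of `rayWeight`. -/
theorem InsideGraph.norm_integral_rayKernel_le (hA : InsideGraph G A η) (hη : 0 < η) (s : ℝ)
    {m n : ℕ} {F : ℝ → Matrix (Fin m) (Fin n) ℂ} (hF : ∀ t, 0 < t → ‖F t‖ ≤ 1)
    (x : Fin n → H) (y : Fin m → H) :
    ‖∫ t in Ioi (0 : ℝ), ∑ i, ∑ j, F t i j * rayKernel G A (x j) (y i) s t‖ ≤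
      ‖G.nb s‖ * (Real.pi / 2 + |Real.arctan (G.d1 s)|) *
          ((∑ j, ‖x j‖ ^ 2 + ∑ i, ‖y i‖ ^ 2) / 2) := by
  have hT := hA.insideGraph_tangentOp s
  set T := tangentOp G A s with hTdef
  set S := Real.pi / 2 + |Real.arctan (G.d1 s)| with hS
  have hS0 : 0 ≤ S := by have := Real.pi_pos; positivity
  -- the Poisson measure of the half-plane in the directions of the given vectors; its mass is at
  -- most one, since the slope bound of the half-plane is `0`
  set μ : ℝ → ℝ := fun r => (∑ j, (⟪x j, density halfPlane T r (x j)⟫).re +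
    ∑ i, (⟪y i, density halfPlane T r (y i)⟫).re) / 2 with hμ
  have hμ0 : ∀ r, 0 ≤ μ r := fun r => div_nonneg (add_nonneg
    (Finset.sum_nonneg fun j _ => hT.density_nonneg hη r (x j))
    (Finset.sum_nonneg fun i _ => hT.density_nonneg hη r (y i))) (by norm_num)
  have hI : ∀ z, (Integrable fun r => (⟪z, density halfPlane T r z⟫).re) ∧
      ∫ r, (⟪z, density halfPlane T r z⟫).re ≤ ‖z‖ ^ 2 := by
    intro z
    have h := hT.integral_density_le hη z
    have h0 : halfPlane.L = 0 := rfl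
    rw [h0, Real.arctan_zero, mul_zero, zero_div, add_zero, one_mul] at h
    exact h
  have hμi : Integrable μ := ((integrable_finsetSum _ fun j _ => (hI (x j)).1).add
    (integrable_finsetSum _ fun i _ => (hI (y i)).1)).div_const 2
  have hμ1 : ∫ r, μ r ≤ (∑ j, ‖x j‖ ^ 2 + ∑ i, ‖y i‖ ^ 2) / 2 := by
    simp only [hμ]
    rw [integral_div, integral_add (integrable_finsetSum _ fun j _ => (hI (x j)).1)
      (integrable_finsetSum _ fun i _ => (hI (y i)).1),
      integral_finsetSum _ fun j _ => (hI (x j)).1, integral_finsetSum _ fun i _ => (hI (y i)).1]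
    gcongr with j _ i _
    · exact (hI (x j)).2
    · exact (hI (y i)).2
  have hμc : Continuous μ := by
    have h1 := fun z => Complex.continuous_re.comp (hT.continuous_inner_density hη z z)
    exact ((continuous_finsetSum _ fun j _ => h1 (x j)).add
      (continuous_finsetSum _ fun i _ => h1 (y i))).div_const 2
  have hw := fun r => integral_rayWeight_le (G.d1 s) r
  -- integrability on the product of the tangent line and the ray
  have hprod : Integrable (Function.uncurry fun r t => rayWeight (G.d1 s) r t * μ r)
      (volume.prod (volume.restrict (Ioi (0 : ℝ)))) := by
    have hmeas : Measurable (Function.uncurry fun r t => rayWeight (G.d1 s) r t * μ r) := by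
      have := hμc.measurable
      unfold rayWeight Function.uncurry
      fun_prop
    rw [integrable_prod_iff hmeas.aestronglyMeasurable]
    refine ⟨Eventually.of_forall fun r => Integrable.mul_const (hw r).1 (μ r), ?_⟩
    refine (hμi.const_mul S).mono' hmeas.aestronglyMeasurable.norm.integral_prod_right'
      (Eventually.of_forall fun r => ?_)
    simp only [Function.uncurry_apply_pair, norm_mul, Real.norm_of_nonneg (hμ0 r),
      Real.norm_of_nonneg (rayWeight_nonneg _ _ _), integral_mul_const]
    rw [Real.norm_of_nonneg (integral_nonneg fun t => rayWeight_nonneg _ _ _)]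
    exact mul_le_mul_of_nonneg_right (hw r).2 (hμ0 r)
  have hbound : ∀ᵐ t ∂(volume.restrict (Ioi (0 : ℝ))),
      ‖∑ i, ∑ j, F t i j * rayKernel G A (x j) (y i) s t‖ ≤
        ‖G.nb s‖ * ∫ r, rayWeight (G.d1 s) r t * μ r := by
    filter_upwards [ae_restrict_mem measurableSet_Ioi, hprod.prod_left_ae] with t ht hti
    have hk := fun i j => hA.rayKernel_eq hη s ht (x j) (y i)
    simp only [← hTdef] at hk
    have e : ∑ i, ∑ j, F t i j * rayKernel G A (x j) (y i) s t = -conj (G.nb s) *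
        ∫ r, polyQuot X ((X + Polynomial.C (t * G.nb s)) ^ 2) (halfPlane.pt r) *
          ∑ i, ∑ j, F t i j * ⟪y i, density halfPlane T r (x j)⟫ := by
      have e1 : ∀ r, polyQuot X ((X + Polynomial.C (t * G.nb s)) ^ 2) (halfPlane.pt r) *
          ∑ i, ∑ j, F t i j * ⟪y i, density halfPlane T r (x j)⟫ =
          ∑ i, ∑ j, F t i j * (polyQuot X ((X + Polynomial.C (t * G.nb s)) ^ 2) (halfPlane.pt r) *
            ⟪y i, density halfPlane T r (x j)⟫) := by
        intro r
        simp only [Finset.mul_sum]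
        exact Finset.sum_congr rfl fun i _ => Finset.sum_congr rfl fun j _ => by ring
      simp only [e1]
      rw [integral_sum_sum_mul (c := fun i j => F t i j) fun i j => (hk i j).1, Finset.mul_sum]
      refine Finset.sum_congr rfl fun i _ => ?_
      rw [Finset.mul_sum]
      refine Finset.sum_congr rfl fun j _ => ?_
      rw [(hk i j).2]
      ring
    rw [e, norm_mul, norm_neg, Complex.norm_conj]
    refine mul_le_mul_of_nonneg_left
        (norm_integral_le_of_norm_le hti (Eventually.of_forall fun r => ?_))
      (norm_nonneg _)
    rw [norm_mul, norm_polyQuot_halfPlane]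
    exact mul_le_mul_of_nonneg_left (norm_sum_mul_inner_le (hF t ht) (hT.density_nonneg hη r)
      (hT.inner_density_symm hη r) x y) (rayWeight_nonneg _ _ _)
  have hswap := hprod.integral_prod_right
  refine (norm_integral_le_of_norm_le (hswap.const_mul _) hbound).trans ?_
  rw [integral_const_mul, mul_assoc]
  refine mul_le_mul_of_nonneg_left ?_ (norm_nonneg _)
  simp only [Function.uncurry_apply_pair]
  rw [← integral_integral_swap hprod]
  calc ∫ r, ∫ t in Ioi (0 : ℝ), rayWeight (G.d1 s) r t * μ r
      ≤ ∫ r, S * μ r := by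
        refine integral_mono hprod.integral_prod_left (hμi.const_mul S) fun r => ?_
        simp only [integral_mul_const]
        exact mul_le_mul_of_nonneg_right (hw r).2 (hμ0 r)
    _ = S * ∫ r, μ r := integral_const_mul _ _
    _ ≤ _ := mul_le_mul_of_nonneg_left hμ1 hS0

end RayBound

/-! ### The estimate for a smooth convex region -/

/-- The bound for the reflected term per unit of slope, where the tangent has the slope `v`. -/
def slopeWeight (v : ℝ) : ℝ := (Real.pi / 2 + |Real.arctan v|) / √(1 + v ^ 2)

lemma slopeWeight_nonneg (v : ℝ) : 0 ≤ slopeWeight v := by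
  have := Real.pi_pos
  unfold slopeWeight; positivity

lemma continuous_slopeWeight : Continuous slopeWeight := by
  unfold slopeWeight
  refine Continuous.div (by fun_prop) (by fun_prop) fun v => ?_
  positivity

/-- The constant obtained for regions whose boundary slopes are bounded by `L`: the mass of the
double layer potential, and the contribution of the reflected term. -/
def slopeConst (L : ℝ) : ℝ :=
  1 + 2 * Real.arctan L / Real.pi + 1 / Real.pi * ∫ v in (-L)..L, slopeWeight v

namespace ConvexGraph

variable (G : ConvexGraph)

lemma integrable_d2_mul_slopeWeight : Integrable fun s => G.d2 s * slopeWeight (G.d1 s) := by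
  refine (G.integrable_d2.mul_const (Real.pi / 2 + Real.pi / 2)).mono'
    ((G.continuous_d2.mul (continuous_slopeWeight.comp G.continuous_d1)).aestronglyMeasurable)
    (Eventually.of_forall fun s => ?_)
  rw [Real.norm_of_nonneg (mul_nonneg (G.d2_nonneg s) (slopeWeight_nonneg _))]
  refine mul_le_mul_of_nonneg_left ?_ (G.d2_nonneg s)
  have h1 : |Real.arctan (G.d1 s)| ≤ Real.pi / 2 := abs_le.2
    ⟨(Real.neg_pi_div_two_lt_arctan _).le, (Real.arctan_lt_pi_div_two _).le⟩
  have h2 : 1 ≤ √(1 + G.d1 s ^ 2) := Real.one_le_sqrt.2 (by nlinarith [sq_nonneg (G.d1 s)])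
  unfold slopeWeight
  refine (div_le_self (by have := Real.pi_pos; positivity) h2).trans ?_
  linarith

/-- The slope `d1` is an increasing function with values in `[-L, L]` and serves as a variable of
integration. -/
lemma integral_d2_mul_slopeWeight_le :
    ∫ s, G.d2 s * slopeWeight (G.d1 s) ≤ ∫ v in (-G.L)..G.L, slopeWeight v := by
  have t1 := intervalIntegral_tendsto_integral (l := atTop) (a := fun i : ℝ => -i) (b := id)
    G.integrable_d2_mul_slopeWeight tendsto_neg_atTop_atBot tendsto_id
  refine le_of_tendsto t1 ?_
  filter_upwards [eventually_ge_atTop 0] with Y hY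
  have h := intervalIntegral.integral_comp_mul_deriv (a := -Y) (b := Y) (f := G.d1) (f' := G.d2)
    (g := slopeWeight) (fun s _ => G.hasDerivAt_d1 s) G.continuous_d2.continuousOn
        continuous_slopeWeight
  simp only [Function.comp, id] at h ⊢
  simp only [mul_comm (G.d2 _)]
  rw [h]
  have h1 := abs_le.1 (G.abs_d1_le (-Y))
  have h2 := abs_le.1 (G.abs_d1_le Y)
  exact intervalIntegral.integral_mono_interval h1.1 (G.monotone_d1 (by linarith)) h2.2
    (Eventually.of_forall slopeWeight_nonneg) (continuous_slopeWeight.intervalIntegrable _ _)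

end ConvexGraph

section SmoothRegion

variable {H : Type u} [NormedAddCommGroup H] [InnerProductSpace ℂ H] [CompleteSpace H]
variable {G : ConvexGraph} {A : H →L[ℂ] H} {η : ℝ}

open scoped Matrix.Norms.L2Operator in
/-- The estimate for matrices of rational functions that vanish at infinity. The vectors
`x' i j` stand for `(p i j / D i j)(A) x j`. -/
theorem InsideGraph.norm_sum_inner_le (hA : InsideGraph G A η) (hη : 0 < η) {m n : ℕ}
    {p D : Fin m → Fin n → ℂ[X]} (hD : ∀ i j, G.RootsOutside (D i j))
    (hk : ∀ i j, (p i j).natDegree + 1 ≤ (D i j).natDegree)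
    (hF : ∀ z ∈ G.region, ‖(Matrix.of fun i j => polyQuot (p i j) (D i j) z)‖ ≤ 1)
    {x : Fin n → H} {x' : Fin m → Fin n → H} (y : Fin m → H)
    (hx : ∀ i j, aeval A (D i j) (x' i j) = aeval A (p i j) (x j)) :
    ‖∑ i, ∑ j, ⟪y i, x' i j⟫‖ ≤ slopeConst G.L * ((∑ j, ‖x j‖ ^ 2 + ∑ i, ‖y i‖ ^ 2) / 2) := by
  have hπ := Real.pi_pos
  have key := fun i j => hA.inner_eq_integral_density hη (hD i j) (hk i j) (y i) (hx i j)
  set N := (∑ j, ‖x j‖ ^ 2 + ∑ i, ‖y i‖ ^ 2) / 2 with hN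
  have hN0 : 0 ≤ N := by positivity
  have e : ∑ i, ∑ j, ⟪y i, x' i j⟫ =
      (∫ s, ∑ i, ∑ j, (polyQuot (p i j) (D i j) (G.pt s) * ⟪y i, density G A s (x j)⟫)) +
      (1 / Real.pi) * ∫ s, ∑ i, ∑ j, (G.d2 s / conj (G.nb s) ^ 2 *
        ∫ t in Ioi (0 : ℝ), polyQuot (p i j) (D i j) (G.pt s + t) *
            rayKernel G A (x j) (y i) s t) := by
    have h1 := integral_sum_sum_mul (c := fun _ _ => 1) fun i j => (key i j).1
    have h2 := integral_sum_sum_mul (c := fun _ _ => 1) fun i j => (key i j).2.2.1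
    simp only [one_mul] at h1 h2
    rw [h1, h2, Finset.mul_sum, ← Finset.sum_add_distrib]
    refine Finset.sum_congr rfl fun i _ => ?_
    rw [Finset.mul_sum, ← Finset.sum_add_distrib]
    exact Finset.sum_congr rfl fun j _ => (key i j).2.2.2
  have hI := fun z => hA.integral_density_le hη z
  have b1 : ‖∫ s, ∑ i, ∑ j, (polyQuot (p i j) (D i j) (G.pt s) * ⟪y i, density G A s (x j)⟫)‖ ≤
      (1 + 2 * Real.arctan G.L / Real.pi) * N := by
    have i1 := integrable_finsetSum Finset.univ fun j (_ : j ∈ Finset.univ) => (hI (x j)).1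
    have i2 := integrable_finsetSum Finset.univ fun i (_ : i ∈ Finset.univ) => (hI (y i)).1
    refine (norm_integral_le_of_norm_le ((i1.add i2).div_const 2) (Eventually.of_forall fun s =>
      norm_sum_mul_inner_le (hF _ (ConvexGraph.pt_mem s)) (hA.density_nonneg hη s)
        (hA.inner_density_symm hη s) x y)).trans ?_
    have e1 := integral_finsetSum Finset.univ fun j (_ : j ∈ Finset.univ) => (hI (x j)).1
    have e2 := integral_finsetSum Finset.univ fun i (_ : i ∈ Finset.univ) => (hI (y i)).1
    rw [integral_div, integral_add' i1 i2, e1, e2, hN, mul_div_assoc', mul_add, Finset.mul_sum,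
      Finset.mul_sum]
    gcongr with j _ i _
    · exact (hI (x j)).2
    · exact (hI (y i)).2
  have b2 : ‖∫ s, ∑ i, ∑ j, (G.d2 s / conj (G.nb s) ^ 2 *
        ∫ t in Ioi (0 : ℝ), polyQuot (p i j) (D i j) (G.pt s + t) *
          rayKernel G A (x j) (y i) s t)‖ ≤
      (∫ v in (-G.L)..G.L, slopeWeight v) * N := by
    refine (norm_integral_le_of_norm_le (G.integrable_d2_mul_slopeWeight.mul_const N)
      (Eventually.of_forall fun s => ?_)).trans ?_
    · have e3 : ∑ i, ∑ j, (G.d2 s / conj (G.nb s) ^ 2 *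
          ∫ t in Ioi (0 : ℝ), polyQuot (p i j) (D i j) (G.pt s + t) *
            rayKernel G A (x j) (y i) s t) =
          G.d2 s / conj (G.nb s) ^ 2 * ∫ t in Ioi (0 : ℝ), ∑ i, ∑ j,
            (polyQuot (p i j) (D i j) (G.pt s + t) * rayKernel G A (x j) (y i) s t) := by
        have h1 := integral_sum_sum_mul (c := fun _ _ => 1) fun i j => (key i j).2.1 s
        simp only [one_mul] at h1
        rw [h1, Finset.mul_sum]
        exact Finset.sum_congr rfl fun i _ => (Finset.mul_sum _ _ _).symm
      have h2 := hA.norm_integral_rayKernel_le hη s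
        (F := fun t => Matrix.of fun i j => polyQuot (p i j) (D i j) (G.pt s + t))
        (fun t ht => hF _ (ConvexGraph.pt_add_mem s ht.le)) x y
      rw [e3, norm_mul, norm_div, norm_pow, Complex.norm_conj, Complex.norm_real,
        Real.norm_of_nonneg (G.d2_nonneg s)]
      have hb : ‖G.nb s‖ = √(1 + G.d1 s ^ 2) := by
        rw [← G.normSq_nb, Real.sqrt_sq (norm_nonneg _)]
      have hb0 : 0 < ‖G.nb s‖ := lt_of_lt_of_le one_pos (G.one_le_norm_nb s)
      refine (mul_le_mul_of_nonneg_left h2 (div_nonneg (G.d2_nonneg s) (by positivity))).trans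
        (le_of_eq ?_)
      rw [slopeWeight, ← hb, ← hN]
      field_simp
    · rw [integral_mul_const]
      exact mul_le_mul_of_nonneg_right G.integral_d2_mul_slopeWeight_le hN0
  rw [e]
  refine (norm_add_le _ _).trans ?_
  rw [norm_mul, norm_div, norm_one, Complex.norm_real, Real.norm_of_nonneg hπ.le, slopeConst,
      add_mul]
  refine add_le_add b1 ?_
  rw [mul_assoc]
  exact mul_le_mul_of_nonneg_left b2 (by positivity)

end SmoothRegion

/-- The integral of `slopeWeight` is transformed by `v = tan β`, and the integral over `β` is twice
the one over `0 < β < π / 2 - α`, where `β = π / 2 - x`. -/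
lemma slopeConst_eq {α : ℝ} (hα : 0 < α) (hα' : α ≤ Real.pi / 2) :
    slopeConst (Real.tan (Real.pi / 2 - α)) =
      1 + 2 / Real.pi * ∫ x in α..(Real.pi / 2), (Real.pi - x + Real.sin x) / Real.sin x := by
  have hπ := Real.pi_pos
  set β := Real.pi / 2 - α with hβ
  have hβ0 : 0 ≤ β := by linarith
  have hβ1 : β < Real.pi / 2 := by linarith
  have harc : Real.arctan (Real.tan β) = β := Real.arctan_tan (by linarith) hβ1
  have hpos : ∀ x ∈ uIcc (-β) β, 0 < Real.cos x := by
    intro x hx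
    rw [uIcc_of_le (by linarith)] at hx
    exact Real.cos_pos_of_mem_Ioo ⟨by linarith [hx.1], by linarith [hx.2]⟩
  -- the substitution `v = tan x`
  have h1 : ∫ v in (-Real.tan β)..(Real.tan β), slopeWeight v =
      ∫ x in (-β)..β, (Real.pi / 2 + |x|) / Real.cos x := by
    have h := intervalIntegral.integral_comp_mul_deriv (a := -β) (b := β) (f := Real.tan)
      (f' := fun x => 1 / Real.cos x ^ 2) (g := slopeWeight)
      (fun x hx => Real.hasDerivAt_tan (hpos x hx).ne')
      (ContinuousOn.div continuousOn_const (by fun_prop) fun x hx => (pow_pos (hpos x hx) 2).ne')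
      continuous_slopeWeight
    rw [Real.tan_neg] at h
    rw [← h]
    refine intervalIntegral.integral_congr fun x hx => ?_
    have hc := hpos x hx
    have hx' := hx
    rw [uIcc_of_le (by linarith)] at hx'
    have hs : √(1 + Real.tan x ^ 2) = 1 / Real.cos x := by
      have : 1 + Real.tan x ^ 2 = (1 / Real.cos x) ^ 2 := by
        rw [Real.tan_eq_sin_div_cos]
        field_simp
        linarith [Real.sin_sq_add_cos_sq x]
      rw [this, Real.sqrt_sq (by positivity)]
    simp only [Function.comp, slopeWeight, hs]
    rw [Real.arctan_tan (by linarith [hx'.1]) (by linarith [hx'.2])]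
    field_simp
  have hcont : ContinuousOn (fun x => (Real.pi / 2 + |x|) / Real.cos x) (uIcc (-β) β) :=
    ContinuousOn.div (by fun_prop) (by fun_prop) fun x hx => (hpos x hx).ne'
  have hi1 : IntervalIntegrable (fun x => (Real.pi / 2 + |x|) / Real.cos x) volume (-β) 0 :=
    (hcont.mono (uIcc_subset_uIcc left_mem_uIcc
        (by rw [uIcc_of_le (by linarith)]; exact ⟨by linarith, hβ0⟩))).intervalIntegrable
  have hi2 : IntervalIntegrable (fun x => (Real.pi / 2 + |x|) / Real.cos x) volume 0 β :=
    (hcont.mono (uIcc_subset_uIcc (by rw [uIcc_of_le (by linarith)]; exact ⟨by linarith, hβ0⟩)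
        right_mem_uIcc)).intervalIntegrable
  have h2 : ∫ x in (-β)..β, (Real.pi / 2 + |x|) / Real.cos x =
      2 * ∫ x in (0 : ℝ)..β, (Real.pi / 2 + |x|) / Real.cos x := by
    rw [← intervalIntegral.integral_add_adjacent_intervals hi1 hi2]
    have h := intervalIntegral.integral_comp_neg (a := 0) (b := β)
      (fun x => (Real.pi / 2 + |x|) / Real.cos x)
    simp only [abs_neg, Real.cos_neg, neg_zero] at h
    rw [← h]; ring
  have h3 : ∫ x in (0 : ℝ)..β, (Real.pi / 2 + |x|) / Real.cos x =
      ∫ x in α..(Real.pi / 2), (Real.pi - x) / Real.sin x := by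
    have h := intervalIntegral.integral_comp_sub_left (a := α) (b := Real.pi / 2)
      (fun x => (Real.pi / 2 + |x|) / Real.cos x) (Real.pi / 2)
    rw [sub_self, ← hβ] at h
    rw [← h]
    refine intervalIntegral.integral_congr fun x hx => ?_
    rw [uIcc_of_le hα'] at hx
    simp only [Real.cos_pi_div_two_sub]
    rw [abs_of_nonneg (by linarith [hx.2])]
    congr 1
    ring
  have hsin : ∀ x ∈ uIcc α (Real.pi / 2), Real.sin x ≠ 0 := by
    intro x hx
    rw [uIcc_of_le hα'] at hx
    exact (Real.sin_pos_of_pos_of_lt_pi (by linarith [hx.1]) (by linarith [hx.2])).ne'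
  have h4 : ∫ x in α..(Real.pi / 2), (Real.pi - x + Real.sin x) / Real.sin x =
      (∫ x in α..(Real.pi / 2), (Real.pi - x) / Real.sin x) + β := by
    have hi : IntervalIntegrable (fun x => (Real.pi - x) / Real.sin x) volume α (Real.pi / 2) :=
      (ContinuousOn.div (by fun_prop) (by fun_prop) hsin).intervalIntegrable
    have e : β = ∫ x in α..(Real.pi / 2), (1 : ℝ) := by simp [hβ]
    rw [e, ← intervalIntegral.integral_add hi (by simp)]
    refine intervalIntegral.integral_congr fun x hx => ?_
    have := hsin x hx
    field_simp
  rw [slopeConst, harc, h1, h2, h3, h4]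
  field_simp
  ring

/-! ### Smooth convex approximation -/

/-- The Steklov mean, that is, the mean of `φ` over the interval `[y - δ, y + δ]`. -/
def steklovMean (δ : ℝ) (φ : ℝ → ℝ) (y : ℝ) : ℝ := (∫ u in (y - δ)..(y + δ), φ u) / (2 * δ)

/-- The symmetric difference quotient of `φ` with step `δ`. -/
def symmSlope (δ : ℝ) (φ : ℝ → ℝ) (y : ℝ) : ℝ := (φ (y + δ) - φ (y - δ)) / (2 * δ)

lemma hasDerivAt_steklovMean {φ : ℝ → ℝ} (hφ : Continuous φ) (δ y : ℝ) :
    HasDerivAt (steklovMean δ φ) (symmSlope δ φ y) y := by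
  have hi : ∀ a b, IntervalIntegrable φ volume a b := fun a b => hφ.intervalIntegrable a b
  have e : steklovMean δ φ = fun y =>
      ((∫ u in (0 : ℝ)..(y + δ), φ u) - ∫ u in (0 : ℝ)..(y - δ), φ u) / (2 * δ) := by
    ext y
    rw [steklovMean, intervalIntegral.integral_interval_sub_left (hi _ _) (hi _ _)]
  have hP : ∀ z, HasDerivAt (fun z => ∫ u in (0 : ℝ)..z, φ u) (φ z) z := fun z =>
    intervalIntegral.integral_hasDerivAt_right (hi _ _) (hφ.stronglyMeasurableAtFilter _ _)
        hφ.continuousAt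
  rw [e]
  exact ((HasDerivAt.comp_add_const y δ (hP (y + δ))).sub
    (HasDerivAt.comp_sub_const y δ (hP (y - δ)))).div_const _

lemma abs_symmSlope_le {φ : ℝ → ℝ} {L : ℝ} (hL : ∀ u v, |φ u - φ v| ≤ L * |u - v|) {δ : ℝ}
    (hδ : 0 < δ) (y : ℝ) : |symmSlope δ φ y| ≤ L := by
  have h := hL (y + δ) (y - δ)
  have e : y + δ - (y - δ) = 2 * δ := by ring
  rw [e, abs_of_pos (by positivity : 0 < 2 * δ)] at h
  rw [symmSlope, abs_div, abs_of_pos (by positivity : 0 < 2 * δ), div_le_iff₀ (by positivity)]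
  exact h

lemma continuous_of_lipschitz {φ : ℝ → ℝ} {L : ℝ} (hL : ∀ u v, |φ u - φ v| ≤ L * |u - v|) :
    Continuous φ := by
  refine (LipschitzWith.of_dist_le_mul (K := Real.toNNReal L) fun u v => ?_).continuous
  rw [Real.dist_eq, Real.dist_eq]
  exact (hL u v).trans (mul_le_mul_of_nonneg_right (Real.le_coe_toNNReal L) (abs_nonneg _))

lemma abs_steklovMean_sub_le {φ : ℝ → ℝ} {L : ℝ} (hL : ∀ u v, |φ u - φ v| ≤ L * |u - v|)
    (hL0 : 0 ≤ L) {δ : ℝ} (hδ : 0 < δ) (y : ℝ) : |steklovMean δ φ y - φ y| ≤ L * δ := by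
  have hc := continuous_of_lipschitz hL
  have e : steklovMean δ φ y - φ y = (∫ u in (y - δ)..(y + δ), (φ u - φ y)) / (2 * δ) := by
    rw [intervalIntegral.integral_sub (hc.intervalIntegrable _ _) (by simp), steklovMean,
      intervalIntegral.integral_const, smul_eq_mul]
    field_simp
    ring
  rw [e, abs_div, abs_of_pos (by positivity : 0 < 2 * δ), div_le_iff₀ (by positivity)]
  have h := intervalIntegral.norm_integral_le_of_norm_le_const (a := y - δ) (b := y + δ)
    (f := fun u => φ u - φ y) (C := L * δ) (fun u hu => by
      rw [uIoc_of_le (by linarith)] at hu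
      refine (hL u y).trans (mul_le_mul_of_nonneg_left ?_ hL0)
      rw [abs_le]
      constructor <;> linarith [hu.1, hu.2])
  rw [Real.norm_eq_abs] at h
  refine h.trans (le_of_eq ?_)
  rw [abs_of_pos (by linarith)]
  ring

lemma lipschitz_steklovMean {φ : ℝ → ℝ} {L : ℝ} (hL : ∀ u v, |φ u - φ v| ≤ L * |u - v|)
    {δ : ℝ} (hδ : 0 < δ) (u v : ℝ) : |steklovMean δ φ u - steklovMean δ φ v| ≤ L * |u - v| :=
  convex_univ.norm_image_sub_le_of_norm_hasDerivWithin_le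
    (fun y _ => (hasDerivAt_steklovMean (continuous_of_lipschitz hL) δ y).hasDerivWithinAt)
    (fun y _ => abs_symmSlope_le hL hδ y) (mem_univ v) (mem_univ u)

lemma _root_.ConvexOn.add_sub_mono {φ : ℝ → ℝ} (hφ : ConvexOn ℝ univ φ) {a b h : ℝ} (hab : a ≤ b)
    (hh : 0 < h) : φ (a + h) - φ a ≤ φ (b + h) - φ b := by
  set θ := h / (b - a + h) with hθ
  have hp : 0 < b - a + h := by linarith
  have h0 : 0 ≤ θ := by positivity
  have h1 : θ ≤ 1 := (div_le_one hp).2 (by linarith)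
  have e : θ * (b - a + h) = h := div_mul_cancel₀ _ hp.ne'
  have k1 := hφ.2 (mem_univ a) (mem_univ (b + h)) (sub_nonneg.2 h1) h0 (by ring)
  have k2 := hφ.2 (mem_univ a) (mem_univ (b + h)) h0 (sub_nonneg.2 h1) (by ring)
  have e1 : (1 - θ) • a + θ • (b + h) = a + h := by simp only [smul_eq_mul]; linarith
  have e2 : θ • a + (1 - θ) • (b + h) = b := by simp only [smul_eq_mul]; linarith
  rw [e1] at k1
  rw [e2] at k2
  simp only [smul_eq_mul] at k1 k2
  linarith

/-- Two successive Steklov means, moved up a little, approximate a convex Lipschitz function from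
above by a smooth one with the same slope bound. -/
theorem exists_convexGraph {φ : ℝ → ℝ} (hφ : ConvexOn ℝ univ φ) {L : ℝ} (hL0 : 0 ≤ L)
    (hL : ∀ u v, |φ u - φ v| ≤ L * |u - v|) {ε : ℝ} (hε : 0 < ε) :
    ∃ G : ConvexGraph, G.L = L ∧ ∀ y, φ y < G.fn y ∧ G.fn y ≤ φ y + ε := by
  set δ := ε / (4 * (L + 1)) with hδdef
  have hδ : 0 < δ := by positivity
  have h2 : 2 * (L * δ) < ε / 2 := by
    have : δ * (4 * (L + 1)) = ε := div_mul_cancel₀ _ (by positivity)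
    nlinarith
  have hc := continuous_of_lipschitz hL
  have hLM := lipschitz_steklovMean hL hδ
  have hcM := continuous_of_lipschitz hLM
  have hcs : ∀ {ψ : ℝ → ℝ}, Continuous ψ → Continuous (symmSlope δ ψ) := fun h => by
    unfold symmSlope; fun_prop
  have hmono : Monotone (symmSlope δ φ) := by
    intro a b hab
    unfold symmSlope
    have := hφ.add_sub_mono (a := a - δ) (b := b - δ) (h := 2 * δ) (by linarith) (by positivity)
    have ea : ∀ z : ℝ, z - δ + 2 * δ = z + δ := fun z => by ring
    rw [ea, ea] at this
    gcongr
  refine ⟨{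
    fn := fun y => steklovMean δ (steklovMean δ φ) y + ε / 2
    d1 := symmSlope δ (steklovMean δ φ)
    d2 := symmSlope δ (symmSlope δ φ)
    L := L
    Q := L / δ
    hasDerivAt_fn := fun y => (hasDerivAt_steklovMean hcM δ y).add_const _
    hasDerivAt_d1 := fun y =>
      ((HasDerivAt.comp_add_const y δ (hasDerivAt_steklovMean hc δ (y + δ))).sub
        (HasDerivAt.comp_sub_const y δ (hasDerivAt_steklovMean hc δ (y - δ)))).div_const _
    continuous_d2 := hcs (hcs hc)
    d2_nonneg := fun y => div_nonneg (sub_nonneg.2 (hmono (by linarith))) (by positivity)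
    d2_le := fun y => by
      have k1 := abs_le.1 (abs_symmSlope_le hL hδ (y + δ))
      have k2 := abs_le.1 (abs_symmSlope_le hL hδ (y - δ))
      rw [symmSlope, div_le_div_iff₀ (by positivity) hδ]
      nlinarith
    abs_d1_le := abs_symmSlope_le hLM hδ }, rfl, fun y => ?_⟩
  have k1 := abs_le.1 (abs_steklovMean_sub_le hL hL0 hδ y)
  have k2 := abs_le.1 (abs_steklovMean_sub_le hLM hL0 hδ y)
  constructor <;> simp only <;> linarith

/-! ### Convex regions containing a sector -/

/-- The open cone `{s ; L |Im s| < Re s}` consists of directions of recession of `Ω`. -/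
def HasRecessionCone (Ω : Set ℂ) (L : ℝ) : Prop :=
  ∀ z ∈ Ω, ∀ s : ℂ, L * |s.im| < s.re → z + s ∈ Ω

/-- A convex region with a cone of recession is the region to the right of a convex Lipschitz
graph. -/
theorem exists_convexOn_of_hasRecessionCone {Ω : Set ℂ} (hopen : IsOpen Ω) (hconv : Convex ℝ Ω)
    (hne : Ω.Nonempty) {L : ℝ} (hrec : HasRecessionCone Ω L) {c : ℝ}
    (hc : ∀ z ∈ Ω, c < z.re) :
    ∃ φ : ℝ → ℝ, ConvexOn ℝ univ φ ∧ (∀ u v, |φ u - φ v| ≤ L * |u - v|) ∧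
      ∀ z, z ∈ Ω ↔ φ z.im < z.re := by
  set S : ℝ → Set ℝ := fun y => {x | (⟨x, y⟩ : ℂ) ∈ Ω} with hS
  have hbdd : ∀ y, BddBelow (S y) := fun y => ⟨c, fun x hx => (hc _ hx).le⟩
  have hnon : ∀ y, (S y).Nonempty := by
    intro y
    obtain ⟨z, hz⟩ := hne
    refine ⟨z.re + (L * |y - z.im| + 1), ?_⟩
    have := hrec z hz ⟨L * |y - z.im| + 1, y - z.im⟩ (by simp)
    have e : z + ⟨L * |y - z.im| + 1, y - z.im⟩ = ⟨z.re + (L * |y - z.im| + 1), y⟩ := by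
      apply Complex.ext <;> simp
    rwa [e] at this
  set φ : ℝ → ℝ := fun y => sInf (S y) with hφ
  have hiff : ∀ z, z ∈ Ω ↔ φ z.im < z.re := by
    intro z
    constructor
    · intro hz
      obtain ⟨r, hr, hball⟩ := Metric.isOpen_iff.1 hopen z hz
      have hm : z.re - r / 2 ∈ S z.im := by
        apply hball
        have e : (⟨z.re - r / 2, z.im⟩ : ℂ) - z = ((-(r / 2) : ℝ) : ℂ) := by
          apply Complex.ext <;> simp
        rw [Metric.mem_ball, dist_eq_norm, e, Complex.norm_real, Real.norm_eq_abs, abs_neg,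
          abs_of_pos (by positivity)]
        linarith
      have := csInf_le (hbdd z.im) hm
      simp only [hφ]
      linarith
    · intro hz
      obtain ⟨x, hx, hlt⟩ := exists_lt_of_csInf_lt (hnon z.im) hz
      have := hrec _ hx ((z.re - x : ℝ) : ℂ) (by simpa using hlt)
      have e : (⟨x, z.im⟩ : ℂ) + ((z.re - x : ℝ) : ℂ) = z := by
        apply Complex.ext <;> simp
      rwa [e] at this
  have hmk : ∀ y ε : ℝ, 0 < ε → (⟨φ y + ε, y⟩ : ℂ) ∈ Ω := fun y ε hε =>
      (hiff _).2 (by simpa using hε)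
  have hle : ∀ u v, φ v ≤ φ u + L * |v - u| := by
    intro u v
    refine le_of_forall_pos_le_add fun ε hε => ?_
    have h1 := hrec _ (hmk u (ε / 2) (by positivity)) ⟨L * |v - u| + ε / 2, v - u⟩
        (by simpa using hε)
    have h2 := (hiff _).1 h1
    simp only [Complex.add_re, Complex.add_im, add_sub_cancel] at h2
    linarith
  refine ⟨φ, ⟨convex_univ, fun u _ v _ a b ha hb hab => ?_⟩, fun u v => ?_, hiff⟩
  · refine le_of_forall_pos_le_add fun ε hε => ?_
    have h1 := hconv (hmk u ε hε) (hmk v ε hε) ha hb hab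
    have h2 := (hiff _).1 h1
    simp only [Complex.add_re, Complex.add_im, Complex.real_smul, Complex.re_ofReal_mul,
      Complex.im_ofReal_mul, smul_eq_mul] at h2 ⊢
    have h3 : a * ε + b * ε = ε := by rw [← add_mul, hab, one_mul]
    linarith
  · have h1 := hle u v
    have h2 := hle v u
    rw [abs_sub_comm v u] at h1
    rw [abs_le]
    constructor <;> linarith

section RecessionCone

variable {H : Type u} [NormedAddCommGroup H] [InnerProductSpace ℂ H]

lemma insideGraph_of_numericalRange {G : ConvexGraph} {A : H →L[ℂ] H} {η : ℝ}
    (h : ∀ w ∈ numericalRange A, G.fn w.im + η ≤ w.re) : InsideGraph G A η := by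
  intro y x
  rcases eq_or_ne x 0 with rfl | hx
  · simp
  have hn : ‖x‖ ≠ 0 := norm_ne_zero_iff.2 hx
  set e : H := ((‖x‖ : ℂ)⁻¹) • x with he
  have he1 : ‖e‖ = 1 := by
    rw [he, norm_smul, norm_inv, Complex.norm_real, norm_norm, inv_mul_cancel₀ hn]
  have hxe : x = (‖x‖ : ℂ) • e := by
    rw [he, smul_smul, mul_inv_cancel₀ (by exact_mod_cast hn), one_smul]
  set w := ⟪e, A e⟫ with hw
  have h1 := h w ⟨e, he1, rfl⟩
  have h2 : ⟪x, A x⟫ = ((‖x‖ ^ 2 : ℝ) : ℂ) * w := by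
    conv_lhs => rw [hxe]
    rw [map_smul, inner_smul_left, inner_smul_right, Complex.conj_ofReal, ← hw]
    push_cast; ring
  have h3 : G.nb y * (⟪x, A x⟫ - G.pt y * ‖x‖ ^ 2) = ((‖x‖ ^ 2 : ℝ) : ℂ) *
      (G.nb y * (w - G.pt y)) := by
    rw [h2]; push_cast; ring
  have h4 := G.tangent_le y w.im
  rw [h3, Complex.re_ofReal_mul, mul_comm]
  refine mul_le_mul_of_nonneg_left ?_ (by positivity)
  simp only [Complex.mul_re, ConvexGraph.nb_re, ConvexGraph.nb_im, Complex.sub_re, Complex.sub_im,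
    ConvexGraph.pt_re, ConvexGraph.pt_im, one_mul]
  linarith

variable [CompleteSpace H]

open scoped Matrix.Norms.L2Operator in
/-- The estimate for a convex region with a cone of recession around the positive real axis. The
factors `(1 + r (z - c))⁻ᴺ`, of modulus at most one where `c ≤ Re z`, make the rational functions
vanish at infinity, and `r` tends to `0`. The vectors `x' i j` stand for `(p i j / d i j)(A) x j`.
-/
theorem norm_sum_inner_le_of_hasRecessionCone {Ω : Set ℂ} (hopen : IsOpen Ω) (hconv : Convex ℝ Ω)
    (hne : Ω.Nonempty) {L : ℝ} (hL0 : 0 ≤ L) (hrec : HasRecessionCone Ω L) {A : H →L[ℂ] H}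
    (hA : closure (numericalRange A) ⊆ Ω) {m n : ℕ} {p d : Fin m → Fin n → ℂ[X]}
    (hd : ∀ i j, ∀ z ∈ Ω, (d i j).eval z ≠ 0)
    (hF : ∀ z ∈ Ω, ‖(Matrix.of fun i j => polyQuot (p i j) (d i j) z)‖ ≤ 1)
    {x : Fin n → H} {x' : Fin m → Fin n → H} (y : Fin m → H)
    (hx : ∀ i j, aeval A (d i j) (x' i j) = aeval A (p i j) (x j)) :
    ‖∑ i, ∑ j, ⟪y i, x' i j⟫‖ ≤ slopeConst L * ((∑ j, ‖x j‖ ^ 2 + ∑ i, ‖y i‖ ^ 2) / 2) := by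
  obtain ⟨z₀, hz₀⟩ := hne
  have hWb : ∀ w ∈ numericalRange A, ‖w‖ ≤ ‖A‖ := by
    rintro w ⟨e, he, rfl⟩
    have := norm_inner_apply_le A e
    rwa [he, one_pow, mul_one] at this
  -- the region is cut off to the left, so that it lies to the right of a graph
  set c := min (-(‖A‖ + 1)) (z₀.re - 1) with hc
  set Ω' : Set ℂ := Ω ∩ {z | c < z.re} with hΩ'
  have hopen' : IsOpen Ω' := hopen.inter (isOpen_lt continuous_const Complex.continuous_re)
  have hconv' : Convex ℝ Ω' := hconv.inter (convex_halfSpace_re_gt c)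
  have hne' : Ω'.Nonempty := ⟨z₀, hz₀, by
    have := min_le_right (-(‖A‖ + 1)) (z₀.re - 1)
    simp only [mem_ofPred_eq]
    linarith⟩
  have hrec' : HasRecessionCone Ω' L := fun z hz s hs => ⟨hrec z hz.1 s hs, by
    have h1 : c < z.re := hz.2
    have h2 : 0 ≤ L * |s.im| := by positivity
    simp only [mem_ofPred_eq, Complex.add_re]
    linarith⟩
  have hA' : closure (numericalRange A) ⊆ Ω' := fun w hw => ⟨hA hw, by
    have h1 : closure (numericalRange A) ⊆ {w | -‖A‖ ≤ w.re} := by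
      refine closure_minimal (fun w hw => ?_) (isClosed_le continuous_const Complex.continuous_re)
      have h2 := Complex.abs_re_le_norm w
      have h3 := neg_abs_le w.re
      have h4 := hWb w hw
      simp only [mem_ofPred_eq]
      linarith
    have h2 : -‖A‖ ≤ w.re := h1 hw
    have := min_le_left (-(‖A‖ + 1)) (z₀.re - 1)
    simp only [mem_ofPred_eq]
    linarith⟩
  obtain ⟨φ, hφ, hlip, hiff⟩ := exists_convexOn_of_hasRecessionCone hopen' hconv' hne' hrec'
    (c := c) fun z hz => hz.2
  have hφc := continuous_of_lipschitz hlip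
  -- the numerical range keeps a positive distance from the boundary
  obtain ⟨ε, hε, hεW⟩ : ∃ ε > 0, ∀ w ∈ numericalRange A, φ w.im + 2 * ε ≤ w.re := by
    rcases (closure (numericalRange A)).eq_empty_or_nonempty with h | h
    · exact ⟨1, one_pos, fun w hw => by
        have : w ∈ closure (numericalRange A) := subset_closure hw
        rw [h] at this
        exact absurd this (notMem_empty w)⟩
    · have hcomp : IsCompact (closure (numericalRange A)) :=
        (isBounded_iff_forall_norm_le.2 ⟨‖A‖, hWb⟩).isCompact_closure
      obtain ⟨w₀, hw₀, hmin⟩ := hcomp.exists_isMinOn h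
        (f := fun w : ℂ => w.re - φ w.im)
        (Complex.continuous_re.sub (hφc.comp Complex.continuous_im)).continuousOn
      have h1 := (hiff w₀).1 (hA' hw₀)
      refine ⟨(w₀.re - φ w₀.im) / 2, by linarith, fun w hw => ?_⟩
      have h2 : w₀.re - φ w₀.im ≤ w.re - φ w.im := hmin (subset_closure hw)
      linarith
  obtain ⟨G, hGL, hG⟩ := exists_convexGraph hφ hL0 hlip hε
  have hin : InsideGraph G A ε := insideGraph_of_numericalRange fun w hw => by
    have h1 := hεW w hw
    have h2 := (hG w.im).2
    linarith
  have hreg : ∀ z ∈ G.region, z ∈ Ω' := fun z hz => (hiff z).2 (lt_of_lt_of_le (hG z.im).1 hz)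
  have hout : ∀ w, w ∉ Ω' → w.re < G.fn w.im := fun w hw => by
    rw [hiff, not_lt] at hw
    exact lt_of_le_of_lt hw (hG w.im).1
  obtain ⟨N, hN⟩ : ∃ N : ℕ, ∀ i j, (p i j).natDegree + 1 ≤ N :=
    ⟨∑ i, ∑ j, ((p i j).natDegree + 1), fun i j =>
      (Finset.single_le_sum (f := fun j => (p i j).natDegree + 1) (fun _ _ => Nat.zero_le _)
        (Finset.mem_univ j)).trans
      (Finset.single_le_sum (f := fun i => ∑ j, ((p i j).natDegree + 1)) (fun _ _ => Nat.zero_le _)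
        (Finset.mem_univ i))⟩
  -- the damping factor is moved over to the vectors `x j`
  have key : ∀ r : ℝ, 0 < r → ‖∑ i, ∑ j, ⟪y i, x' i j⟫‖ ≤
      slopeConst L * ((∑ j, ‖((1 + (r : ℂ) • (A - (c : ℂ) • (1 : H →L[ℂ] H))) ^ N) (x j)‖ ^ 2 +
        ∑ i, ‖y i‖ ^ 2) / 2) := by
    intro r hr
    set q : ℂ[X] := 1 + Polynomial.C (r : ℂ) * (X - Polynomial.C (c : ℂ)) with hq
    have hqdeg : q.natDegree = 1 := by
      have : q = Polynomial.C (r : ℂ) * X + Polynomial.C (1 - r * c : ℂ) := by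
        rw [hq]; simp only [map_sub, map_mul, map_one]; ring
      rw [this]
      exact natDegree_linear (by exact_mod_cast hr.ne')
    have hq0 : q ≠ 0 := fun h => by rw [h] at hqdeg; simp at hqdeg
    have hqev : ∀ z, q.eval z = 1 + r * (z - c) := fun z => by simp [hq]
    have hqre : ∀ z : ℂ, c ≤ z.re → 1 ≤ ‖q.eval z‖ := by
      intro z hz
      refine le_trans ?_ (Complex.re_le_norm _)
      rw [hqev, Complex.add_re, Complex.re_ofReal_mul]
      have : 0 ≤ r * (z.re - c) := mul_nonneg hr.le (by linarith)
      simp only [Complex.one_re, Complex.sub_re, Complex.ofReal_re]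
      linarith
    have hqroots : G.RootsOutside (q ^ N) := by
      refine ConvexGraph.RootsOutside.pow ⟨hq0, fun w hw => hout w fun hw' => ?_⟩ N
      have h1 : c < w.re := hw'.2
      have := hqre w h1.le
      rw [hw, norm_zero] at this
      linarith
    have hdroots : ∀ i j, G.RootsOutside (d i j) := fun i j =>
      ⟨fun h => hd i j z₀ hz₀ (by rw [h, eval_zero]), fun w hw => hout w fun hw' =>
          hd i j w hw'.1 hw⟩
    have hae : aeval A (q ^ N) = (1 + (r : ℂ) • (A - (c : ℂ) • (1 : H →L[ℂ] H))) ^ N := by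
      rw [map_pow, hq]
      congr 1
      rw [map_add, map_one, map_mul, map_sub, aeval_X, aeval_C, aeval_C,
          Algebra.algebraMap_eq_smul_one,
        Algebra.algebraMap_eq_smul_one, smul_mul_assoc, one_mul]
    rw [← hGL, ← hae]
    refine hin.norm_sum_inner_le hε (p := p) (D := fun i j => d i j * q ^ N)
      (fun i j => (hdroots i j).mul hqroots) (fun i j => ?_) (fun z hz => ?_) y fun i j => ?_
    · rw [natDegree_mul (hdroots i j).1 (pow_ne_zero _ hq0), natDegree_pow, hqdeg]
      have := hN i j
      omega
    · have hzΩ := hreg z hz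
      have h1 := hqre z (le_of_lt hzΩ.2)
      have e : (Matrix.of fun i j => polyQuot (p i j) (d i j * q ^ N) z) =
          ((q.eval z ^ N)⁻¹) • (Matrix.of fun i j => polyQuot (p i j) (d i j) z) := by
        ext i j
        simp only [Matrix.of_apply, Matrix.smul_apply, polyQuot, eval_mul, eval_pow, smul_eq_mul]
        rw [div_mul_eq_div_div, div_eq_inv_mul]
      rw [e, norm_smul, norm_inv, norm_pow]
      exact mul_le_one₀ (inv_le_one_of_one_le₀ (one_le_pow₀ h1)) (norm_nonneg _) (hF z hzΩ.1)
    · rw [mul_comm, map_mul]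
      have e1 : (aeval A (q ^ N) * aeval A (d i j)) (x' i j) =
          aeval A (q ^ N) (aeval A (p i j) (x j)) :=
        congrArg (aeval A (q ^ N)) (hx i j)
      rw [e1]
      have e2 : aeval A (q ^ N) * aeval A (p i j) = aeval A (p i j) * aeval A (q ^ N) := by
        rw [← map_mul, mul_comm, map_mul]
      exact DFunLike.congr_fun e2 (x j)
  have hcont : Continuous fun r : ℝ => slopeConst L *
      ((∑ j, ‖((1 + (r : ℂ) • (A - (c : ℂ) • (1 : H →L[ℂ] H))) ^ N) (x j)‖ ^ 2 + ∑ i, ‖y i‖ ^ 2) /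
          2) := by
    have h1 : Continuous fun r : ℝ => (1 + (r : ℂ) • (A - (c : ℂ) • (1 : H →L[ℂ] H))) ^ N := by
      fun_prop
    have h2 : ∀ j, Continuous fun r : ℝ =>
        ‖((1 + (r : ℂ) • (A - (c : ℂ) • (1 : H →L[ℂ] H))) ^ N) (x j)‖ ^ 2 := fun j =>
      (h1.clm_apply continuous_const).norm.pow 2
    exact continuous_const.mul
        (((continuous_finsetSum _ fun j _ => h2 j).add continuous_const).div_const 2)
  have hlim := (hcont.tendsto 0).mono_left (nhdsWithin_le_nhds (s := Ioi 0))
  simp only [Complex.ofReal_zero, zero_smul, add_zero, one_pow, one_apply_eq_self] at hlim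
  exact ge_of_tendsto hlim (eventually_nhdsWithin_of_forall fun r hr => key r hr)

end RecessionCone

/-! ### Regions containing a sector in general position -/

/-- Translations by the elements of a cone contained in an open convex set preserve the set:
`z + s` lies between `z / (1 - l)` and `s / l`. -/
lemma hasRecessionCone_of_subset {Ω : Set ℂ} (hopen : IsOpen Ω) (hconv : Convex ℝ Ω) {L : ℝ}
    (h : {s : ℂ | L * |s.im| < s.re} ⊆ Ω) : HasRecessionCone Ω L := by
  intro z hz s hs
  have hlim : Tendsto (fun l : ℝ => (1 - l)⁻¹ • z) (𝓝[>] 0) (𝓝 z) := by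
    have hc : ContinuousAt (fun l : ℝ => (1 - l)⁻¹ • z) 0 :=
      ((continuousAt_const.sub continuousAt_id).inv₀ (by simp)).smul continuousAt_const
    have := hc.tendsto
    simp only [sub_zero, inv_one, one_smul] at this
    exact this.mono_left nhdsWithin_le_nhds
  have h1 : ∀ᶠ l : ℝ in 𝓝[>] 0, l ∈ Ioo (0 : ℝ) 1 := Ioo_mem_nhdsGT one_pos
  obtain ⟨l, hl, hl0, hl1⟩ := ((hlim.eventually (hopen.mem_nhds hz)).and h1).exists
  have h2 : l⁻¹ • s ∈ Ω := h (by
    have hl' : 0 < l⁻¹ := inv_pos.2 hl0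
    simp only [mem_ofPred_eq, Complex.smul_re, Complex.smul_im, smul_eq_mul, abs_mul,
        abs_of_pos hl']
    nlinarith)
  have h3 := hconv hl h2 (by linarith : 0 ≤ 1 - l) hl0.le (by ring)
  rwa [smul_smul, smul_smul, mul_inv_cancel₀ (by linarith), mul_inv_cancel₀ hl0.ne', one_smul,
    one_smul] at h3

lemma tan_mul_sin_eq_cos {α : ℝ} (hα : 0 < α) (hα' : α ≤ Real.pi / 2) :
    Real.tan (Real.pi / 2 - α) * Real.sin α = Real.cos α := by
  have : Real.sin α ≠ 0 := (Real.sin_pos_of_pos_of_lt_pi hα (by linarith [Real.pi_pos])).ne'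
  rw [Real.tan_eq_sin_div_cos, Real.sin_pi_div_two_sub, Real.cos_pi_div_two_sub]
  field_simp

lemma tan_pi_div_two_sub_nonneg {α : ℝ} (hα : 0 < α) (hα' : α ≤ Real.pi / 2) :
    0 ≤ Real.tan (Real.pi / 2 - α) :=
  Real.tan_nonneg_of_nonneg_of_le_pi_div_two (by linarith) (by linarith)

/-- The cone `{s ; cot α * |Im s| < Re s}` is contained in the sector of angle `2α` around the
positive real axis. -/
lemma abs_arg_lt_of_tan_mul_lt {α : ℝ} (hα : 0 < α) (hα' : α ≤ Real.pi / 2) {s : ℂ}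
    (hs : Real.tan (Real.pi / 2 - α) * |s.im| < s.re) : |s.arg| < α := by
  have hL := tan_pi_div_two_sub_nonneg hα hα'
  by_contra! h
  have hre : 0 ≤ s.re := (mul_nonneg hL (abs_nonneg _)).trans hs.le
  have h1 := Complex.abs_arg_le_pi_div_two_iff.2 hre
  have h2 : Real.sin α ≤ Real.sin |s.arg| :=
    Real.sin_le_sin_of_le_of_le_pi_div_two (by linarith) h1 h
  have h3 : Real.cos |s.arg| ≤ Real.cos α :=
    Real.cos_le_cos_of_nonneg_of_le_pi hα.le (by linarith [Real.pi_pos]) h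
  have h4 : |s.im| = ‖s‖ * Real.sin |s.arg| := by
    rw [← Real.abs_sin_eq_sin_abs_of_abs_le_pi (by linarith [Real.pi_pos]),
      ← Complex.norm_mul_sin_arg s, abs_mul, abs_norm]
  have h5 : s.re = ‖s‖ * Real.cos |s.arg| := by rw [Real.cos_abs, Complex.norm_mul_cos_arg]
  have h6 := tan_mul_sin_eq_cos hα hα'
  refine absurd hs (not_lt.2 ?_)
  calc s.re ≤ ‖s‖ * Real.cos α := by rw [h5]; gcongr
    _ = Real.tan (Real.pi / 2 - α) * (‖s‖ * Real.sin α) := by rw [← h6]; ring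
    _ ≤ _ := by rw [h4]; gcongr

section Operators

variable {H : Type u} [NormedAddCommGroup H] [InnerProductSpace ℂ H]

lemma blockOperator_apply {m n : ℕ} (T : Fin m → Fin n → (H →L[ℂ] H))
    (x : PiLp 2 fun _ : Fin n => H) (i : Fin m) : blockOperator T x i = ∑ j, T i j (x j) := by
  simp [blockOperator]

variable [CompleteSpace H]

open scoped Matrix.Norms.L2Operator in
/-- The estimate for a convex region that contains a sector; a rigid motion makes the positive real
axis the axis of the sector. -/
theorem norm_sum_inner_le_of_sector_subset {Ω : Set ℂ} (hopen : IsOpen Ω) (hconv : Convex ℝ Ω)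
    {α : ℝ} (hα : 0 < α) (hα' : α ≤ Real.pi / 2) {a : ℂ} {φ : ℝ} (hsec : sector a φ α ⊆ Ω)
    {A : H →L[ℂ] H} (hA : closure (numericalRange A) ⊆ Ω) {m n : ℕ} {p d : Fin m → Fin n → ℂ[X]}
    (hd : ∀ i j, ∀ z ∈ Ω, (d i j).eval z ≠ 0)
    (hF : ∀ z ∈ Ω, ‖(Matrix.of fun i j => polyQuot (p i j) (d i j) z)‖ ≤ 1)
    {x : Fin n → H} {x' : Fin m → Fin n → H} (y : Fin m → H)
    (hx : ∀ i j, aeval A (d i j) (x' i j) = aeval A (p i j) (x j)) :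
    ‖∑ i, ∑ j, ⟪y i, x' i j⟫‖ ≤
      slopeConst (Real.tan (Real.pi / 2 - α)) * ((∑ j, ‖x j‖ ^ 2 + ∑ i, ‖y i‖ ^ 2) / 2) := by
  set e : ℂ := Complex.exp (φ * Complex.I) with he
  have he0 : e ≠ 0 := Complex.exp_ne_zero _
  set τ : ℂ → ℂ := fun z => e * z + a with hτ
  have hτc : Continuous τ := by fun_prop
  set τp : ℂ[X] := Polynomial.C e * X + Polynomial.C a with hτp
  have hτev : ∀ z, τp.eval z = τ z := fun z => by simp [hτp, hτ]
  set B : H →L[ℂ] H := e⁻¹ • (A - a • (1 : H →L[ℂ] H)) with hB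
  have hBA : aeval B τp = A := by
    rw [hτp, map_add, map_mul, aeval_X, aeval_C, aeval_C, Algebra.algebraMap_eq_smul_one,
      Algebra.algebraMap_eq_smul_one, hB, smul_mul_assoc, one_mul, smul_smul, mul_inv_cancel₀ he0,
      one_smul, sub_add_cancel]
  have hopen' : IsOpen (τ ⁻¹' Ω) := hopen.preimage hτc
  have hconv' : Convex ℝ (τ ⁻¹' Ω) := by
    intro z hz w hw b c hb hc hbc
    have h := hconv hz hw hb hc hbc
    have h1 : b • τ z + c • τ w = τ (b • z + c • w) := by
      simp only [hτ, Complex.real_smul]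
      have : (b : ℂ) + c = 1 := by exact_mod_cast hbc
      linear_combination a * this
    rwa [h1] at h
  have hcone : {s : ℂ | Real.tan (Real.pi / 2 - α) * |s.im| < s.re} ⊆ τ ⁻¹' Ω := by
    intro s hs
    have hs' : Real.tan (Real.pi / 2 - α) * |s.im| < s.re := hs
    refine hsec ⟨fun h => ?_, ?_⟩
    · have h1 : e * s = 0 := by simpa [hτ] using h
      have h2 : s = 0 := (mul_eq_zero.1 h1).resolve_left he0
      rw [h2] at hs'
      simp at hs'
    · have h1 : (τ s - a) * Complex.exp (-(φ * Complex.I)) = s := by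
        have : e * Complex.exp (-(φ * Complex.I)) = 1 := by
          rw [he, ← Complex.exp_add, add_neg_cancel, Complex.exp_zero]
        simp only [hτ]
        linear_combination s * this
      rw [h1]
      exact abs_arg_lt_of_tan_mul_lt hα hα' hs'
  have hB' : closure (numericalRange B) ⊆ τ ⁻¹' Ω := by
    refine Subset.trans ?_ (preimage_mono hA)
    refine closure_minimal ?_ (isClosed_closure.preimage hτc)
    rintro w ⟨v, hv, rfl⟩
    refine subset_closure ⟨v, hv, ?_⟩
    have h1 : ⟪v, v⟫ = 1 := by simp [inner_self_eq_norm_sq_to_K, hv]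
    simp only [hτ, hB, smul_apply, sub_apply, one_apply_eq_self, inner_smul_right, inner_sub_right,
        h1]
    field_simp
    ring
  have hpq : ∀ i j z, polyQuot ((p i j).comp τp) ((d i j).comp τp) z =
      polyQuot (p i j) (d i j) (τ z) :=
    fun i j z => by simp only [polyQuot, eval_comp, hτev]
  have hone : (1 : ℂ) ∈ τ ⁻¹' Ω := hcone (by simp)
  refine norm_sum_inner_le_of_hasRecessionCone hopen' hconv' ⟨1, hone⟩
    (tan_pi_div_two_sub_nonneg hα hα') (hasRecessionCone_of_subset hopen' hconv' hcone) hB'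
    (p := fun i j => (p i j).comp τp) (d := fun i j => (d i j).comp τp) (fun i j z hz => ?_)
    (fun z hz => ?_) y fun i j => ?_
  · rw [eval_comp, hτev]
    exact hd i j _ hz
  · simp only [hpq]
    exact hF _ hz
  · rw [aeval_comp, aeval_comp, hBA]
    exact hx i j

/-! ### The spectrum and the numerical range -/

/-- The numerical range and a point outside an open convex set containing its closure are strictly
separated by a line, so that the resolvent exists at that point. -/
lemma mem_resolventSet_of_notMem {Ω : Set ℂ} (hopen : IsOpen Ω) (hconv : Convex ℝ Ω)
    {A : H →L[ℂ] H} (hA : closure (numericalRange A) ⊆ Ω) {w : ℂ} (hw : w ∉ Ω) :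
    w ∈ resolventSet ℂ A := by
  obtain ⟨f, hf⟩ := geometric_hahn_banach_open_point hconv hopen hw
  have hWb : ∀ w ∈ numericalRange A, ‖w‖ ≤ ‖A‖ := by
    rintro w ⟨e, he, rfl⟩
    have := norm_inner_apply_le A e
    rwa [he, one_pow, mul_one] at this
  have hcomp : IsCompact (closure (numericalRange A)) :=
    (isBounded_iff_forall_norm_le.2 ⟨‖A‖, hWb⟩).isCompact_closure
  obtain ⟨ε, hε, hεW⟩ : ∃ ε > 0, ∀ v ∈ numericalRange A, f v + ε ≤ f w := by
    rcases (closure (numericalRange A)).eq_empty_or_nonempty with h | h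
    · refine ⟨1, one_pos, fun v hv => ?_⟩
      have : v ∈ closure (numericalRange A) := subset_closure hv
      rw [h] at this
      exact absurd this (notMem_empty v)
    · obtain ⟨v₀, hv₀, hmax⟩ := hcomp.exists_isMaxOn h f.continuous.continuousOn
      refine ⟨f w - f v₀, sub_pos.2 (hf v₀ (hA hv₀)), fun v hv => ?_⟩
      have : f v ≤ f v₀ := hmax (subset_closure hv)
      linarith
  refine (mem_resolventSet_of_le (c := ε / (‖f‖ + 1)) (by positivity) fun x => ?_).1
  rcases eq_or_ne x 0 with rfl | hx
  · simp
  have hn : ‖x‖ ≠ 0 := norm_ne_zero_iff.2 hx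
  set s : ℝ := ‖x‖ ^ 2 with hs
  have hs0 : 0 < s := by positivity
  set v : ℂ := ⟪((‖x‖ : ℂ)⁻¹) • x, A (((‖x‖ : ℂ)⁻¹) • x)⟫ with hv
  have h1 : f v + ε ≤ f w := hεW v ⟨_, by
    rw [norm_smul, norm_inv, Complex.norm_real, norm_norm, inv_mul_cancel₀ hn], rfl⟩
  have h2 : w * (‖x‖ : ℂ) ^ 2 - ⟪x, A x⟫ = s • (w - v) := by
    have : (‖x‖ : ℂ) ≠ 0 := by exact_mod_cast hn
    rw [hv, map_smul, inner_smul_left, inner_smul_right, map_inv₀, Complex.conj_ofReal,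
      Complex.real_smul, hs]
    push_cast
    field_simp
  rw [h2, norm_smul, Real.norm_of_nonneg hs0.le, mul_comm s]
  refine mul_le_mul_of_nonneg_right ?_ hs0.le
  have h3 := (le_abs_self _).trans (f.le_opNorm (w - v))
  rw [map_sub] at h3
  rw [div_le_iff₀ (by positivity)]
  nlinarith [norm_nonneg (w - v)]

lemma isUnit_aeval_of_eval_ne {Ω : Set ℂ} (hopen : IsOpen Ω) (hconv : Convex ℝ Ω)
    {A : H →L[ℂ] H} (hA : closure (numericalRange A) ⊆ Ω) {d : ℂ[X]} (hd0 : d ≠ 0)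
    (hd : ∀ z ∈ Ω, d.eval z ≠ 0) : IsUnit (aeval A d) := by
  rcases le_or_gt d.degree 0 with h | h
  · rw [eq_C_of_degree_le_zero h] at hd0 ⊢
    rw [aeval_C]
    exact (IsUnit.mk0 _ fun h0 => hd0 (by rw [h0, map_zero])).map _
  · by_contra hu
    have h0 : (0 : ℂ) ∈ spectrum ℂ (aeval A d) := by rwa [spectrum.zero_mem_iff]
    rw [spectrum.map_polynomial_aeval_of_degree_pos A d h] at h0
    obtain ⟨w, hw, hw0⟩ := h0
    by_cases hwΩ : w ∈ Ω
    · exact hd w hwΩ hw0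
    · exact hw (mem_resolventSet_of_notMem hopen hconv hA hwΩ)

/-! ### Norms of block operators -/

lemma opNorm_le_of_norm_inner_le {E F : Type*} [NormedAddCommGroup E] [InnerProductSpace ℂ E]
    [NormedAddCommGroup F] [InnerProductSpace ℂ F] {T : E →L[ℂ] F} {K : ℝ} (hK : 0 ≤ K)
    (h : ∀ x y, ‖⟪y, T x⟫‖ ≤ K * ((‖x‖ ^ 2 + ‖y‖ ^ 2) / 2)) : ‖T‖ ≤ K := by
  refine T.opNorm_le_bound hK fun x => ?_
  rcases eq_or_ne (T x) 0 with h0 | h0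
  · rw [h0, norm_zero]; positivity
  have hx : x ≠ 0 := fun hx => h0 (by rw [hx, map_zero])
  have hT : 0 < ‖T x‖ := norm_pos_iff.2 h0
  have hx0 : 0 < ‖x‖ := norm_pos_iff.2 hx
  -- the vector of the norm of `x` in the direction of `T x` makes the two sides homogeneous
  have h1 := h x (((‖x‖ / ‖T x‖ : ℝ) : ℂ) • T x)
  rw [inner_smul_left, Complex.conj_ofReal, inner_self_eq_norm_sq_to_K, norm_mul, norm_smul,
    Complex.norm_real, Real.norm_of_nonneg (by positivity), norm_pow, RCLike.norm_ofReal, abs_norm,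
    div_mul_cancel₀ _ hT.ne', add_self_div_two] at h1
  have h2 : ‖x‖ / ‖T x‖ * ‖T x‖ ^ 2 = ‖x‖ * ‖T x‖ := by field_simp
  rw [h2] at h1
  nlinarith

lemma slopeConst_nonneg {L : ℝ} (hL : 0 ≤ L) : 0 ≤ slopeConst L := by
  have h1 : 0 ≤ ∫ v in (-L)..L, slopeWeight v :=
    intervalIntegral.integral_nonneg (by linarith) fun v _ => slopeWeight_nonneg v
  have h2 : 0 ≤ Real.arctan L := Real.arctan_nonneg.2 hL
  have := Real.pi_pos
  unfold slopeConst
  positivity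

/-- The bound for `R(A)`, where `R` is a rational matrix function bounded by one. -/
theorem norm_matRatEval_le {Ω : Set ℂ} (hopen : IsOpen Ω) (hconv : Convex ℝ Ω)
    {α : ℝ} (hα : 0 < α) (hα' : α ≤ Real.pi / 2) {a : ℂ} {φ : ℝ} (hsec : sector a φ α ⊆ Ω)
    {A : H →L[ℂ] H} (hA : closure (numericalRange A) ⊆ Ω) {m n : ℕ}
    {R : Matrix (Fin m) (Fin n) (RatFunc ℂ)} (hR : MatBoundedByOne R Ω) :
    ‖matRatEval R A‖ ≤ slopeConst (Real.tan (Real.pi / 2 - α)) := by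
  refine opNorm_le_of_norm_inner_le (slopeConst_nonneg (tan_pi_div_two_sub_nonneg hα hα'))
    fun x y => ?_
  have h1 : ⟪y, matRatEval R A x⟫ = ∑ i, ∑ j, ⟪y i, ratEval (R i j) A (x j)⟫ := by
    simp only [PiLp.inner_apply, matRatEval, blockOperator_apply, inner_sum]
  rw [h1, PiLp.norm_sq_eq_of_L2, PiLp.norm_sq_eq_of_L2]
  refine norm_sum_inner_le_of_sector_subset hopen hconv hα hα' hsec hA
    (p := fun i j => (R i j).num) (d := fun i j => (R i j).denom) hR.1 (fun z hz => ?_)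
    (fun i => y i) fun i j => ?_
  · have h2 := hR.2 z hz
    have h3 : (Matrix.of fun i j => polyQuot (R i j).num (R i j).denom z) =
        R.map (RatFunc.eval (RingHom.id ℂ) z) := by
      ext i j
      simp [polyQuot, RatFunc.eval, eval₂_eq_eval_map]
    rwa [h3]
  · have hu := isUnit_aeval_of_eval_ne hopen hconv hA (R i j).denom_ne_zero (hR.1 i j)
    have h4 : aeval A (R i j).denom * ratEval (R i j) A = aeval A (R i j).num := by
      rw [ratEval, ← mul_assoc, ← map_mul, mul_comm (R i j).denom, map_mul, mul_assoc,
        Ring.mul_inverse_cancel _ hu, mul_one]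
    exact DFunLike.congr_fun h4 (x j)

end Operators

lemma BoundedByOne.matBoundedByOne {Ω : Set ℂ} {r : RatFunc ℂ} (hr : BoundedByOne r Ω) :
    MatBoundedByOne (Matrix.of fun _ _ : Fin 1 => r) Ω := by
  refine ⟨fun _ _ => hr.1, fun z hz => ?_⟩
  have h : (Matrix.of fun _ _ : Fin 1 => r).map (RatFunc.eval (RingHom.id ℂ) z) =
      Matrix.diagonal fun _ => r.eval (RingHom.id ℂ) z := by
    ext i j
    fin_cases i; fin_cases j
    simp
  rw [h, Matrix.l2_opNorm_diagonal]
  exact (pi_norm_le_iff_of_nonneg zero_le_one).2 fun _ => hr.2 z hz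

lemma norm_ratEval_le_norm_matRatEval {H : Type u} [NormedAddCommGroup H] [InnerProductSpace ℂ H]
    (r : RatFunc ℂ) (A : H →L[ℂ] H) :
    ‖ratEval r A‖ ≤ ‖matRatEval (Matrix.of fun _ _ : Fin 1 => r) A‖ := by
  refine ContinuousLinearMap.opNorm_le_bound _ (ContinuousLinearMap.opNorm_nonneg _) fun x => ?_
  have h := (matRatEval (Matrix.of fun _ _ : Fin 1 => r) A).le_opNorm (WithLp.toLp 2 fun _ => x)
  rw [PiLp.norm_eq_of_L2, PiLp.norm_eq_of_L2] at h
  simpa [matRatEval, blockOperator_apply] using h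

end ConvexFunctionalCalculus

end

theorem mainTheorem2 (Ω : Set ℂ) (hopen : IsOpen Ω) (hconv : Convex ℝ Ω) (hne : Ω ≠ Set.univ)
    (α : ℝ) (hα : 0 < α) (hα' : α ≤ Real.pi / 2)
    (hsector : ∃ (a : ℂ) (φ : ℝ), ConvexFunctionalCalculus.sector a φ α ⊆ Ω) :
    ConvexFunctionalCalculus.C.{u} Ω ≤ ConvexFunctionalCalculus.Ccb.{u} Ω ∧
      ConvexFunctionalCalculus.Ccb.{u} Ω ≤
        ENNReal.ofReal (1 + 2 / Real.pi *
          ∫ x in α..(Real.pi / 2), (Real.pi - x + Real.sin x) / Real.sin x) := by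
  open ConvexFunctionalCalculus in
  constructor
  · refine iSup_le fun H => iSup_le fun _ => iSup_le fun _ => iSup_le fun _ => iSup_le fun A =>
      iSup_le fun hA => iSup_le fun r => iSup_le fun hr => ?_
    refine (ENNReal.ofReal_le_ofReal (norm_ratEval_le_norm_matRatEval r A)).trans ?_
    exact le_iSup_of_le H <| le_iSup_of_le _ <| le_iSup_of_le _ <| le_iSup_of_le ‹_› <|
      le_iSup_of_le A <| le_iSup_of_le hA <| le_iSup_of_le 1 <| le_iSup_of_le 1 <|
      le_iSup_of_le _ <| le_iSup_of_le hr.matBoundedByOne le_rfl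
  · obtain ⟨a, φ, hsec⟩ := hsector
    rw [← slopeConst_eq hα hα']
    exact iSup_le fun H => iSup_le fun _ => iSup_le fun _ => iSup_le fun _ => iSup_le fun A =>
      iSup_le fun hA => iSup_le fun m => iSup_le fun n => iSup_le fun R => iSup_le fun hR =>
      ENNReal.ofReal_le_ofReal (norm_matRatEval_le hopen hconv hα hα' hsec hA hR)
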